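/- **Setting.** There are $M$ cells, exactly $L$ of which are anomalous, $1\le L<M$; the set $\mathcal D$ of anomalous cells has a prior $\pi$ with $\pi_{\mathcal D}>0$ for every $L$-subset $\mathcal D$. At each time step at most $K$ cells are probed, $L\le K\le M$. All observations are independent; an observation has law $g$ in an anomalous cell and law $f$ in a normal cell, where $f,g$ are known probability laws with $0<D(g\|f)<\infty$ and $0<D(f\|g)<\infty$ (Kullback–Leibler divergences). A policy $\Gamma$ (adaptive, possibly randomized, measurable) chooses from the past observations which cells to probe, when to stop (time $\tau$) and which set $\delta$ to declare. $N_s(t)$ is the number of cells probed at time $t\ge 2$ that were not probed at time $t-1$, and $\tau_{switch}=\sum_{t=2}^{\tau}N_s(t)$. Averaging over the prior, $$P_e(\Gamma)=\mathbf P(\delta\ne\mathcal D),\qquad R(\Gamma)=P_e(\Gamma)+c\,\mathbf E[\tau]+s\,\mathbf E[\tau_{switch}],\qquad s=s(c)\ge0,\ s=O(c)\ \text{as } c\to0 .$$ Case 1 means $L\big(\tfrac{D(f\|g)}{D(g\|f)}+1\big)\le M$, Case 2 means that this fails; in Case 2 it is also assumed that $K\le M-L$. Put $$I^*=I^*(M,K,L)=\begin{cases}D(g\|f)+\dfrac{(K-L)D(f\|g)}{M-L}&\text{in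 Case 1},\\[2mm] \dfrac{K\,D(f\|g)}{M-L}&\text{in Case 2}.\end{cases}$$ **The Consecutive Controlled Sensing (CCS) policy.** Let $S_m(n)$ be the sum of the log-likelihood ratios $\log(g/f)$ of the observations made in cell $m$ up to time $n$, and $\mathcal H_1(n)=\{m:S_m(n)>0\}$. CCS stops at the first $n$ at which the $L$-th highest of the $S_m(n)$ exceeds the $(L+1)$-st highest by at least $-\log c$, and declares the $L$ cells with the highest $S_m(n)$. Until then: * *Exploration.* While $|\mathcal H_1(n)|\ne L$, the cells are probed one at a time, in round-robin order. * *Ordering.* When $|\mathcal H_1(n)|=L$ after an exploration step, or when $|\mathcal H_1(n)|=L$ but the set $\mathcal H_1(n)$ has changed, $\mathcal H_1(n)$ becomes the set of suspected anomalous cells. The other $M-L$ cells are concatenated in some order as unit intervals of a line of length $M-L$, and the line is cut into $N$ equal pieces, one for each of $N$ machines, where $N=K-L$ in Case 1 and $N=K$ in Case 2 (no such machine if $N=0$). The order is arbitrary, except that it does not change if the set of suspected anomalous cells is the same as at the preceding ordering, and that in Case 2 all cells which are suspected to be normal at both orderings keep their places. * *Exploitation.* As long as $\mathcal H_1(n)$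 stays the same, all machines work in parallel, and in Case 1 all cells of $\mathcal H_1(n)$ are probed as well. Each machine probes the cells of its piece consecutively from left to right; it leaves cell $j$ when $S_j(n)<\theta\,h$, where $h=\dfrac{N\,D(f\|g)\log c}{(M-L)\,I^*}$ and $\theta$ is the fraction of the interval of $j$ that lies in the piece of this machine or of later machines. A machine is idle when it has finished its piece, and while its current cell is still being probed by the next machine. **Theorem.** For every CCS policy of this form, with $R^*$ its Bayes risk: 1. There is a constant $A$ independent of $c$ with $P_e\le A\,c$ for all $c>0$. 2. The expected number of switchings $\mathbf E[\tau_{switch}]$ is bounded by a constant independent of $c$. 3. As $c\to0$, $$R^*\;\sim\;\frac{-c\log c}{I^*(M,K,L)}\;\sim\;\inf_\Gamma R(\Gamma),$$ where the infimum is over all policies that probe at most $K$ cells at a time, and $a\sim b$ means $a/b\to1$. CCS is itself such a policy. -/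

import Mathlib

open MeasureTheory InformationTheory Filter Topology Asymptotics
open scoped ENNReal NNReal

noncomputable section

namespace AnomalySearch

/-! ### Observation model

There are `M` cells. `f` is the law of an observation from a normal cell and `g` the law of an
observation from an anomalous cell; `D` is the set of anomalous cells. -/

/-- What is seen in one time step: `some y` at every probed cell, `none` at the other cells. -/
abbrev Record (M : ℕ) (Y : Type*) := Fin M → Option Y

/-- The decision taken before a time step: probe a set of cells, or stop and declare a set of
cells to be the anomalous ones. -/
inductive Action (M : ℕ) where
  | probe (A : Finset (Fin M))
  | declare (D : Finset (Fin M))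

/-- A search policy `(τ, δ, φ)`: it maps the records seen so far (latest record first) and a
random seed (which a deterministic policy ignores) to the next action. -/
abbrev Policy (M : ℕ) (Y : Type*) := unitInterval → List (Record M Y) → Action M

/-- The sample space: the seed of the policy, and for every cell `i` and every `r` the outcome
`X (i, r)` of the `r`-th probe (counted from `0`) of cell `i`. -/
abbrev Sample (M : ℕ) (Y : Type*) := unitInterval × (Fin M × ℕ → Y)

/-- The law of all observations when `D` is the set of anomalous cells: all observations are
independent, with law `g` in the cells of `D` and law `f` in the other cells, and they are
independent of the seed, which is uniform on `[0, 1]`. -/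
def hypLaw {M : ℕ} {Y : Type*} [MeasurableSpace Y] (f g : Measure Y) (D : Finset (Fin M)) :
    Measure (Sample M Y) :=
  (volume : Measure unitInterval).prod
    (Measure.infinitePi fun p : Fin M × ℕ => if p.1 ∈ D then g else f)

/-- How often cell `i` has been probed in the history `h`. -/
def probeCount {M : ℕ} {Y : Type*} (h : List (Record M Y)) (i : Fin M) : ℕ :=
  h.countP fun r => (r i).isSome

/-- The record produced by probing the cells of `A` after the history `h`. -/
def nextRecord {M : ℕ} {Y : Type*} (X : Fin M × ℕ → Y) (A : Finset (Fin M))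
    (h : List (Record M Y)) : Record M Y :=
  fun i => if i ∈ A then some (X (i, probeCount h i)) else none

namespace Policy

variable {M : ℕ} {Y : Type*}

/-- The history after `n` time steps; it does not grow any more once the policy has stopped. -/
def history (Γ : Policy M Y) (ω : Sample M Y) : ℕ → List (Record M Y)
  | 0 => []
  | n + 1 =>
    match Γ ω.1 (history Γ ω n) with
    | Action.probe A => nextRecord ω.2 A (history Γ ω n) :: history Γ ω n
    | Action.declare _ => history Γ ω n

/-- The action taken after `n` time steps. -/
def action (Γ : Policy M Y) (ω : Sample M Y) (n : ℕ) : Action M := Γ ω.1 (history Γ ω n)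

/-- The set of cells probed in time step `n + 1` (empty after stopping). -/
def probed (Γ : Policy M Y) (ω : Sample M Y) (n : ℕ) : Finset (Fin M) :=
  match Γ.action ω n with
  | Action.probe A => A
  | Action.declare _ => ∅

/-- The stopping time `τ`: the number of time steps made before a declaration. -/
def stopTime (Γ : Policy M Y) (ω : Sample M Y) : ℕ∞ :=
  ⨅ (n : ℕ) (_ : ∃ D, Γ.action ω n = Action.declare D), (n : ℕ∞)

/-- `D` is what the policy declares when it stops. -/
def Declares (Γ : Policy M Y) (ω : Sample M Y) (D : Finset (Fin M)) : Prop :=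
  ∃ n, Γ.action ω n = Action.declare D

/-- The total number of switchings: in every time step after the first, every probed cell that was
not probed in the preceding time step counts once. -/
def switchings (Γ : Policy M Y) (ω : Sample M Y) : ℝ≥0∞ :=
  ∑' n : ℕ, ((Γ.probed ω (n + 1) \ Γ.probed ω n).card : ℝ≥0∞)

/-- The policies that can be carried out with `K` probing machines: at most `K` cells are probed
at a time, and all decisions are measurable. -/
structure IsAdmissible [MeasurableSpace Y] (Γ : Policy M Y) (K : ℕ) : Prop where
  card_le : ∀ u h A, Γ u h = Action.probe A → A.card ≤ K
  measurable : ∀ (n : ℕ) (a : Action M), MeasurableSet {ω : Sample M Y | Γ.action ω n = a}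

variable [MeasurableSpace Y]

/-- The average over the prior `π` on the `L`-subsets of the cells of a quantity that depends on
the set of anomalous cells. -/
def average (L : ℕ) (π : Finset (Fin M) → ℝ≥0) (v : Finset (Fin M) → ℝ≥0∞) : ℝ≥0∞ :=
  ∑ D ∈ Finset.powersetCard L Finset.univ, (π D : ℝ≥0∞) * v D

/-- The error probability: the set of anomalous cells is not declared. -/
def errorProb (f g : Measure Y) (L : ℕ) (π : Finset (Fin M) → ℝ≥0) (Γ : Policy M Y) : ℝ≥0∞ :=
  average L π fun D => hypLaw f g D {ω | ¬ Γ.Declares ω D}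

/-- The expected detection delay. -/
def expectedDelay (f g : Measure Y) (L : ℕ) (π : Finset (Fin M) → ℝ≥0) (Γ : Policy M Y) :
    ℝ≥0∞ :=
  average L π fun D => ∫⁻ ω, ((Γ.stopTime ω : ℕ∞) : ℝ≥0∞) ∂(hypLaw f g D)

/-- The expected number of switchings. -/
def expectedSwitchings (f g : Measure Y) (L : ℕ) (π : Finset (Fin M) → ℝ≥0) (Γ : Policy M Y) :
    ℝ≥0∞ :=
  average L π fun D => ∫⁻ ω, Γ.switchings ω ∂(hypLaw f g D)

/-- The Bayes risk with cost `c` per time step and cost `s` per switching. -/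
def bayesRisk (f g : Measure Y) (L : ℕ) (π : Finset (Fin M) → ℝ≥0) (c s : ℝ) (Γ : Policy M Y) :
    ℝ≥0∞ :=
  Γ.errorProb f g L π + ENNReal.ofReal c * Γ.expectedDelay f g L π
    + ENNReal.ofReal s * Γ.expectedSwitchings f g L π

end Policy

/-! ### The rate function -/

/-- Kullback-Leibler divergence as a real number. -/
def klReal {Y : Type*} [MeasurableSpace Y] (μ ν : Measure Y) : ℝ := (klDiv μ ν).toReal

/-- The first of the two cases: `L (D(f||g) / D(g||f) + 1) ≤ M`. -/
def CaseOne {Y : Type*} [MeasurableSpace Y] (f g : Measure Y) (M L : ℕ) : Prop :=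
  (L : ℝ) * (klReal f g / klReal g f + 1) ≤ M

open scoped Classical in
/-- The rate function `I*(M, K, L)`. -/
def rate {Y : Type*} [MeasurableSpace Y] (f g : Measure Y) (M K L : ℕ) : ℝ :=
  if CaseOne f g M L then klReal g f + ((K : ℝ) - L) * klReal f g / ((M : ℝ) - L)
  else (K : ℝ) * klReal f g / ((M : ℝ) - L)

/-! ### The Consecutive Controlled Sensing policy -/

/-- The cells with positive sum LLR. -/
def positives {M : ℕ} (S : Fin M → ℝ) : Finset (Fin M) := {i | 0 < S i}

/-- The `L` cells with the highest sum LLRs, ties being broken in favour of the smaller index. -/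
def top {M : ℕ} (L : ℕ) (S : Fin M → ℝ) : Finset (Fin M) :=
  {i | (({j | S i < S j ∨ (S i = S j ∧ j < i)} : Finset (Fin M)).card) < L}

/-- The difference between the `L`-th and the `(L+1)`-st highest sum LLR is at least `b`. -/
def GapAtLeast {M : ℕ} (L : ℕ) (S : Fin M → ℝ) (b : ℝ) : Prop :=
  ∀ i ∈ top L S, ∀ j ∉ top L S, b ≤ S i - S j

/-- How the `M - L` suspected normal cells are concatenated before an exploitation phase.
`order prev H p` is the cell that gets the place `p` when `H` is the set of suspected anomalous
cells and `prev` is the preceding order (`none` before the first ordering). The order is arbitrary,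
but it is not changed when the set of suspected cells is found unchanged. -/
structure OrderingRule (M L : ℕ) where
  order : Option (Fin (M - L) → Fin M) → Finset (Fin M) → Fin (M - L) → Fin M
  injective : ∀ prev H, H.card = L → Function.Injective (order prev H)
  notMem : ∀ prev H, H.card = L → ∀ p, order prev H p ∉ H
  keep : ∀ (q : Fin (M - L) → Fin M) (H : Finset (Fin M)), H.card = L → Function.Injective q →
    (∀ p, q p ∉ H) → order (some q) H = q

/-- When the set of suspected anomalous cells changes, the cells that are still suspected to be
normal keep their places; the other places are filled arbitrarily. -/
def OrderingRule.IsStable {M L : ℕ} (R : OrderingRule M L) : Prop :=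
  ∀ (q : Fin (M - L) → Fin M) (H : Finset (Fin M)), H.card = L → Function.Injective q →
    ∀ p, q p ∉ H → R.order (some q) H p = q p

/-- What the CCS policy remembers: the sum LLRs, the counter of the round-robin exploration, the
latest order of the suspected normal cells, the set of suspected anomalous cells of the running
exploitation phase (`none` in an exploration phase), and for every machine that serves suspected
normal cells the place which it currently serves. -/
structure CCSState (M L N : ℕ) where
  llr : Fin M → ℝ
  turn : ℕ
  plan : Option (Fin (M - L) → Fin M)
  suspects : Option (Finset (Fin M))
  pos : Fin N → ℕ

/-! `N` machines serve the `M - L` suspected normal cells. Place `p` is the interval `[p, p + 1)`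
of the line `[0, M - L)`, and machine `r` (counted from `0`) gets the interval
`[r (M - L) / N, (r + 1) (M - L) / N)`, which it serves from left to right. -/

/-- Place `p` does not lie to the right of the interval of machine `r`. -/
def InMachine (M L N : ℕ) (r p : ℕ) : Prop :=
  p < M - L ∧ p * N < (r + 1) * (M - L)

/-- The share of place `p` that belongs to machine `r` or to a later machine: it is `q^r_j` when
the place has begun in the preceding machine, and `1` otherwise. -/
def share (M L N : ℕ) (r p : ℕ) : ℝ :=
  min 1 ((((p : ℝ) + 1) * N - (r : ℝ) * ((M : ℝ) - L)) / N)

open scoped Classical in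
/-- Machine `r`, serving place `p`, goes on to the next place if the sum LLR of the cell at place
`p` is below its share of the level `b`. -/
def advanceOnce {M L N : ℕ} (b : ℝ) (S : Fin M → ℝ) (q : Fin (M - L) → Fin M) (r p : ℕ) : ℕ :=
  if h : InMachine M L N r p then
    if S (q ⟨p, h.1⟩) < share M L N r p * b then p + 1 else p
  else p

/-- Machine `r` passes over all places that are finished. -/
def advance {M L N : ℕ} (b : ℝ) (S : Fin M → ℝ) (q : Fin (M - L) → Fin M) (r p : ℕ) : ℕ :=
  (advanceOnce (N := N) b S q r)^[M] p

open scoped Classical in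
/-- The cells probed by the machines that serve suspected normal cells. A machine has nothing to
probe when it is done, and it is idle as long as its cell is still probed by another machine (the
union over the machines contains such a cell only once). -/
def machineCells {M L N : ℕ} (q : Fin (M - L) → Fin M) (pos : Fin N → ℕ) : Finset (Fin M) :=
  {i | ∃ (r : Fin N) (h : InMachine M L N r (pos r)), q ⟨pos r, h.1⟩ = i}

section Policy

variable {Y : Type*} [MeasurableSpace Y]

open scoped Classical in
/-- The number of machines for suspected normal cells: `K - L` in the first case (the suspected
anomalous cells occupy the other `L` machines), `K` in the second case. -/
def normalMachines (f g : Measure Y) (M K L : ℕ) : ℕ :=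
  if CaseOne f g M L then K - L else K

/-- The level which the sum LLR of a suspected normal cell has to reach. -/
def level (f g : Measure Y) (M K L : ℕ) (c : ℝ) : ℝ :=
  (normalMachines f g M K L : ℝ) * klReal f g * Real.log c / (((M : ℝ) - L) * rate f g M K L)

/-- Initially all sum LLRs are zero and the policy explores. -/
def ccsInit (M L N : ℕ) : CCSState M L N :=
  { llr := fun _ => 0, turn := 0, plan := none, suspects := none, pos := fun _ => 0 }

open scoped Classical in
/-- Update after a time step: the sum LLRs are updated; if exactly `L` of them are positive, then
the running exploitation phase goes on, or, if the policy was exploring or the set of positive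
cells has changed, a new order is set and every machine starts at its first place. -/
def ccsUpdate {M L N : ℕ} (f g : Measure Y) (b : ℝ) (R : OrderingRule M L)
    (st : CCSState M L N) (row : Record M Y) : CCSState M L N :=
  let S : Fin M → ℝ := fun i => st.llr i + (row i).elim 0 (llr g f)
  let t : ℕ := if st.suspects = none then st.turn + 1 else st.turn
  let H := positives S
  if H.card = L then
    match st.plan, decide (st.suspects = some H) with
    | some q, true =>
      { llr := S, turn := t, plan := some q, suspects := some H,
        pos := fun r => advance (N := N) b S q r (st.pos r) }
    | prev, _ =>
      { llr := S, turn := t, plan := some (R.order prev H), suspects := some H,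
        pos := fun r => advance (N := N) b S (R.order prev H) r (r * (M - L) / N) }
  else
    { llr := S, turn := t, plan := st.plan, suspects := none, pos := fun _ => 0 }

/-- The state of the CCS policy after a history (latest record first). -/
def ccsState {M L : ℕ} (N : ℕ) (f g : Measure Y) (b : ℝ) (R : OrderingRule M L) :
    List (Record M Y) → CCSState M L N
  | [] => ccsInit M L N
  | row :: h => ccsUpdate f g b R (ccsState N f g b R h) row

open scoped Classical in
/-- The set of cells probed by the CCS policy: one cell in round-robin order in an exploration
phase; in an exploitation phase the cells scheduled on the machines for suspected normal cells and,
in the first case, also all suspected anomalous cells. -/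
def ccsProbe {M L N : ℕ} (f g : Measure Y) (st : CCSState M L N) : Finset (Fin M) :=
  match st.suspects, st.plan with
  | some H, some q => (if CaseOne f g M L then H else ∅) ∪ machineCells q st.pos
  | _, _ => {i | (i : ℕ) = st.turn % M}

open scoped Classical in
/-- The Consecutive Controlled Sensing policy with cost `c` per time step. It stops as soon as the
gap between the `L`-th and the `(L+1)`-st highest sum LLR is at least `-log c`. -/
def ccs {M : ℕ} (K : ℕ) {L : ℕ} (f g : Measure Y) (R : OrderingRule M L) (c : ℝ) : Policy M Y :=
  fun _ h =>
    let st := ccsState (normalMachines f g M K L) f g (level f g M K L c) R h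
    if GapAtLeast L st.llr (-Real.log c) then Action.declare (top L st.llr)
    else Action.probe (ccsProbe f g st)

end Policy

end AnomalySearch

end

open AnomalySearch

noncomputable section

namespace AnomalySearch

/-! ### Advancing machines -/

/-! Observations are indexed by cell and probe number. Hence the sum LLR of a cell after its k-th
probe is a random walk that does not depend on the policy, and CCS is a deterministic machine fed
with these walks. The upper bounds split into a pathwise part, about `Trajectory`, and a
probabilistic part, about the walks. Write b for -log c.

Lower bound. A policy that is reliable under D and under every set got from D by swapping an
anomalous cell i for a normal cell j must collect a log-likelihood ratio of about b against each
such neighbour (`le_integral_llr`). By Wald's identity (`integral_walk_count`) its expectation is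
D(g||f) E N_i + D(f||g) E N_j, with N the numbers of probes. Averaging over all pairs (i, j), with
N_i ≤ τ and ∑ N_i ≤ K τ, gives a linear program with value I* E τ (`rate_bound`); the two cases say
whether anomalous or normal cells yield more. Error probabilities above a constant times c b are too
expensive anyway (`eventually_le_bayesRisk`).

Sharp upper bound. Without fluctuations every machine would finish its piece after the time b / I*,
and in Case 1 the anomalous sums would by then have climbed high enough for the gap to be b. Cells
cut between two machines are treated as in the wrap-around rule of preemptive scheduling: the later
machine serves its share first, the earlier one last. With fluctuations, only few steps explore,
probe a cell whose sign is not yet settled, or serve a cell again that was already low enough. In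
all other steps the places keep their cells and the machines move to the right only, so the ideal
time bound survives up to errors (`card_le_of_unfinished`, `card_le_of_finished`, `time_le`).

Fluctuations. A single integrable variable U, the `envelope`, bounds how far all walks fall behind
their drifts on all intervals. Finite divergences suffice for this, because only one-sided
exponential moments enter and those are integrals of likelihood ratios
(`exists_lintegral_exp_lt_one`, `lintegral_envelope_lt_top`). Always τ = O(1 + b + U); if U ≤ ε b
the sharp bound holds, and otherwise b < U / ε, so that the crude bound is O(1 + U). Integrating
gives E τ ≤ (1 / I* + η) b + O(1).

Switchings are counted by a potential argument whose bound O(1 + U) does not involve c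
(`sum_switchings_le`). For the errors: when a wrong set is declared, some swapped hypothesis is at
least 1/c times as likely as the true one, so each wrong declaration has probability at most c
(`measure_ccs_declares_le`). -/

theorem iterate_conditional_succ (P : ℕ → Prop) (F : ℕ → ℕ) (h₁ : ∀ p, P p → F p = p + 1)
    (h₂ : ∀ p, ¬ P p → F p = p) (m p : ℕ) :
    p ≤ F^[m] p ∧ (∀ p', p ≤ p' → p' < F^[m] p → P p') ∧ (¬ P (F^[m] p) ∨ F^[m] p = p + m) := by
  induction m with
  | zero => exact ⟨le_rfl, fun p' h h' => absurd h' (by simpa using h), Or.inr rfl⟩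
  | succ m ih =>
    obtain ⟨a, b, c⟩ := ih
    rw [Function.iterate_succ_apply']
    by_cases hP : P (F^[m] p)
    · rw [h₁ _ hP]
      refine ⟨by omega, fun p' h h' => ?_, Or.inr ?_⟩
      · rcases Nat.lt_succ_iff_lt_or_eq.1 h' with h' | h'
        · exact b p' h h'
        · exact h' ▸ hP
      · rcases c with c | c
        · exact absurd hP c
        · omega
    · rw [h₂ _ hP]
      exact ⟨a, b, Or.inl hP⟩

section Advance

variable {M L N : ℕ} (h : ℝ) (S : Fin M → ℝ) (q : Fin (M - L) → Fin M) (r p : ℕ)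

/-- Every proper move raises the place by one and only `M - L` places exist, so `M` iterations
certainly end in a fixed point of `advanceOnce`. The pathwise analysis uses `advance` through these
three clauses. -/
theorem advance_spec :
    p ≤ advance (N := N) h S q r p ∧
    (∀ p', p ≤ p' → p' < advance (N := N) h S q r p →
      ∃ hp : InMachine M L N r p', S (q ⟨p', hp.1⟩) < share M L N r p' * h) ∧
    ∀ hp : InMachine M L N r (advance (N := N) h S q r p),
      share M L N r (advance (N := N) h S q r p) * h ≤
        S (q ⟨advance (N := N) h S q r p, hp.1⟩) := by
  obtain ⟨a, b, c⟩ := iterate_conditional_succ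
    (fun p' => ∃ hp : InMachine M L N r p', S (q ⟨p', hp.1⟩) < share M L N r p' * h)
    (advanceOnce (N := N) h S q r)
    (fun p' hp => by simp only [advanceOnce, dif_pos hp.1, if_pos hp.2])
    (fun p' hp => by
      unfold advanceOnce
      split_ifs with h1 h2
      · exact absurd ⟨h1, h2⟩ hp
      · rfl
      · rfl) M p
  refine ⟨a, b, fun hp => ?_⟩
  rcases c with c | c
  · by_contra hlt
    exact c ⟨hp, not_le.1 hlt⟩
  · have h1 := hp.1
    have h2 : advance (N := N) h S q r p = p + M := c
    omega

theorem advance_le (hp : p ≤ M - L) : advance (N := N) h S q r p ≤ M - L := by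
  by_contra hlt
  push Not at hlt
  obtain ⟨hq, -⟩ := (advance_spec (N := N) h S q r p).2.1 (M - L) hp hlt
  exact absurd hq.1 (lt_irrefl _)

end Advance

/-- The first place of machine `r`. -/
def firstPlace (M L N r : ℕ) : ℕ := r * (M - L) / N

theorem firstPlace_le {M L N r : ℕ} (hr : r < N) : firstPlace M L N r ≤ M - L := by
  unfold firstPlace
  apply Nat.div_le_of_le_mul
  exact Nat.mul_le_mul_right _ hr.le

theorem share_le_one {M L N r p : ℕ} : share M L N r p ≤ 1 := min_le_left _ _

/-- All interval ends are multiples of 1/N, so a strict inequality between them gains a full 1/N.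
The uniform bound matters in Case 2: a cell passed at its share has to be so low that no anomalous
cell gets there. -/
theorem inv_le_share {M L N r p : ℕ} (hLM : L < M) (hN : 0 < N) (hp : firstPlace M L N r ≤ p) :
    1 / (N : ℝ) ≤ share M L N r p := by
  have hN' : (0 : ℝ) < N := by exact_mod_cast hN
  have h1 : r * (M - L) < (p + 1) * N := by
    have := Nat.lt_mul_div_succ (r * (M - L)) hN
    unfold firstPlace at hp
    calc r * (M - L) < N * (r * (M - L) / N + 1) := this
      _ ≤ N * (p + 1) := Nat.mul_le_mul_left _ (by omega)
      _ = _ := mul_comm _ _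
  have h2 : (r : ℝ) * ((M : ℝ) - L) + 1 ≤ ((p : ℝ) + 1) * N := by
    have : ((r * (M - L) + 1 : ℕ) : ℝ) ≤ (((p + 1) * N : ℕ) : ℝ) := by exact_mod_cast h1
    push_cast [Nat.cast_sub hLM.le] at this
    exact this
  unfold share
  refine le_min ?_ ?_
  · rw [div_le_one hN']; exact_mod_cast hN
  · gcongr; linarith

theorem share_pos {M L N r p : ℕ} (hLM : L < M) (hN : 0 < N) (hp : firstPlace M L N r ≤ p) :
    0 < share M L N r p :=
  lt_of_lt_of_le (by positivity) (inv_le_share hLM hN hp)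

/-! ### Runs of the CCS policy without stopping -/

/-- A run of the state machine of the CCS policy that never stops. The sum LLR of cell `i` after
its `k`-th probe is `W i k`; `one` says that the suspected anomalous cells are probed as well. -/
structure Trajectory (M L N : ℕ) (one : Prop) (h : ℝ) (R : OrderingRule M L)
    (W : Fin M → ℕ → ℝ) where
  count : ℕ → Fin M → ℕ
  turn : ℕ → ℕ
  plan : ℕ → Option (Fin (M - L) → Fin M)
  suspects : ℕ → Option (Finset (Fin M))
  pos : ℕ → Fin N → ℕ
  probe : ℕ → Finset (Fin M)
  count_zero : ∀ i, count 0 i = 0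
  turn_zero : turn 0 = 0
  suspects_zero : suspects 0 = none
  pos_zero : ∀ r, pos 0 r = 0
  count_succ : ∀ n i, count (n + 1) i = if i ∈ probe n then count n i + 1 else count n i
  turn_succ : ∀ n, turn (n + 1) = if suspects n = none then turn n + 1 else turn n
  lost : ∀ n, (positives fun i => W i (count (n + 1) i)).card ≠ L →
    suspects (n + 1) = none ∧ plan (n + 1) = plan n ∧ ∀ r, pos (n + 1) r = 0
  goOn : ∀ n q, (positives fun i => W i (count (n + 1) i)).card = L →
    suspects n = some (positives fun i => W i (count (n + 1) i)) → plan n = some q →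
    suspects (n + 1) = suspects n ∧ plan (n + 1) = some q ∧
    ∀ r, pos (n + 1) r = advance (N := N) h (fun i => W i (count (n + 1) i)) q r (pos n r)
  renew : ∀ n, (positives fun i => W i (count (n + 1) i)).card = L →
    suspects n ≠ some (positives fun i => W i (count (n + 1) i)) →
    suspects (n + 1) = some (positives fun i => W i (count (n + 1) i)) ∧
    plan (n + 1) = some (R.order (plan n) (positives fun i => W i (count (n + 1) i))) ∧
    ∀ r, pos (n + 1) r = advance (N := N) h (fun i => W i (count (n + 1) i))
      (R.order (plan n) (positives fun i => W i (count (n + 1) i))) r (firstPlace M L N r)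
  explore : ∀ n, suspects n = none → ∀ i : Fin M, i ∈ probe n ↔ (i : ℕ) = turn n % M
  exploit : ∀ n H q, suspects n = some H → plan n = some q →
    ∀ i, i ∈ probe n ↔ (one ∧ i ∈ H) ∨ i ∈ machineCells q (pos n)

namespace Trajectory

variable {M L N : ℕ} {one : Prop} {h : ℝ} {R : OrderingRule M L} {W : Fin M → ℕ → ℝ}
  (T : Trajectory M L N one h R W)

/-- The sum LLRs at time `n`. -/
def sums (n : ℕ) (i : Fin M) : ℝ := W i (T.count n i)

/-- At time `n` the run exploits with the suspected set `H` and the order `q`. -/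
structure Phase (n : ℕ) (H : Finset (Fin M)) (q : Fin (M - L) → Fin M) : Prop where
  suspects : T.suspects n = some H
  plan : T.plan n = some q

/-- Exploration ends at the very step at which exactly `L` sums are positive. At time 0 no sum is
positive, which differs from `L` because `1 ≤ L`. -/
theorem card_positives_of_explore (hW : ∀ i, W i 0 = 0) (hL : 1 ≤ L) {n : ℕ}
    (hn : T.suspects n = none) : (positives (T.sums n)).card ≠ L := by
  cases n with
  | zero =>
    have : positives (T.sums 0) = ∅ := by
      simp [positives, sums, T.count_zero, hW]
    rw [this]; simp; omega
  | succ n =>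
    intro hc
    by_cases hs : T.suspects n = some (positives (T.sums (n + 1)))
    · cases hp : T.plan n with
      | none =>
        -- An exploitation phase always has an order, so an unchanged suspected set is covered by
        -- `goOn`.
        have hp' : ∀ m, T.plan m = none → T.suspects m = none := by
          intro m
          induction m with
          | zero => intro _; exact T.suspects_zero
          | succ m ih =>
            intro hm
            by_cases h1 : (positives (T.sums (m + 1))).card = L
            · by_cases h2 : T.suspects m = some (positives (T.sums (m + 1)))
              · cases hq : T.plan m with
                | none => exact absurd (ih hq) (by simp [h2])
                | some q => exact absurd (T.goOn m q h1 h2 hq).2.1 (by simp [hm])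
              · exact absurd (T.renew m h1 h2).2.1 (by simp [hm])
            · exact (T.lost m h1).1
        exact absurd (hp' n hp) (by simp [hs])
      | some q =>
        have := (T.goOn n q hc hs hp).1
        rw [hn, hs] at this
        exact absurd this (by simp)
    · have := (T.renew n hc hs).1
      rw [hn] at this
      exact absurd this (by simp)

/-- What holds throughout an exploitation phase. -/
structure Invariants (n : ℕ) (H : Finset (Fin M)) (q : Fin (M - L) → Fin M) : Prop where
  eq_positives : H = positives (T.sums n)
  card_eq : H.card = L
  injective : Function.Injective q
  notMem : ∀ p, q p ∉ H
  first_le : ∀ r : Fin N, firstPlace M L N r ≤ T.pos n r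
  pos_le : ∀ r : Fin N, T.pos n r ≤ M - L
  share_mul_le : ∀ (r : Fin N) (p : Fin (M - L)), (p : ℕ) = T.pos n r →
    InMachine M L N r p → share M L N r p * h ≤ T.sums n (q p)
  inMachine : ∀ (r : Fin N) (p : Fin (M - L)), firstPlace M L N r ≤ p → (p : ℕ) < T.pos n r →
    InMachine M L N r p
  passed : ∀ (r : Fin N) (p : Fin (M - L)), firstPlace M L N r ≤ p → (p : ℕ) < T.pos n r →
    ∃ m ≤ n, T.sums m (q p) < share M L N r p * h

/-- Induction over time with `advance_spec`: if the phase goes on, the evidence for the places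
passed earlier is kept; if a new order is set, all evidence starts afresh at the first places of the
machines. -/
theorem exists_phase_or_explore (n : ℕ) :
    T.suspects n = none ∨ ∃ H q, T.Phase n H q ∧ T.Invariants n H q := by
  induction n with
  | zero => exact Or.inl T.suspects_zero
  | succ n ih =>
    by_cases hc : (positives (T.sums (n + 1))).card = L
    swap
    · exact Or.inl (T.lost n hc).1
    right
    by_cases hs : T.suspects n = some (positives (T.sums (n + 1)))
    · rcases ih with ih | ⟨H, q, hph, hi⟩
      · simp [ih] at hs
      obtain ⟨e1, e2, e3⟩ := T.goOn n q hc hs hph.plan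
      have hH : H = positives (T.sums (n + 1)) := by
        have := hph.suspects
        rw [hs] at this
        exact (Option.some_injective _ this).symm
      refine ⟨H, q, ⟨by rw [e1, hph.suspects], e2⟩, hH, hi.card_eq, hi.injective, hi.notMem,
        ?_, ?_, ?_, ?_, ?_⟩
      · intro r
        rw [e3]
        exact (hi.first_le r).trans (advance_spec _ _ _ _ _).1
      · intro r
        rw [e3]
        exact advance_le _ _ _ _ _ (hi.pos_le r)
      · intro r p hp hin
        have h3 := (advance_spec (N := N) h (T.sums (n + 1)) q r (T.pos n r)).2.2
        have h4 : advance (N := N) h (T.sums (n + 1)) q r (T.pos n r) = p := by rw [hp, e3]; rfl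
        rw [h4] at h3
        exact h3 hin
      · intro r p hp hlt
        by_cases h5 : (p : ℕ) < T.pos n r
        · exact hi.inMachine r p hp h5
        · rw [e3] at hlt
          obtain ⟨h6, -⟩ := (advance_spec (N := N) h (T.sums (n + 1)) q r (T.pos n r)).2.1 p
            (not_lt.1 h5) hlt
          exact h6
      · intro r p hp hlt
        by_cases h5 : (p : ℕ) < T.pos n r
        · obtain ⟨m, hm, h6⟩ := hi.passed r p hp h5
          exact ⟨m, by omega, h6⟩
        · rw [e3] at hlt
          obtain ⟨h6, h7⟩ := (advance_spec (N := N) h (T.sums (n + 1)) q r (T.pos n r)).2.1 p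
            (not_lt.1 h5) hlt
          exact ⟨n + 1, le_rfl, h7⟩
    · obtain ⟨e1, e2, e3⟩ := T.renew n hc hs
      refine ⟨_, _, ⟨e1, e2⟩, rfl, hc, R.injective _ _ hc, R.notMem _ _ hc, ?_, ?_, ?_, ?_, ?_⟩
      · intro r
        rw [e3]
        exact (advance_spec _ _ _ _ _).1
      · intro r
        rw [e3]
        exact advance_le _ _ _ _ _ (firstPlace_le r.2)
      · intro r p hp hin
        have h3 := (advance_spec (N := N) h (T.sums (n + 1))
          (R.order (T.plan n) (positives (T.sums (n + 1)))) r (firstPlace M L N r)).2.2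
        have h4 : advance (N := N) h (T.sums (n + 1))
          (R.order (T.plan n) (positives (T.sums (n + 1)))) r (firstPlace M L N r) = p := by
          rw [hp, e3]; rfl
        rw [h4] at h3
        exact h3 hin
      · intro r p hp hlt
        rw [e3] at hlt
        obtain ⟨h6, -⟩ := (advance_spec (N := N) h (T.sums (n + 1))
          (R.order (T.plan n) (positives (T.sums (n + 1)))) r (firstPlace M L N r)).2.1 p hp hlt
        exact h6
      · intro r p hp hlt
        rw [e3] at hlt
        obtain ⟨h6, h7⟩ := (advance_spec (N := N) h (T.sums (n + 1))
          (R.order (T.plan n) (positives (T.sums (n + 1)))) r (firstPlace M L N r)).2.1 p hp hlt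
        exact ⟨n + 1, le_rfl, h7⟩

variable {T} in
theorem Phase.invariants {n : ℕ} {H : Finset (Fin M)} {q : Fin (M - L) → Fin M}
    (hph : T.Phase n H q) : T.Invariants n H q := by
  rcases T.exists_phase_or_explore n with h1 | ⟨H', q', hph', hi⟩
  · rw [hph.suspects] at h1; simp at h1
  · have e1 := hph.suspects.symm.trans hph'.suspects
    have e2 := hph.plan.symm.trans hph'.plan
    simp only [Option.some.injEq] at e1 e2
    rw [e1, e2]; exact hi

variable {T} in
theorem Invariants.surjective {n : ℕ} {H : Finset (Fin M)} {q : Fin (M - L) → Fin M}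
    (hi : T.Invariants n H q) {i : Fin M} (hiH : i ∉ H) : ∃ p, q p = i := by
  have h1 : (Finset.univ.image q) = Hᶜ := by
    apply Finset.eq_of_subset_of_card_le
    · intro x hx
      obtain ⟨p, -, rfl⟩ := Finset.mem_image.1 hx
      exact Finset.mem_compl.2 (hi.notMem p)
    · rw [Finset.card_image_of_injective _ hi.injective, Finset.card_compl, hi.card_eq]
      simp
  have h2 : i ∈ Finset.univ.image q := by rw [h1]; exact Finset.mem_compl.2 hiH
  obtain ⟨p, -, hp⟩ := Finset.mem_image.1 h2
  exact ⟨p, hp⟩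

theorem sums_of_notMem_probe {n : ℕ} {i : Fin M} (hi : i ∉ T.probe n) :
    T.sums (n + 1) i = T.sums n i := by
  simp [sums, T.count_succ, hi]

theorem count_mono (i : Fin M) : Monotone fun n => T.count n i := by
  refine monotone_nat_of_le_succ fun n => ?_
  rw [T.count_succ]; split_ifs <;> omega

/-- A cell whose place lies entirely in machine `r`, or begins there, stays below the level once
machine `r` has passed it. -/
theorem sums_lt_of_passed (hh : h ≤ 0) (hLM : L < M) (n : ℕ) :
    ∀ H q, T.Phase n H q → ∀ (r : Fin N) (p : Fin (M - L)), r * (M - L) ≤ p * N →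
      firstPlace M L N r ≤ p → (p : ℕ) < T.pos n r → T.sums n (q p) < h := by
  -- The condition says that the place begins in machine `r` or later, so the minimum in `share` is
  -- attained by 1.
  have hshare : ∀ (r : Fin N) (p : ℕ), r * (M - L) ≤ p * N → share M L N r p = 1 := by
    intro r p hrp
    have hN : (0 : ℝ) < N := by exact_mod_cast (Nat.zero_le _).trans_lt r.2
    have h1 : (r : ℝ) * ((M : ℝ) - L) ≤ p * N := by
      have : ((r * (M - L) : ℕ) : ℝ) ≤ ((p * N : ℕ) : ℝ) := by exact_mod_cast hrp
      push_cast [Nat.cast_sub hLM.le] at this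
      exact this
    unfold share
    rw [min_eq_left]
    rw [le_div_iff₀ hN]; linarith
  induction n with
  | zero =>
    intro H q hph
    have := hph.suspects
    rw [T.suspects_zero] at this; simp at this
  | succ n ih =>
    intro H q hph r p hrp hfp hlt
    have hi := hph.invariants
    have hc : (positives (T.sums (n + 1))).card = L := by rw [← hi.eq_positives, hi.card_eq]
    by_cases hs : T.suspects n = some (positives (T.sums (n + 1)))
    · rcases T.exists_phase_or_explore n with h1 | ⟨H', q', hph', hi'⟩
      · simp [h1] at hs
      obtain ⟨e1, e2, e3⟩ := T.goOn n q' hc hs hph'.plan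
      obtain rfl : q = q' := by
        have := hph.plan.symm.trans e2
        simpa using this
      by_cases h5 : (p : ℕ) < T.pos n r
      · have h6 := ih H' q hph' r p hrp hfp h5
        -- A cell below `h` is not probed any more in this phase: machines serve only cells with sum
        -- at least share times `h`, and this is at least `h` since `h ≤ 0` and shares are at most
        -- 1. Without a probe the sum does not change.
        by_cases hpr : q p ∈ T.probe n
        swap
        · rwa [T.sums_of_notMem_probe hpr]
        exfalso
        rw [T.exploit n H' q hph'.suspects hph'.plan] at hpr
        rcases hpr with hpr | hpr
        · exact hi'.notMem p hpr.2
        · simp only [machineCells, Finset.mem_filter, Finset.mem_univ, true_and] at hpr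
          obtain ⟨r', hin', e⟩ := hpr
          have e4 : (p : ℕ) = T.pos n r' := by
            have := hi'.injective e; rw [← this]
          have h7 := hi'.share_mul_le r' p e4 (e4 ▸ hin')
          have h8 : h ≤ share M L N r' p * h := by
            nlinarith [share_le_one (M := M) (L := L) (N := N) (r := r') (p := p)]
          linarith
      · rw [e3] at hlt
        obtain ⟨h6, h7⟩ := (advance_spec (N := N) h (T.sums (n + 1)) q r (T.pos n r)).2.1 p
          (not_lt.1 h5) hlt
        rw [hshare r p hrp, one_mul] at h7
        exact h7
    · obtain ⟨e1, e2, e3⟩ := T.renew n hc hs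
      obtain rfl := Option.some_injective _ (hph.plan.symm.trans e2)
      rw [e3] at hlt
      obtain ⟨h6, h7⟩ := (advance_spec (N := N) h (T.sums (n + 1))
          (R.order (T.plan n) (positives (T.sums (n + 1)))) r (firstPlace M L N r)).2.1 p hfp hlt
      rw [hshare r p hrp, one_mul] at h7
      exact h7

end Trajectory

/-! ### The stopping criterion -/

theorem mem_positives {M : ℕ} {S : Fin M → ℝ} {i : Fin M} : i ∈ positives S ↔ 0 < S i := by
  simp [positives]

/-- A positive cell is outranked only by the other positive cells, a nonpositive cell by all `L` of
them. -/
theorem top_eq_positives {M L : ℕ} {S : Fin M → ℝ} (hc : (positives S).card = L) :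
    top L S = positives S := by
  ext i
  simp only [top, Finset.mem_filter, Finset.mem_univ, true_and]
  by_cases hi : 0 < S i
  · have hi' : i ∈ positives S := by simpa [positives] using hi
    simp only [hi', iff_true]
    have h1 : ({j | S i < S j ∨ (S i = S j ∧ j < i)} : Finset (Fin M)) ⊆ (positives S).erase i := by
      intro j hj
      simp only [Finset.mem_filter, Finset.mem_univ, true_and] at hj
      simp only [positives, Finset.mem_erase, Finset.mem_filter, Finset.mem_univ, true_and]
      rcases hj with hj | ⟨hj, hlt⟩
      · exact ⟨fun e => by simp [e] at hj, hi.trans hj⟩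
      · exact ⟨hlt.ne, hj ▸ hi⟩
    have h2 := Finset.card_le_card h1
    have h3 := Finset.card_pos.2 ⟨i, hi'⟩
    rw [Finset.card_erase_of_mem hi'] at h2
    omega
  · have hi' : i ∉ positives S := by simpa [positives] using hi
    simp only [hi', iff_false, not_lt, ← hc]
    apply Finset.card_le_card
    intro j hj
    simp only [positives, Finset.mem_filter, Finset.mem_univ, true_and] at hj ⊢
    exact Or.inl ((not_lt.1 hi).trans_lt hj)

theorem gapAtLeast_of_positives {M L : ℕ} {S : Fin M → ℝ} {b : ℝ} (hc : (positives S).card = L)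
    (hb : ∀ i ∈ positives S, ∀ j ∉ positives S, b ≤ S i - S j) : GapAtLeast L S b := by
  unfold GapAtLeast
  rwa [top_eq_positives hc]

namespace Trajectory

variable {M L N : ℕ} {one : Prop} {h : ℝ} {R : OrderingRule M L} {W : Fin M → ℕ → ℝ}
  (T : Trajectory M L N one h R W)

/-! ### Counting probes -/

theorem count_lt_count {i : Fin M} {m n : ℕ} (hm : i ∈ T.probe m) (hmn : m < n) :
    T.count m i < T.count n i := by
  have h1 : T.count (m + 1) i = T.count m i + 1 := by rw [T.count_succ, if_pos hm]
  have h2 : T.count (m + 1) i ≤ T.count n i := T.count_mono i hmn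
  omega

/-- The count of the cell rises strictly from one step of `s` to the next, hence is injective on
`s`. In this way bounds for numbers of probes become bounds for time. -/
theorem card_le_of_count_mem (i : Fin M) (s : Finset ℕ) (a b : ℕ) (hs : ∀ n ∈ s, i ∈ T.probe n)
    (ha : ∀ n ∈ s, a ≤ T.count n i) (hb : ∀ n ∈ s, T.count n i < b) : s.card ≤ b - a := by
  rw [← Nat.card_Ico]
  refine Finset.card_le_card_of_injOn (fun n => T.count n i)
    (fun n hn => by simpa using ⟨ha n hn, hb n hn⟩) ?_
  intro m hm n hn e
  rcases lt_trichotomy m n with hlt | rfl | hlt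
  · exact absurd e (T.count_lt_count (hs m hm) hlt).ne
  · rfl
  · exact absurd e (T.count_lt_count (hs n hn) hlt).ne'

theorem card_le_of_count_le (i : Fin M) (s : Finset ℕ) (a : ℕ) (x : ℝ) (hx : 0 ≤ x)
    (hs : ∀ n ∈ s, i ∈ T.probe n) (ha : ∀ n ∈ s, a ≤ T.count n i)
    (hb : ∀ n ∈ s, (T.count n i : ℝ) ≤ a + x) : (s.card : ℝ) ≤ x + 1 := by
  have h1 := T.card_le_of_count_mem i s a (a + ⌊x⌋₊ + 1) hs ha (fun n hn => by
    have h2 := hb n hn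
    have h3 : ((T.count n i - a : ℕ) : ℝ) ≤ x := by
      rw [Nat.cast_sub (ha n hn)]; linarith
    have h4 := Nat.le_floor h3
    have := ha n hn
    omega)
  have h5 : s.card ≤ ⌊x⌋₊ + 1 := by omega
  have h6 : (s.card : ℝ) ≤ ⌊x⌋₊ + 1 := by exact_mod_cast h5
  linarith [Nat.floor_le hx]

open scoped Classical in
/-- The steps in which some cell is probed that has been probed fewer than `κ` times. -/
theorem card_young_le (κ m : ℕ) :
    ((Finset.range m).filter fun n => ∃ i ∈ T.probe n, T.count n i < κ).card ≤ M * κ := by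
  have h1 : ((Finset.range m).filter fun n => ∃ i ∈ T.probe n, T.count n i < κ) ⊆
      Finset.univ.biUnion fun i : Fin M =>
        (Finset.range m).filter fun n => i ∈ T.probe n ∧ T.count n i < κ := by
    intro n hn
    simp only [Finset.mem_filter, Finset.mem_biUnion, Finset.mem_univ, true_and] at hn ⊢
    obtain ⟨hn, i, hi⟩ := hn
    exact ⟨i, hn, hi⟩
  refine (Finset.card_le_card h1).trans (Finset.card_biUnion_le.trans ?_)
  refine (Finset.sum_le_card_nsmul _ _ κ fun i _ => ?_).trans (by simp)
  have := T.card_le_of_count_mem i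
    ((Finset.range m).filter fun n => i ∈ T.probe n ∧ T.count n i < κ) 0 κ
    (fun n hn => (Finset.mem_filter.1 hn).2.1) (fun _ _ => Nat.zero_le _)
    (fun n hn => (Finset.mem_filter.1 hn).2.2)
  simpa using this

/-! ### Exploration -/

/-- In round-robin order cell `i` is due at the turns congruent to `i` modulo `M`, so the turn
cannot pass `M * k + i` without a (k+1)-st probe of `i`. Exploitation can only add probes. -/
theorem turn_le_mul_count (n : ℕ) (i : Fin M) : T.turn n ≤ M * T.count n i + i := by
  induction n with
  | zero => simp [T.turn_zero]
  | succ n ih =>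
    rw [T.turn_succ, T.count_succ]
    split_ifs with h1 h2 h2
    · rw [mul_add, mul_one]; have := i.2; omega
    · rw [T.explore n h1] at h2
      have : T.turn n ≠ M * T.count n i + i := by
        intro e
        apply h2
        rw [e, Nat.mul_add_mod, Nat.mod_eq_of_lt i.2]
      omega
    · rw [mul_add, mul_one]; omega
    · exact ih

/-- From the `κ`-th probe on, the sign of the sum LLR of every cell is correct. -/
def SignsSettled (W : Fin M → ℕ → ℝ) (D : Finset (Fin M)) (κ : ℕ) : Prop :=
  ∀ i k, κ ≤ k → (0 < W i k ↔ i ∈ D)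

variable {T} {D : Finset (Fin M)} {κ : ℕ}

/-- After so many turns every cell has been probed `κ` times; then the positive cells are exactly
those of `D`, there are `L` of them, and exploration is over. -/
theorem turn_lt_of_explore (hW : ∀ i, W i 0 = 0) (hL : 1 ≤ L) (hD : D.card = L)
    (hκ : SignsSettled W D κ) {n : ℕ} (hn : T.suspects n = none) : T.turn n < M * (κ + 1) := by
  by_contra hlt
  push Not at hlt
  have h1 : ∀ i, κ ≤ T.count n i := by
    intro i
    have h2 := T.turn_le_mul_count n i
    have h3 : M * (κ + 1) < M * (T.count n i + 1) := by
      rw [mul_add M (T.count n i), mul_one]; have := i.2; omega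
    have := lt_of_mul_lt_mul_left h3 (Nat.zero_le M)
    omega
  apply T.card_positives_of_explore hW hL hn
  refine Eq.trans (congrArg Finset.card ?_) hD
  ext i
  rw [mem_positives]
  exact hκ i _ (h1 i)

theorem turn_le (hW : ∀ i, W i 0 = 0) (hL : 1 ≤ L) (hD : D.card = L)
    (hκ : SignsSettled W D κ) (n : ℕ) : T.turn n ≤ M * (κ + 1) := by
  induction n with
  | zero => simp [T.turn_zero]
  | succ n ih =>
    rw [T.turn_succ]
    split_ifs with h1
    · exact turn_lt_of_explore hW hL hD hκ h1
    · exact ih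

theorem card_explore_le (hW : ∀ i, W i 0 = 0) (hL : 1 ≤ L) (hD : D.card = L)
    (hκ : SignsSettled W D κ) (m : ℕ) :
    ((Finset.range m).filter fun n => T.suspects n = none).card ≤ M * (κ + 1) := by
  have h1 : ((Finset.range m).filter fun n => T.suspects n = none).card = T.turn m := by
    induction m with
    | zero => simp [T.turn_zero]
    | succ m ih =>
      rw [Finset.range_add_one, Finset.filter_insert, T.turn_succ]
      split_ifs
      · rw [Finset.card_insert_of_notMem (by simp), ih]
      · exact ih
  rw [h1]; exact turn_le hW hL hD hκ m

/-! ### Switchings -/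

theorem positives_succ (hκ : SignsSettled W D κ) {n : ℕ}
    (hold : ∀ i ∈ T.probe n, κ ≤ T.count n i) :
    positives (T.sums (n + 1)) = positives (T.sums n) := by
  ext i
  simp only [positives, Finset.mem_filter, Finset.mem_univ, true_and]
  by_cases hi : i ∈ T.probe n
  · have h1 := hold i hi
    simp only [sums, T.count_succ, if_pos hi]
    rw [hκ i _ h1, hκ i _ (by omega)]
  · rw [T.sums_of_notMem_probe hi]

theorem pos_le (n : ℕ) (r : Fin N) : T.pos n r ≤ M - L := by
  rcases T.exists_phase_or_explore n with h1 | ⟨H, q, -, hi⟩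
  · cases n with
    | zero => simp [T.pos_zero]
    | succ n =>
      by_cases hc : (positives (T.sums (n + 1))).card = L
      · by_cases hs : T.suspects n = some (positives (T.sums (n + 1)))
        · rcases T.exists_phase_or_explore n with h2 | ⟨H, q, hph, -⟩
          · simp [h2] at hs
          · have := (T.goOn n q hc hs hph.plan).1
            simp [h1, hs] at this
        · have := (T.renew n hc hs).1
          simp [h1] at this
      · simp [(T.lost n hc).2.2]
  · exact hi.pos_le r

theorem phase_succ (hκ : SignsSettled W D κ) {n : ℕ} {H : Finset (Fin M)}
    {q : Fin (M - L) → Fin M} (hph : T.Phase n H q) (hold : ∀ i ∈ T.probe n, κ ≤ T.count n i) :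
    T.Phase (n + 1) H q ∧ ∀ r, T.pos n r ≤ T.pos (n + 1) r := by
  have hi := hph.invariants
  have e := positives_succ hκ hold
  have hH : H = positives (T.sums (n + 1)) := by rw [e]; exact hi.eq_positives
  obtain ⟨e1, e2, e3⟩ := T.goOn n q (by
    have := hi.card_eq
    rwa [hH] at this) (by rw [hph.suspects, hH]; rfl) hph.plan
  exact ⟨⟨by rw [e1, hph.suspects], e2⟩, fun r => by rw [e3]; exact (advance_spec _ _ _ _ _).1⟩

theorem probe_eq_of_phase {m n : ℕ} {H : Finset (Fin M)} {q : Fin (M - L) → Fin M}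
    (hm : T.Phase m H q) (hn : T.Phase n H q) (hpos : ∀ r, T.pos m r = T.pos n r) :
    T.probe m = T.probe n := by
  ext i
  rw [T.exploit m H q hm.suspects hm.plan, T.exploit n H q hn.suspects hn.plan,
    show T.pos m = T.pos n from funext hpos]

/-- Amortization with the sum `Φ` of the machine positions as potential. In an exploitation step
that probes settled cells only, the positive cells stay the same, the phase goes on and no machine
moves back; so the probed set can change only if `Φ` grows. The other steps are few, and each costs
at most `M` switchings and the whole potential `N * M`. The bound does not contain `h`, hence later
not `c`. -/
theorem sum_switchings_le (hW : ∀ i, W i 0 = 0) (hL : 1 ≤ L) (hD : D.card = L)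
    (hκ : SignsSettled W D κ) (m : ℕ) :
    ∑ n ∈ Finset.range m, (T.probe (n + 1) \ T.probe n).card ≤
      M * (N * M) + M * (1 + N * M) * (M * (κ + 1) + M * κ) := by
  classical
  set Φ : ℕ → ℕ := fun n => ∑ r, T.pos n r with hΦ
  have hΦle : ∀ n, Φ n ≤ N * M := by
    intro n
    refine (Finset.sum_le_card_nsmul _ _ M fun r _ => (T.pos_le n r).trans (Nat.sub_le _ _)).trans ?_
    simp
  set B : ℕ → Prop := fun n => T.suspects n = none ∨ ∃ i ∈ T.probe n, T.count n i < κ with hB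
  have hcard : ∀ n, (T.probe (n + 1) \ T.probe n).card ≤ M := fun n =>
    (Finset.card_le_univ _).trans (by simp)
  have hstep : ∀ n, (T.probe (n + 1) \ T.probe n).card + M * Φ n ≤
      M * Φ (n + 1) + M * (1 + N * M) * (if B n then 1 else 0) := by
    intro n
    by_cases hn : B n
    · rw [if_pos hn]
      have h1 := hcard n
      have h2 : M * Φ n ≤ M * (N * M) := Nat.mul_le_mul_left _ (hΦle n)
      have h3 : M * (1 + N * M) * 1 = M + M * (N * M) := by ring
      rw [h3]; omega
    · rw [if_neg hn]
      simp only [hB, not_or, not_exists, not_and, not_lt] at hn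
      obtain ⟨hn1, hold⟩ := hn
      rcases T.exists_phase_or_explore n with h1 | ⟨H, q, hph, -⟩
      · exact absurd h1 hn1
      obtain ⟨hph', hmono⟩ := phase_succ hκ hph hold
      by_cases hpos : ∀ r, T.pos n r = T.pos (n + 1) r
      · rw [probe_eq_of_phase hph hph' hpos]
        have : Φ n = Φ (n + 1) := Finset.sum_congr rfl fun r _ => hpos r
        simp [this]
      · push Not at hpos
        obtain ⟨r, hr⟩ := hpos
        have h1 : Φ n < Φ (n + 1) := Finset.sum_lt_sum (fun r _ => hmono r)
          ⟨r, Finset.mem_univ _, lt_of_le_of_ne (hmono r) hr⟩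
        have h2 : M * (Φ n + 1) ≤ M * Φ (n + 1) := Nat.mul_le_mul_left _ h1
        have := hcard n
        rw [mul_add, mul_one] at h2
        omega
  have hsum : ∑ n ∈ Finset.range m, (T.probe (n + 1) \ T.probe n).card + M * Φ 0 ≤
      M * Φ m + M * (1 + N * M) * ((Finset.range m).filter B).card := by
    induction m with
    | zero => simp
    | succ m ih =>
      have h1 := hstep m
      rw [Finset.sum_range_succ, Finset.range_add_one, Finset.filter_insert]
      split_ifs with h2
      · rw [Finset.card_insert_of_notMem (by simp), mul_add _ _ 1]
        rw [if_pos h2] at h1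
        omega
      · rw [if_neg h2] at h1
        omega
  have hBc : ((Finset.range m).filter B).card ≤ M * (κ + 1) + M * κ := by
    have h1 : (Finset.range m).filter B ⊆
        ((Finset.range m).filter fun n => T.suspects n = none) ∪
        ((Finset.range m).filter fun n => ∃ i ∈ T.probe n, T.count n i < κ) := by
      rw [← Finset.filter_or]
    refine (Finset.card_le_card h1).trans ((Finset.card_union_le _ _).trans ?_)
    exact add_le_add (card_explore_le hW hL hD hκ m) (T.card_young_le κ m)
  calc ∑ n ∈ Finset.range m, (T.probe (n + 1) \ T.probe n).card
      ≤ M * Φ m + M * (1 + N * M) * ((Finset.range m).filter B).card := by omega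
    _ ≤ _ := by gcongr; exact hΦle m

/-! ### Stopping -/

/-- Every place begins in exactly one piece, that of the machine with number ⌊p N / (M - L)⌋. This
machine is responsible for the full level at `p`, and it has passed `p` when it has finished. -/
theorem sums_lt_of_finished (hh : h ≤ 0) (hLM : L < M) (hN : 0 < N) {n : ℕ} {H : Finset (Fin M)}
    {q : Fin (M - L) → Fin M} (hph : T.Phase n H q)
    (hfin : ∀ r : Fin N, ¬ InMachine M L N r (T.pos n r)) (p : Fin (M - L)) :
    T.sums n (q p) < h := by
  have hML : 0 < M - L := by omega
  have hr : (p : ℕ) * N / (M - L) < N := by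
    rw [Nat.div_lt_iff_lt_mul hML, mul_comm]
    exact Nat.mul_lt_mul_of_pos_left p.2 hN
  have h1 : (p : ℕ) * N / (M - L) * (M - L) ≤ p * N := Nat.div_mul_le_self _ _
  have h2 : (p : ℕ) * N < ((p : ℕ) * N / (M - L) + 1) * (M - L) := by
    have := Nat.lt_div_mul_add (a := (p : ℕ) * N) hML
    rw [add_mul, one_mul]; exact this
  refine T.sums_lt_of_passed hh hLM n H q hph ⟨_, hr⟩ p h1 ?_ ?_
  · exact Nat.div_le_of_le_mul (by rw [mul_comm N]; exact h1)
  · by_contra hlt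
    push Not at hlt
    refine hfin ⟨_, hr⟩ ⟨hlt.trans_lt p.2, ?_⟩
    exact (Nat.mul_le_mul_right N hlt).trans_lt h2

theorem mem_machineCells {n : ℕ} {q : Fin (M - L) → Fin M} {r : Fin N} {p : Fin (M - L)}
    (hp : (p : ℕ) = T.pos n r) (hin : InMachine M L N r p) :
    q p ∈ machineCells q (T.pos n) := by
  simp only [machineCells, Finset.mem_filter, Finset.mem_univ, true_and]
  refine ⟨r, hp ▸ hin, ?_⟩
  congr 1
  exact Fin.ext hp.symm

/-- If all probed cells were settled, the gap would be reached. In Case 1 all suspected cells are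
probed, so they form `D` and have sums at least `b`, while the other sums are not positive. In Case
2 no machine can be at work: an anomalous cell would be positive and therefore suspected, and a
normal one would already lie below its share of `h = -b`. So all unsuspected sums are below `-b`,
and the suspected ones are positive. -/
theorem exists_young_of_not_gap (hLM : L < M) (hD : D.card = L) {b : ℝ} (hb : 0 < b)
    (h1 : ¬ one → h = -b ∧ 0 < N)
    (hpos : ∀ i ∈ D, ∀ k, κ ≤ k → b ≤ W i k) (hneg : ∀ i ∉ D, ∀ k, κ ≤ k → W i k < -b)
    {n : ℕ} {H : Finset (Fin M)} {q : Fin (M - L) → Fin M} (hph : T.Phase n H q)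
    (hgap : ¬ GapAtLeast L (T.sums n) b) : ∃ i ∈ T.probe n, T.count n i < κ := by
  by_contra hold
  push Not at hold
  have hi := hph.invariants
  apply hgap
  have hc : (positives (T.sums n)).card = L := by rw [← hi.eq_positives, hi.card_eq]
  refine gapAtLeast_of_positives hc ?_
  rw [← hi.eq_positives]
  have hHpos : ∀ i, i ∈ H ↔ 0 < T.sums n i := by
    intro i; rw [hi.eq_positives]; simp [positives]
  have hprobe := T.exploit n H q hph.suspects hph.plan
  by_cases h2 : one
  · have hHD : H = D := by
      apply Finset.eq_of_subset_of_card_le _ (by rw [hD, hi.card_eq])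
      intro i hiH
      by_contra hiD
      have h3 := hneg i hiD _ (hold i ((hprobe i).2 (Or.inl ⟨h2, hiH⟩)))
      have h4 := (hHpos i).1 hiH
      unfold sums at h4; linarith
    intro i hiH j hj
    have h3 := hpos i (hHD ▸ hiH) _ (hold i ((hprobe i).2 (Or.inl ⟨h2, hiH⟩)))
    have h4 : ¬ 0 < T.sums n j := fun h4 => hj ((hHpos j).2 h4)
    have h5 : b ≤ T.sums n i := h3
    linarith
  · obtain ⟨rfl, hN⟩ := h1 h2
    have hfin : ∀ r : Fin N, ¬ InMachine M L N r (T.pos n r) := by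
      intro r hin
      have hp : InMachine M L N r ((⟨T.pos n r, hin.1⟩ : Fin (M - L)) : ℕ) := hin
      have h3 := hi.share_mul_le r ⟨T.pos n r, hin.1⟩ rfl hp
      have h4 := hold _ ((hprobe _).2 (Or.inr (mem_machineCells (T := T) (q := q) rfl hp)))
      have h5 : q ⟨T.pos n r, hin.1⟩ ∉ D := by
        intro h6
        have h7 := hpos _ h6 _ h4
        exact hi.notMem _ ((hHpos _).2 (lt_of_lt_of_le hb h7))
      have h6 : T.sums n (q ⟨T.pos n r, hin.1⟩) < -b := hneg _ h5 _ h4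
      have := share_le_one (M := M) (L := L) (N := N) (r := r) (p := T.pos n r)
      simp only at h3
      nlinarith
    intro i hiH j hj
    obtain ⟨p, rfl⟩ := hi.surjective hj
    have h3 := sums_lt_of_finished (by linarith) hLM hN hph hfin p
    have h4 := (hHpos i).1 hiH
    linarith

/-- Each step before stopping either explores or probes a cell with fewer than `κ` probes. This
crude bound needs no control of the order in which cells are served. -/
theorem le_of_not_gap (hW : ∀ i, W i 0 = 0) (hL : 1 ≤ L) (hLM : L < M) (hD : D.card = L) {b : ℝ}
    (hb : 0 < b) (h1 : ¬ one → h = -b ∧ 0 < N)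
    (hpos : ∀ i ∈ D, ∀ k, κ ≤ k → b ≤ W i k) (hneg : ∀ i ∉ D, ∀ k, κ ≤ k → W i k < -b)
    {m : ℕ} (hgap : ∀ n < m, ¬ GapAtLeast L (T.sums n) b) : m ≤ M * (κ + 1) + M * κ := by
  classical
  have hκ : SignsSettled W D κ := by
    intro i k hk
    by_cases hi : i ∈ D
    · simp only [hi, iff_true]; linarith [hpos i hi k hk]
    · simp only [hi, iff_false]; linarith [hneg i hi k hk]
  have h2 : Finset.range m ⊆
      ((Finset.range m).filter fun n => T.suspects n = none) ∪
      ((Finset.range m).filter fun n => ∃ i ∈ T.probe n, T.count n i < κ) := by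
    intro n hn
    rw [← Finset.filter_or, Finset.mem_filter]
    refine ⟨hn, ?_⟩
    rcases T.exists_phase_or_explore n with h3 | ⟨H, q, hph, -⟩
    · exact Or.inl h3
    · exact Or.inr (exists_young_of_not_gap hLM hD hb h1 hpos hneg hph
        (hgap n (Finset.mem_range.1 hn)))
  have h3 := Finset.card_le_card h2
  rw [Finset.card_range] at h3
  refine h3.trans ((Finset.card_union_le _ _).trans ?_)
  exact add_le_add (card_explore_le hW hL hD hκ m) (T.card_young_le κ m)

end Trajectory

/-! ### Runs along regular paths -/

namespace Trajectory

variable {M L N : ℕ} {one : Prop} {h : ℝ} {R : OrderingRule M L} {W : Fin M → ℕ → ℝ}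

theorem count_le (T : Trajectory M L N one h R W) (n : ℕ) (i : Fin M) : T.count n i ≤ n := by
  induction n with
  | zero => simp [T.count_zero]
  | succ n ih => rw [T.count_succ]; split_ifs <;> omega

/-- The sum LLRs follow their drifts `dg` and `-df` up to errors `δ`, and the stopping criterion
with threshold `b` is not met before time `m`. -/
structure Regular (T : Trajectory M L N one h R W) (D : Finset (Fin M)) (dg df δ v b : ℝ)
    (m : ℕ) : Prop where
  zero : ∀ i, W i 0 = 0
  one_le : 1 ≤ L
  lt : L < M
  card_eq : D.card = L
  dg_pos : 0 < dg
  df_pos : 0 < df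
  nonneg : 0 ≤ δ
  level : h = -v
  level_nonneg : 0 ≤ v
  anomalous : ∀ i ∈ D, ∀ k₀ ≤ m, ∀ k, k₀ ≤ k → dg * ((k : ℝ) - k₀) - δ ≤ W i k - W i k₀
  normal : ∀ i ∉ D, ∀ k₀ ≤ m, ∀ k, k₀ ≤ k → df * ((k : ℝ) - k₀) - δ ≤ W i k₀ - W i k
  two : ¬ one → v = b ∧ 0 < N ∧ R.IsStable ∧ N * δ < v
  notGap : ∀ n < m, ¬ GapAtLeast L (T.sums n) b

namespace Regular

variable {T : Trajectory M L N one h R W} {D : Finset (Fin M)} {dg df δ v b : ℝ} {m : ℕ}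

/-- From this number of probes on, the sign of a sum LLR is correct. -/
def young (dg df δ : ℝ) : ℕ := ⌊δ / dg + δ / df⌋₊ + 1

theorem young_le (hT : T.Regular D dg df δ v b m) :
    (young dg df δ : ℝ) ≤ δ / dg + δ / df + 1 := by
  have h1 := hT.dg_pos
  have h2 := hT.df_pos
  have h3 := hT.nonneg
  unfold young
  push_cast
  linarith [Nat.floor_le (show 0 ≤ δ / dg + δ / df by positivity)]

theorem signsSettled (hT : T.Regular D dg df δ v b m) : SignsSettled W D (young dg df δ) := by
  intro i k hk
  have h1 := hT.dg_pos
  have h2 := hT.df_pos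
  have h3 := hT.nonneg
  have hk' : δ / dg + δ / df < k := by
    have h4 := Nat.lt_floor_add_one (δ / dg + δ / df)
    have h5 : ((⌊δ / dg + δ / df⌋₊ + 1 : ℕ) : ℝ) ≤ k := by exact_mod_cast hk
    push_cast at h5
    linarith
  have h6 : 0 ≤ δ / dg := by positivity
  have h7 : 0 ≤ δ / df := by positivity
  by_cases hi : i ∈ D
  · have h4 := hT.anomalous i hi 0 (Nat.zero_le _) k (Nat.zero_le _)
    have h5 : δ < k * dg := (div_lt_iff₀ h1).1 (by linarith)
    simp only [hi, iff_true]
    rw [hT.zero] at h4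
    push_cast at h4
    linarith
  · have h4 := hT.normal i hi 0 (Nat.zero_le _) k (Nat.zero_le _)
    have h5 : δ < k * df := (div_lt_iff₀ h2).1 (by linarith)
    simp only [hi, iff_false]
    rw [hT.zero] at h4
    push_cast at h4
    linarith

/-- The exploitation steps before time `m` in which only settled cells are probed. -/
def Settled (T : Trajectory M L N one h R W) (κ m n : ℕ) : Prop :=
  n < m ∧ T.suspects n ≠ none ∧ ∀ i ∈ T.probe n, κ ≤ T.count n i

/-- In Case 1 all suspected cells are probed, hence settled, hence anomalous, and `L` of them
exhaust `D`. They stay positive since counts only grow; so whenever later exactly `L` cells are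
positive, these are again the cells of `D`. -/
theorem suspects_eq (hT : T.Regular D dg df δ v b m) (h1 : one) {n : ℕ}
    (hn : Settled T (young dg df δ) m n) {H : Finset (Fin M)} {q : Fin (M - L) → Fin M}
    (hph : T.Phase n H q) : H = D ∧ ∀ i ∈ D, ∀ n', n ≤ n' → 0 < T.sums n' i := by
  have hi := hph.invariants
  have hprobe := T.exploit n H q hph.suspects hph.plan
  have hHD : H = D := by
    apply Finset.eq_of_subset_of_card_le _ (by rw [hT.card_eq, hi.card_eq])
    intro i hiH
    have h2 : 0 < T.sums n i := by
      rw [hi.eq_positives] at hiH; simpa [positives] using hiH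
    exact (hT.signsSettled i _ (hn.2.2 i ((hprobe i).2 (Or.inl ⟨h1, hiH⟩)))).1 h2
  refine ⟨hHD, fun i hiD n' hn' => ?_⟩
  have h2 := hn.2.2 i ((hprobe i).2 (Or.inl ⟨h1, hHD ▸ hiD⟩))
  exact (hT.signsSettled i _ (h2.trans (T.count_mono i hn'))).2 hiD

/-- The suspected set may get lost by a fluctuation of a normal cell, but the next one found is `D`
again, and then the ordering rule leaves the order unchanged. -/
theorem plan_eq_of_one (hT : T.Regular D dg df δ v b m) (h1 : one) {n : ℕ}
    (hn : Settled T (young dg df δ) m n) {H : Finset (Fin M)} {q : Fin (M - L) → Fin M}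
    (hph : T.Phase n H q) {n' : ℕ} (hn' : n ≤ n') : T.plan n' = some q := by
  obtain ⟨hHD, hpos⟩ := hT.suspects_eq h1 hn hph
  induction n', hn' using Nat.le_induction with
  | base => exact hph.plan
  | succ t ht ih =>
    by_cases hc : (positives (T.sums (t + 1))).card = L
    swap
    · rw [(T.lost t hc).2.1, ih]
    by_cases hs : T.suspects t = some (positives (T.sums (t + 1)))
    · exact (T.goOn t q hc hs ih).2.1
    · have h2 : D = positives (T.sums (t + 1)) := by
        apply Finset.eq_of_subset_of_card_le _ (by rw [hT.card_eq, hc])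
        intro i hi
        simpa [positives] using hpos i hi (t + 1) (by omega)
      rw [(T.renew t hc hs).2.1, ih]
      refine congrArg some (R.keep q _ hc hph.invariants.injective fun p => ?_)
      change q p ∉ positives (T.sums (t + 1))
      rw [← h2, ← hHD]
      exact hph.invariants.notMem p

/-- An occupant that never becomes positive again is unsuspected at every later ordering, so
stability applies to its place each time, even if other places change. -/
theorem plan_apply_of_stable (hR : R.IsStable) {n : ℕ} {H : Finset (Fin M)}
    {q : Fin (M - L) → Fin M} (hph : T.Phase n H q) (p : Fin (M - L))
    (hneg : ∀ n', n ≤ n' → ¬ 0 < T.sums n' (q p)) {n' : ℕ} (hn' : n ≤ n') :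
    ∃ q', T.plan n' = some q' ∧ Function.Injective q' ∧ q' p = q p := by
  induction n', hn' using Nat.le_induction with
  | base => exact ⟨q, hph.plan, hph.invariants.injective, rfl⟩
  | succ t ht ih =>
    obtain ⟨q', e1, e2, e3⟩ := ih
    by_cases hc : (positives (T.sums (t + 1))).card = L
    swap
    · exact ⟨q', by rw [(T.lost t hc).2.1, e1], e2, e3⟩
    by_cases hs : T.suspects t = some (positives (T.sums (t + 1)))
    · exact ⟨q', (T.goOn t q' hc hs e1).2.1, e2, e3⟩
    · refine ⟨_, (T.renew t hc hs).2.1, R.injective _ _ hc, ?_⟩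
      rw [e1, ← e3]
      refine hR q' _ hc e2 p ?_
      rw [e3, mem_positives]
      exact hneg (t + 1) (by omega)

/-- A place which a machine serves or has passed is occupied by a normal cell and keeps it. -/
theorem keep (hT : T.Regular D dg df δ v b m) {n n' : ℕ} (hn : Settled T (young dg df δ) m n)
    (hn' : n ≤ n') {H H' : Finset (Fin M)} {q q' : Fin (M - L) → Fin M} (hph : T.Phase n H q)
    (hph' : T.Phase n' H' q') {r : Fin N} {p : Fin (M - L)} (hfp : firstPlace M L N r ≤ p)
    (hp : ((p : ℕ) = T.pos n r ∧ InMachine M L N r p) ∨ (p : ℕ) < T.pos n r) :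
    q p ∉ D ∧ q' p = q p := by
  have hi := hph.invariants
  by_cases h1 : one
  · refine ⟨(hT.suspects_eq h1 hn hph).1 ▸ hi.notMem p, ?_⟩
    have := (hT.plan_eq_of_one h1 hn hph hn').symm.trans hph'.plan
    rw [Option.some_injective _ this]
  obtain ⟨hvb, hN, hR, hδ⟩ := hT.two h1
  -- In Case 2 the suspected set need not be `D`, but the occupant of this place is known to be
  -- normal for good. If it is being served, it is probed and thus settled. If it has been passed,
  -- its sum was below `-v / N < -δ`, which no anomalous cell reaches and from which no normal cell
  -- returns to positive values.
  have key : q p ∉ D ∧ ∀ n', n ≤ n' → ¬ 0 < T.sums n' (q p) := by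
    rcases hp with ⟨hp, hin⟩ | hp
    · have h2 : q p ∈ T.probe n :=
        (T.exploit n H q hph.suspects hph.plan _).2 (Or.inr (mem_machineCells hp hin))
      have h3 := hn.2.2 _ h2
      have h4 : q p ∉ D := by
        intro h5
        have h6 := (hT.signsSettled _ _ h3).2 h5
        apply hi.notMem p
        rw [hi.eq_positives, mem_positives]
        exact h6
      exact ⟨h4, fun n' hn' h5 => h4 ((hT.signsSettled _ _ (h3.trans (T.count_mono _ hn'))).1 h5)⟩
    · obtain ⟨m₀, hm₀, h2⟩ := hi.passed r p hfp hp
      have h3 := inv_le_share hT.lt hN hfp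
      have hN' : (0 : ℝ) < N := by exact_mod_cast hN
      have h4 : T.sums m₀ (q p) < -δ := by
        have h5 : δ < v / N := by rw [lt_div_iff₀ hN']; linarith
        have h6 : 1 / N * v ≤ share M L N r p * v :=
          mul_le_mul_of_nonneg_right h3 hT.level_nonneg
        have h7 : 1 / N * v = v / N := by ring
        have h8 : share M L N r p * h = -(share M L N r p * v) := by rw [hT.level]; ring
        linarith
      have hm : T.count m₀ (q p) ≤ m :=
        (T.count_le _ _).trans (hm₀.trans hn.1.le)
      have h8 : q p ∉ D := by
        intro h9
        have h10 := hT.anomalous _ h9 0 (Nat.zero_le _) (T.count m₀ (q p)) (Nat.zero_le _)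
        rw [hT.zero] at h10
        have h11 : 0 ≤ dg * ((T.count m₀ (q p) : ℝ) - (0 : ℕ)) := by
          have := hT.dg_pos
          push_cast
          rw [sub_zero]; positivity
        unfold sums at h4
        linarith
      refine ⟨h8, fun n' hn' h9 => ?_⟩
      have h12 : T.count m₀ (q p) ≤ T.count n' (q p) := T.count_mono _ (hm₀.trans hn')
      have h10 := hT.normal _ h8 _ hm _ h12
      have h11 : 0 ≤ df * ((T.count n' (q p) : ℝ) - T.count m₀ (q p)) :=
        mul_nonneg hT.df_pos.le (sub_nonneg.2 (by exact_mod_cast h12))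
      unfold sums at h4 h9
      linarith
  refine ⟨key.1, ?_⟩
  obtain ⟨q'', e1, -, e3⟩ := plan_apply_of_stable hR hph p key.2 hn'
  have := e1.symm.trans hph'.plan
  rw [← Option.some_injective _ this, e3]

end Regular

end Trajectory

/-! ### Time that a machine needs for its piece. -/

namespace Trajectory.Regular

variable {M L N : ℕ} {one : Prop} {h : ℝ} {R : OrderingRule M L} {W : Fin M → ℕ → ℝ}
  {T : Trajectory M L N one h R W} {D : Finset (Fin M)} {dg df δ v b : ℝ} {m : ℕ}

theorem share_mul_level (hT : T.Regular D dg df δ v b m) (r p : ℕ) :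
    share M L N r p * h = -(share M L N r p * v) := by
  rw [hT.level]; ring

/-- The number of steps which machine `r` spends at the place `p`. -/
theorem card_at_place_le (hT : T.Regular D dg df δ v b m) {q : ℕ → Fin (M - L) → Fin M}
    {s : Finset ℕ} {r : Fin N} {p : Fin (M - L)}
    (hset : ∀ n ∈ s, Settled T (young dg df δ) m n) (hph : ∀ n ∈ s, ∃ H, T.Phase n H (q n))
    (hpos : ∀ n ∈ s, T.pos n r = p) (hin : InMachine M L N r p)
    (hfp : firstPlace M L N r ≤ p) :
    (s.card : ℝ) ≤ (share M L N r p * v + δ) / df + 1 := by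
  have hdf := hT.df_pos
  have hN : 0 < N := (Nat.zero_le _).trans_lt r.2
  have hθ := share_pos hT.lt hN hfp
  have hx : 0 ≤ (share M L N r p * v + δ) / df := by
    have := hT.nonneg
    have := hT.level_nonneg
    positivity
  rcases s.eq_empty_or_nonempty with rfl | ⟨n₁, hn₁⟩
  · simp; linarith
  -- All steps of `s` find the same normal cell at this place, by `keep` from the earlier to the
  -- later step; so its probes can be counted.
  have key : ∀ n ∈ s, q n p = q n₁ p ∧ q n p ∉ D := by
    intro n hn
    obtain ⟨H, hH⟩ := hph n hn
    obtain ⟨H₁, hH₁⟩ := hph n₁ hn₁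
    rcases le_total n n₁ with hle | hle
    · have := hT.keep (hset n hn) hle hH hH₁ hfp (Or.inl ⟨(hpos n hn).symm, hin⟩)
      exact ⟨this.2.symm, this.1⟩
    · have := hT.keep (hset n₁ hn₁) hle hH₁ hH hfp (Or.inl ⟨(hpos n₁ hn₁).symm, hin⟩)
      exact ⟨this.2, this.2 ▸ this.1⟩
  refine T.card_le_of_count_le (q n₁ p) s 0 _ hx ?_ (fun _ _ => Nat.zero_le _) ?_
  · intro n hn
    obtain ⟨H, hH⟩ := hph n hn
    rw [← (key n hn).1]
    exact (T.exploit n H (q n) hH.suspects hH.plan _).2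
      (Or.inr (mem_machineCells (hpos n hn).symm hin))
  · intro n hn
    obtain ⟨H, hH⟩ := hph n hn
    have h1 := hH.invariants.share_mul_le r p (hpos n hn).symm hin
    rw [(key n hn).1, hT.share_mul_level] at h1
    have h2 := hT.normal _ ((key n hn).1 ▸ (key n hn).2) 0 (Nat.zero_le _)
      (T.count n (q n₁ p)) (Nat.zero_le _)
    rw [hT.zero] at h2
    unfold sums at h1
    push_cast at h2 ⊢
    rw [zero_add, le_div_iff₀ hdf]
    linarith

/-- The number of steps which machine `r` spends at the place `p` after machine `r'` has finished
its share of this place. -/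
theorem card_after_passed_le (hT : T.Regular D dg df δ v b m) {q : ℕ → Fin (M - L) → Fin M}
    {s : Finset ℕ} {r r' : Fin N} {p : Fin (M - L)}
    (hset : ∀ n ∈ s, Settled T (young dg df δ) m n) (hph : ∀ n ∈ s, ∃ H, T.Phase n H (q n))
    (hpos : ∀ n ∈ s, T.pos n r = p) (hin : InMachine M L N r p)
    (hfp' : firstPlace M L N r' ≤ p) (hpos' : ∀ n ∈ s, (p : ℕ) < T.pos n r') :
    (s.card : ℝ) ≤ ((1 - share M L N r' p) * v + δ) / df + 1 := by
  have hdf := hT.df_pos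
  have hv := hT.level_nonneg
  have hx : 0 ≤ ((1 - share M L N r' p) * v + δ) / df := by
    have := hT.nonneg
    have := sub_nonneg.2 (share_le_one (M := M) (L := L) (N := N) (r := r') (p := p))
    positivity
  rcases s.eq_empty_or_nonempty with rfl | hs
  · simp; linarith
  obtain ⟨n₁, hn₁, hmin⟩ : ∃ n₁ ∈ s, ∀ n ∈ s, n₁ ≤ n :=
    ⟨s.min' hs, s.min'_mem hs, fun n hn => s.min'_le n hn⟩
  obtain ⟨H₁, hH₁⟩ := hph n₁ hn₁
  have key : ∀ n ∈ s, q n p = q n₁ p := by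
    intro n hn
    obtain ⟨H, hH⟩ := hph n hn
    exact (hT.keep (hset n₁ hn₁) (hmin n hn) hH₁ hH hfp' (Or.inr (hpos' n₁ hn₁))).2
  have hD : q n₁ p ∉ D := (hT.keep (hset n₁ hn₁) le_rfl hH₁ hH₁ hfp' (Or.inr (hpos' n₁ hn₁))).1
  -- At time `m₁` the sum was already below share times `-v`, and while machine `r` stays it is at
  -- least `-v`. Only the rest of the level is left to be worked off.
  obtain ⟨m₁, hm₁, h1⟩ := hH₁.invariants.passed r' p hfp' (hpos' n₁ hn₁)
  have hcount : ∀ n ∈ s, T.count m₁ (q n₁ p) ≤ T.count n (q n₁ p) := fun n hn =>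
    T.count_mono _ (hm₁.trans (hmin n hn))
  refine T.card_le_of_count_le (q n₁ p) s (T.count m₁ (q n₁ p)) _ hx ?_ hcount ?_
  · intro n hn
    obtain ⟨H, hH⟩ := hph n hn
    rw [← key n hn]
    exact (T.exploit n H (q n) hH.suspects hH.plan _).2
      (Or.inr (mem_machineCells (hpos n hn).symm hin))
  · intro n hn
    obtain ⟨H, hH⟩ := hph n hn
    have h2 := hH.invariants.share_mul_le r p (hpos n hn).symm hin
    rw [key n hn, hT.share_mul_level] at h2
    rw [hT.share_mul_level] at h1
    have h3 := hT.normal _ hD (T.count m₁ (q n₁ p))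
      ((T.count_le _ _).trans (hm₁.trans (hset n₁ hn₁).1.le)) (T.count n (q n₁ p)) (hcount n hn)
    have h4 : share M L N r p * v ≤ 1 * v := mul_le_mul_of_nonneg_right share_le_one hv
    unfold sums at h1 h2
    rw [← sub_le_iff_le_add', le_div_iff₀ hdf]
    linarith

/-- Some machine serves a cell whose sum LLR has already been below its share of the level. -/
def Stale (T : Trajectory M L N one h R W) (q : ℕ → Fin (M - L) → Fin M) (n : ℕ) : Prop :=
  ∃ (r : Fin N) (p : Fin (M - L)), (p : ℕ) = T.pos n r ∧ InMachine M L N r p ∧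
    ∃ m₀ ≤ n, T.sums m₀ (q n p) < share M L N r p * h

/-- Fix machine, place and cell. Once the sum of a normal cell has been below its share of the
level, it climbs back by at most `δ`, and its drift allows at most `δ / df + 1` further probes with
the sum above this level. The prefactor counts the triples. -/
theorem card_stale_le (hT : T.Regular D dg df δ v b m) {q : ℕ → Fin (M - L) → Fin M}
    {s : Finset ℕ} (hset : ∀ n ∈ s, Settled T (young dg df δ) m n)
    (hph : ∀ n ∈ s, ∃ H, T.Phase n H (q n)) (hstale : ∀ n ∈ s, Stale T q n) :
    (s.card : ℝ) ≤ N * M * M * (δ / df + 1) := by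
  classical
  have hdf := hT.df_pos
  have hδ : 0 ≤ δ / df := div_nonneg hT.nonneg hdf.le
  set t : Fin N × Fin (M - L) × Fin M → Finset ℕ := fun x => s.filter fun n =>
    (x.2.1 : ℕ) = T.pos n x.1 ∧ InMachine M L N x.1 x.2.1 ∧ q n x.2.1 = x.2.2 ∧
    ∃ m₀ ≤ n, T.sums m₀ x.2.2 < share M L N x.1 x.2.1 * h with ht
  have h1 : s ⊆ Finset.univ.biUnion t := by
    intro n hn
    obtain ⟨r, p, h2, h3, m₀, h4, h5⟩ := hstale n hn
    refine Finset.mem_biUnion.2 ⟨(r, p, q n p), Finset.mem_univ _, ?_⟩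
    exact Finset.mem_filter.2 ⟨hn, h2, h3, rfl, m₀, h4, h5⟩
  have h2 : ∀ x, ((t x).card : ℝ) ≤ δ / df + 1 := by
    rintro ⟨r, p, j⟩
    by_cases hex : ∃ m₀, T.sums m₀ j < share M L N r p * h
    swap
    · have : t (r, p, j) = ∅ := by
        refine Finset.filter_eq_empty_iff.2 fun n hn hn' => hex ?_
        obtain ⟨-, -, -, m₀, -, h5⟩ := hn'
        exact ⟨m₀, h5⟩
      rw [this]; simp; linarith
    obtain ⟨m₁, hf, hfind⟩ : ∃ m₁, T.sums m₁ j < share M L N r p * h ∧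
        ∀ m₀, T.sums m₀ j < share M L N r p * h → m₁ ≤ m₀ :=
      ⟨Nat.find hex, Nat.find_spec hex, fun m₀ hm₀ => Nat.find_min' hex hm₀⟩
    have hmin : ∀ n ∈ t (r, p, j), m₁ ≤ n := by
      intro n hn
      obtain ⟨-, -, -, -, m₀, h4, h5⟩ := Finset.mem_filter.1 hn
      exact (hfind m₀ h5).trans h4
    have hcount : ∀ n ∈ t (r, p, j), T.count m₁ j ≤ T.count n j := fun n hn =>
      T.count_mono _ (hmin n hn)
    refine T.card_le_of_count_le j _ (T.count m₁ j) _ hδ ?_ hcount ?_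
    · intro n hn
      obtain ⟨hns, e1, e2, e3, -⟩ := Finset.mem_filter.1 hn
      obtain ⟨H, hH⟩ := hph n hns
      simp only at e1 e2 e3
      rw [← e3]
      exact (T.exploit n H (q n) hH.suspects hH.plan _).2 (Or.inr (mem_machineCells e1 e2))
    · intro n hn
      obtain ⟨hns, e1, e2, e3, -⟩ := Finset.mem_filter.1 hn
      simp only at e1 e2 e3
      obtain ⟨H, hH⟩ := hph n hns
      have h3 := hH.invariants.share_mul_le r p e1 e2
      have hjD := (hT.keep (hset n hns) le_rfl hH hH (r := r) (p := p)
        (by rw [e1]; exact hH.invariants.first_le r) (Or.inl ⟨e1, e2⟩)).1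
      rw [e3] at h3 hjD
      have h4 := hT.normal _ hjD (T.count m₁ j)
        ((T.count_le _ _).trans ((hmin n hn).trans (hset n hns).1.le)) (T.count n j) (hcount n hn)
      unfold sums at h3 hf
      rw [← sub_le_iff_le_add', le_div_iff₀ hdf]
      linarith
  calc (s.card : ℝ) ≤ ((Finset.univ.biUnion t).card : ℝ) := by
        exact_mod_cast Finset.card_le_card h1
    _ ≤ ((∑ x, (t x).card : ℕ) : ℝ) := by exact_mod_cast Finset.card_biUnion_le
    _ = ∑ x, ((t x).card : ℝ) := by push_cast; rfl
    _ ≤ ∑ x : Fin N × Fin (M - L) × Fin M, (δ / df + 1) := Finset.sum_le_sum fun x _ => h2 x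
    _ = (N : ℝ) * ((M - L : ℕ) * M) * (δ / df + 1) := by simp; ring
    _ ≤ N * M * M * (δ / df + 1) := by
        have h3 : ((M - L : ℕ) : ℝ) ≤ M := by exact_mod_cast Nat.sub_le _ _
        rw [mul_assoc (N : ℝ) M M]
        gcongr

/-- Outside the stale steps the machines only move to the right. -/
theorem pos_le_pos (hT : T.Regular D dg df δ v b m) {q : ℕ → Fin (M - L) → Fin M} {n n' : ℕ}
    (hn : Settled T (young dg df δ) m n) {H H' : Finset (Fin M)} (hph : T.Phase n H (q n))
    (hph' : T.Phase n' H' (q n')) (hle : n ≤ n') (hst : ¬ Stale T q n') (r : Fin N) :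
    T.pos n r ≤ T.pos n' r := by
  -- A machine that has moved back is at a place which it had passed before. By `keep` the same cell
  -- is still there, so the later step would be stale.
  by_contra hlt
  push Not at hlt
  have hi := hph.invariants
  have h0 : T.pos n' r < M - L := hlt.trans_le (hi.pos_le r)
  have h1 := hph'.invariants.first_le r
  have h2 := hi.inMachine r ⟨T.pos n' r, h0⟩ h1 hlt
  obtain ⟨m₀, h3, h4⟩ := hi.passed r ⟨T.pos n' r, h0⟩ h1 hlt
  refine hst ⟨r, ⟨T.pos n' r, h0⟩, rfl, h2, m₀, h3.trans hle, ?_⟩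
  rw [(hT.keep hn hle hph hph' (r := r) (p := ⟨T.pos n' r, h0⟩) h1 (Or.inr hlt)).2]
  exact h4

/-- The first place contributes at most what lies to the right of the left end of the piece, and
every further place at most 1. -/
theorem sum_share_le {r P : ℕ} (hr : r < N) (hP : firstPlace M L N r < P) :
    ∑ p ∈ Finset.Ico (firstPlace M L N r) P, share M L N r p ≤
      P - r * (((M : ℝ) - L) / N) := by
  have hN : (0 : ℝ) < N := by exact_mod_cast (Nat.zero_le _).trans_lt hr
  induction P, hP using Nat.le_induction with
  | base =>
    rw [Nat.Ico_succ_singleton, Finset.sum_singleton]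
    refine (min_le_right _ _).trans (le_of_eq ?_)
    push_cast
    field_simp
  | succ P hP ih =>
    rw [Finset.sum_Ico_succ_top (by omega)]
    push_cast
    linarith [share_le_one (M := M) (L := L) (N := N) (r := r) (p := P)]

/-- The number of steps in which machine `r` serves a place before `P`. -/
theorem card_pos_lt_le (hT : T.Regular D dg df δ v b m) {q : ℕ → Fin (M - L) → Fin M}
    {s : Finset ℕ} {r : Fin N} {P : ℕ}
    (hset : ∀ n ∈ s, Settled T (young dg df δ) m n) (hph : ∀ n ∈ s, ∃ H, T.Phase n H (q n))
    (hpos : ∀ n ∈ s, T.pos n r < P) (hin : ∀ p < P, InMachine M L N r p)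
    (hP : firstPlace M L N r < P) :
    (s.card : ℝ) ≤ (P - r * (((M : ℝ) - L) / N)) * v / df + M * (δ / df + 1) := by
  classical
  have hdf := hT.df_pos
  have hδ := hT.nonneg
  have h1 : s.card = ∑ p ∈ Finset.Ico (firstPlace M L N r) P,
      (s.filter fun n => T.pos n r = p).card := by
    refine Finset.card_eq_sum_card_fiberwise fun n hn => ?_
    obtain ⟨H, hH⟩ := hph n hn
    simpa using ⟨hH.invariants.first_le r, hpos n hn⟩
  have h2 : ∀ p ∈ Finset.Ico (firstPlace M L N r) P,
      ((s.filter fun n => T.pos n r = p).card : ℝ) ≤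
        share M L N r p * (v / df) + (δ / df + 1) := by
    intro p hp
    rw [Finset.mem_Ico] at hp
    have h3 := hin p hp.2
    have h4 := hT.card_at_place_le (q := q) (s := s.filter fun n => T.pos n r = p) (r := r)
      (p := ⟨p, h3.1⟩) (fun n hn => hset n (Finset.mem_filter.1 hn).1)
      (fun n hn => hph n (Finset.mem_filter.1 hn).1) (fun n hn => (Finset.mem_filter.1 hn).2)
      h3 hp.1
    refine h4.trans (le_of_eq ?_)
    simp only
    ring
  have h5 : (P : ℝ) - firstPlace M L N r ≤ M := by
    have h6 := (hin (P - 1) (by omega)).1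
    have h7 : P ≤ M := by omega
    have h8 : (P : ℝ) ≤ M := by exact_mod_cast h7
    have h9 : (0 : ℝ) ≤ firstPlace M L N r := by positivity
    linarith
  rw [h1]
  push_cast
  calc ∑ p ∈ Finset.Ico (firstPlace M L N r) P, ((s.filter fun n => T.pos n r = p).card : ℝ)
      ≤ ∑ p ∈ Finset.Ico (firstPlace M L N r) P,
        (share M L N r p * (v / df) + (δ / df + 1)) := Finset.sum_le_sum h2
    _ = (∑ p ∈ Finset.Ico (firstPlace M L N r) P, share M L N r p) * (v / df) +
        ((P : ℝ) - firstPlace M L N r) * (δ / df + 1) := by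
        rw [Finset.sum_add_distrib, Finset.sum_mul]
        simp [Nat.cast_sub hP.le]
        ring
    _ ≤ (P - r * (((M : ℝ) - L) / N)) * (v / df) + M * (δ / df + 1) := by
        have := hT.level_nonneg
        gcongr
        exact sum_share_le r.2 hP
    _ = _ := by ring

/-- If machine `r` has not finished at the end of `s`, then `s` is not longer than the time which
this machine needs along paths without fluctuations, up to errors. -/
theorem card_le_of_unfinished (hT : T.Regular D dg df δ v b m) (hNM : N ≤ M - L)
    {q : ℕ → Fin (M - L) → Fin M} {s : Finset ℕ}
    (hset : ∀ n ∈ s, Settled T (young dg df δ) m n) (hph : ∀ n ∈ s, ∃ H, T.Phase n H (q n))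
    (hst : ∀ n ∈ s, ¬ Stale T q n) {n₁ : ℕ} (hn₁ : n₁ ∈ s) (hmax : ∀ n ∈ s, n ≤ n₁) {r : Fin N}
    (hin₁ : InMachine M L N r (T.pos n₁ r)) :
    (s.card : ℝ) ≤ ((M : ℝ) - L) / N * v / df + (M + 2) * (δ / df + 1) := by
  classical
  have hdf := hT.df_pos
  have hδ : 0 ≤ δ / df := div_nonneg hT.nonneg hdf.le
  have hv := hT.level_nonneg
  have hvd : 0 ≤ v / df := div_nonneg hv hdf.le
  have hN : (0 : ℝ) < N := by exact_mod_cast (Nat.zero_le _).trans_lt r.2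
  have hmono : ∀ n ∈ s, ∀ n' ∈ s, n ≤ n' → ∀ r, T.pos n r ≤ T.pos n' r := by
    intro n hn n' hn' hle r
    obtain ⟨H, hH⟩ := hph n hn
    obtain ⟨H', hH'⟩ := hph n' hn'
    exact hT.pos_le_pos (hset n hn) hH hH' hle (hst n' hn') r
  have hle : ∀ n ∈ s, T.pos n r ≤ T.pos n₁ r := fun n hn => hmono n hn n₁ hn₁ (hmax n hn) r
  obtain ⟨H₁, hH₁⟩ := hph n₁ hn₁
  set P := T.pos n₁ r with hP
  have hfp : firstPlace M L N r ≤ P := hH₁.invariants.first_le r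
  have hinP : ∀ p ≤ P, InMachine M L N r p := fun p hp =>
    ⟨hp.trans_lt hin₁.1, (Nat.mul_le_mul_right _ hp).trans_lt hin₁.2⟩
  have hML : (0 : ℝ) < (M : ℝ) - L := by
    have : (L : ℝ) < M := by exact_mod_cast hT.lt
    linarith
  set len : ℝ := ((M : ℝ) - L) / N with hlen
  -- This is where `N ≤ M - L` enters: a single cell, which cannot be probed twice at a time, takes
  -- no longer than a whole piece.
  have hlen1 : 1 ≤ len := by
    rw [hlen, le_div_iff₀ hN, one_mul]
    have : (N : ℝ) ≤ ((M - L : ℕ) : ℝ) := by exact_mod_cast hNM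
    rwa [Nat.cast_sub hT.lt.le] at this
  -- If place `P` ends within the piece of machine `r`, the shares of all its places up to `P` add
  -- up to at most `len`.
  by_cases hshared : (P : ℝ) + 1 ≤ (r + 1) * len
  · have h1 := hT.card_pos_lt_le (q := q) (s := s) (r := r) (P := P + 1) hset hph
      (fun n hn => Nat.lt_succ_of_le (hle n hn)) (fun p hp => hinP p (by omega)) (by omega)
    push_cast at h1
    have h2 : ((P : ℝ) + 1 - r * len) * v / df ≤ len * v / df := by
      rw [mul_div_assoc, mul_div_assoc]
      apply mul_le_mul_of_nonneg_right _ hvd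
      linarith
    linarith
  push Not at hshared
  -- Otherwise `P` sticks out of the piece, so there is a next machine `r'`, and `P` is the first
  -- place of that machine.
  have hr1 : (r : ℕ) + 1 < N := by
    by_contra hge
    have h1 : N ≤ (r : ℕ) + 1 := not_lt.1 hge
    have h2 : (N : ℝ) ≤ (r : ℝ) + 1 := by exact_mod_cast h1
    have h3 : (P : ℝ) + 1 ≤ (M : ℝ) - L := by
      have : ((P + 1 : ℕ) : ℝ) ≤ ((M - L : ℕ) : ℝ) := by exact_mod_cast hin₁.1
      rw [Nat.cast_sub hT.lt.le] at this
      push_cast at this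
      exact this
    have h4 : (M : ℝ) - L = N * len := by rw [hlen]; field_simp
    have h5 : (N : ℝ) * len ≤ (r + 1) * len := by gcongr
    linarith
  set r' : Fin N := ⟨r + 1, hr1⟩ with hr'
  have hfp' : firstPlace M L N r' ≤ P := by
    unfold firstPlace
    have hN' : 0 < N := (Nat.zero_le _).trans_lt r.2
    have h1 : (r + 1) * (M - L) < (P + 1) * N := by
      have h2 : ((r : ℝ) + 1) * ((M : ℝ) - L) < (P + 1) * N := by
        have : ((r : ℝ) + 1) * len = ((r : ℝ) + 1) * ((M : ℝ) - L) / N := by rw [hlen]; ring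
        rw [this, div_lt_iff₀ hN] at hshared
        exact hshared
      have h3 : (((r + 1) * (M - L) : ℕ) : ℝ) < (((P + 1) * N : ℕ) : ℝ) := by
        push_cast [Nat.cast_sub hT.lt.le]
        exact h2
      exact_mod_cast h3
    have := Nat.div_lt_of_lt_mul (by rw [mul_comm N]; exact h1 : ((r : ℕ) + 1) * (M - L) < N * (P + 1))
    exact Nat.lt_succ_iff.1 this
  have hinP' : InMachine M L N r' P := by
    refine ⟨hin₁.1, hin₁.2.trans_le ?_⟩
    exact Nat.mul_le_mul_right _ (by simp [hr'])
  have hge' : ∀ n ∈ s, P ≤ T.pos n r' := by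
    intro n hn
    obtain ⟨H, hH⟩ := hph n hn
    refine le_trans ?_ (hH.invariants.first_le r')
    unfold firstPlace
    have hN' : 0 < N := (Nat.zero_le _).trans_lt r.2
    rw [Nat.le_div_iff_mul_le hN']
    exact hin₁.2.le
  -- The part of `P` that belongs to the next machine; the part left for machine `r` is `1 - x`.
  set x := share M L N r' P with hx
  have hx1 : x ≤ 1 := share_le_one
  have hx2 : x ≤ (P : ℝ) + 1 - (r + 1) * len := by
    refine (min_le_right _ _).trans (le_of_eq ?_)
    rw [hr', hlen]
    push_cast
    field_simp
  have hx0 : 0 ≤ x := (share_pos hT.lt ((Nat.zero_le _).trans_lt r.2) hfp').le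
  have hx3 : (P : ℝ) + 1 - (r + 1) * len ≤ x := by
    refine le_min ?_ (le_of_eq ?_)
    · have : ((P * N : ℕ) : ℝ) ≤ ((((r : ℕ) + 1) * (M - L) : ℕ) : ℝ) := by exact_mod_cast hin₁.2.le
      push_cast [Nat.cast_sub hT.lt.le] at this
      have h2 : (P : ℝ) ≤ (r + 1) * len := by
        rw [hlen, ← mul_div_assoc, le_div_iff₀ hN]; exact this
      linarith
    · rw [hr', hlen]
      push_cast
      field_simp
  set A := s.filter fun n => T.pos n r' = P with hA
  set B := s.filter fun n => T.pos n r = P ∧ P < T.pos n r' with hB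
  have hAc : (A.card : ℝ) ≤ (x * v + δ) / df + 1 :=
    hT.card_at_place_le (q := q) (r := r') (p := ⟨P, hin₁.1⟩)
      (fun n hn => hset n (Finset.mem_filter.1 hn).1)
      (fun n hn => hph n (Finset.mem_filter.1 hn).1) (fun n hn => (Finset.mem_filter.1 hn).2)
      hinP' hfp'
  have hBc : (B.card : ℝ) ≤ ((1 - x) * v + δ) / df + 1 :=
    hT.card_after_passed_le (q := q) (r := r) (r' := r') (p := ⟨P, hin₁.1⟩)
      (fun n hn => hset n (Finset.mem_filter.1 hn).1)
      (fun n hn => hph n (Finset.mem_filter.1 hn).1) (fun n hn => (Finset.mem_filter.1 hn).2.1)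
      hin₁ hfp' (fun n hn => (Finset.mem_filter.1 hn).2.2)
  have eA : (x * v + δ) / df = x * (v / df) + δ / df := by ring
  have eB : ((1 - x) * v + δ) / df = v / df - x * (v / df) + δ / df := by ring
  have eL : len * v / df = len * (v / df) := by ring
  have hMe : 0 ≤ (M : ℝ) * (δ / df + 1) := by positivity
  have hlv : v / df ≤ len * (v / df) := le_mul_of_one_le_left hvd hlen1
  rw [eA] at hAc
  rw [eB] at hBc
  rw [eL]
  -- If both machines are at `P` at some time, then the cell at `P` is probed in all steps of `s`:
  -- by the next machine until its share is done, afterwards by machine `r`. This takes `v / df`. If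
  -- they never meet there, machine `r` is never idle: it works `(P - r * len) * v / df` before `P`
  -- and `(1 - x) * v / df` at `P`, together `len * v / df`.
  by_cases hex : ∃ n ∈ s, T.pos n r = P ∧ T.pos n r' = P
  · obtain ⟨n₂, hn₂, e1, e2⟩ := hex
    have hsub : s ⊆ A ∪ B := by
      intro n hn
      rw [Finset.mem_union, hA, hB, Finset.mem_filter, Finset.mem_filter]
      rcases (hge' n hn).eq_or_lt with h1 | h1
      · exact Or.inl ⟨hn, h1.symm⟩
      · right
        refine ⟨hn, le_antisymm (hle n hn) ?_, h1⟩
        rw [← e1]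
        apply hmono n₂ hn₂ n hn
        by_contra hlt
        push Not at hlt
        have := hmono n hn n₂ hn₂ hlt.le r'
        omega
    have h1 : (s.card : ℝ) ≤ A.card + B.card := by
      exact_mod_cast (Finset.card_le_card hsub).trans (Finset.card_union_le _ _)
    linarith
  · push Not at hex
    set E := s.filter fun n => T.pos n r < P with hE
    have hsub : s ⊆ E ∪ B := by
      intro n hn
      rw [Finset.mem_union, hE, hB, Finset.mem_filter, Finset.mem_filter]
      rcases (hle n hn).eq_or_lt with h1 | h1
      · exact Or.inr ⟨hn, h1, lt_of_le_of_ne (hge' n hn) (hex n hn h1).symm⟩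
      · exact Or.inl ⟨hn, h1⟩
    have h1 : (s.card : ℝ) ≤ E.card + B.card := by
      exact_mod_cast (Finset.card_le_card hsub).trans (Finset.card_union_le _ _)
    rcases hfp.eq_or_lt with h2 | h2
    · have h3 : E = ∅ := by
        refine Finset.filter_eq_empty_iff.2 fun n hn => ?_
        obtain ⟨H, hH⟩ := hph n hn
        have := hH.invariants.first_le r
        omega
      rw [h3, Finset.card_empty, Nat.cast_zero] at h1
      have : 0 ≤ x * (v / df) := by positivity
      linarith
    · have h3 := hT.card_pos_lt_le (q := q) (s := E) (r := r) (P := P)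
        (fun n hn => hset n (Finset.mem_filter.1 hn).1)
        (fun n hn => hph n (Finset.mem_filter.1 hn).1) (fun n hn => (Finset.mem_filter.1 hn).2)
        (fun p hp => hinP p hp.le) h2
      have h4 : ((P : ℝ) - r * len) * v / df = ((P : ℝ) - r * len) * (v / df) := by ring
      have h5 : ((P : ℝ) - r * len + (1 - x)) * (v / df) ≤ len * (v / df) := by
        apply mul_le_mul_of_nonneg_right _ hvd
        linarith
      rw [h4] at h3
      linarith

end Trajectory.Regular

/-! ### Total running time along regular paths. -/

namespace Trajectory.Regular

variable {M L N : ℕ} {one : Prop} {h : ℝ} {R : OrderingRule M L} {W : Fin M → ℕ → ℝ}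
  {T : Trajectory M L N one h R W} {D : Finset (Fin M)} {dg df δ v b : ℝ} {m : ℕ}

/-- If all machines have finished at the end of `s` and the run has not stopped, then the sum LLR
of an anomalous cell is still small, and therefore `s` is short. -/
theorem card_le_of_finished (hT : T.Regular D dg df δ v b m) (hv0 : 0 < N ∨ v = 0)
    {q : ℕ → Fin (M - L) → Fin M} {s : Finset ℕ}
    (hset : ∀ n ∈ s, Settled T (young dg df δ) m n) (hph : ∀ n ∈ s, ∃ H, T.Phase n H (q n))
    {n₁ : ℕ} (hn₁ : n₁ ∈ s) (hmax : ∀ n ∈ s, n ≤ n₁)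
    (hfin : ∀ r : Fin N, ¬ InMachine M L N r (T.pos n₁ r)) {t : ℝ} (ht : one → b - v ≤ dg * t) :
    (s.card : ℝ) ≤ t + δ / dg + 1 := by
  have hdg := hT.dg_pos
  have hv := hT.level_nonneg
  have hh : h ≤ 0 := by rw [hT.level]; linarith
  obtain ⟨H, hH⟩ := hph n₁ hn₁
  have hi := hH.invariants
  have hc : (positives (T.sums n₁)).card = L := by rw [← hi.eq_positives, hi.card_eq]
  -- Without machines for normal cells the level is 0, and it suffices that unsuspected sums are not
  -- positive.
  have hneg : ∀ j ∉ H, T.sums n₁ j ≤ -v := by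
    intro j hj
    rcases hv0 with hN | hv0
    · obtain ⟨p, rfl⟩ := hi.surjective hj
      have := sums_lt_of_finished hh hT.lt hN hH hfin p
      have := hT.level
      linarith
    · rw [hv0, neg_zero]
      rw [hi.eq_positives, mem_positives] at hj
      exact not_lt.1 hj
  by_cases h1 : one
  swap
  -- In Case 2 `v = b`, so finished machines together with positive suspected sums already give the
  -- gap.
  · exfalso
    refine hT.notGap n₁ (hset n₁ hn₁).1 (gapAtLeast_of_positives hc ?_)
    intro i hiH j hj
    rw [← hi.eq_positives] at hj
    have := hneg j hj
    have := mem_positives.1 hiH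
    have := (hT.two h1).1
    linarith
  have hHD := (hT.suspects_eq h1 (hset n₁ hn₁) hH).1
  -- In Case 1 the gap can be missed only because of an anomalous cell with sum below `b - v`. This
  -- cell is probed in every step of `s`, so its positive drift makes `s` short.
  obtain ⟨i, hiD, hi1⟩ : ∃ i ∈ D, T.sums n₁ i < b - v := by
    by_contra hall
    push Not at hall
    refine hT.notGap n₁ (hset n₁ hn₁).1 (gapAtLeast_of_positives hc ?_)
    intro i hiH j hj
    rw [← hi.eq_positives] at hj hiH
    have := hneg j hj
    have := hall i (hHD ▸ hiH)
    linarith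
  have hprobe : ∀ n ∈ s, i ∈ T.probe n := by
    intro n hn
    obtain ⟨H', hH'⟩ := hph n hn
    refine (T.exploit n H' (q n) hH'.suspects hH'.plan i).2 (Or.inl ⟨h1, ?_⟩)
    rw [(hT.suspects_eq h1 (hset n hn) hH').1]; exact hiD
  have h2 := T.card_le_of_count_mem i (s.erase n₁) 0 (T.count n₁ i)
    (fun n hn => hprobe n (Finset.mem_of_mem_erase hn)) (fun _ _ => Nat.zero_le _)
    (fun n hn => T.count_lt_count (hprobe n (Finset.mem_of_mem_erase hn))
      (lt_of_le_of_ne (hmax n (Finset.mem_of_mem_erase hn)) (Finset.ne_of_mem_erase hn)))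
  rw [Finset.card_erase_of_mem hn₁] at h2
  have h3 : (s.card : ℝ) ≤ T.count n₁ i + 1 := by
    have : s.card ≤ T.count n₁ i + 1 := by omega
    exact_mod_cast this
  have h4 := hT.anomalous i hiD 0 (Nat.zero_le _) (T.count n₁ i) (Nat.zero_le _)
  rw [hT.zero] at h4
  push_cast at h4
  have h5 : (T.count n₁ i : ℝ) - t ≤ δ / dg := by
    rw [le_div_iff₀ hdg]
    have := ht h1
    unfold sums at hi1
    linarith
  linarith

/-- Along regular paths, CCS does not run for longer than along paths without fluctuations, up to
errors. -/
theorem time_le (hT : T.Regular D dg df δ v b m) (hNM : N ≤ M - L) (hv0 : 0 < N ∨ v = 0) {t : ℝ}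
    (ht0 : 0 ≤ t) (ht : one → b - v ≤ dg * t)
    (ht' : 0 < N → ((M : ℝ) - L) / N * v ≤ df * t) :
    (m : ℝ) ≤ t + (4 * M + N * M * M + 2) * (δ / dg + δ / df + 1) := by
  classical
  have hdg := hT.dg_pos
  have hdf := hT.df_pos
  have hδ := hT.nonneg
  have hδg : 0 ≤ δ / dg := div_nonneg hδ hdg.le
  have hδf : 0 ≤ δ / df := div_nonneg hδ hdf.le
  have hM : 0 < M := (Nat.zero_le L).trans_lt hT.lt
  have : Inhabited (Fin M) := ⟨⟨0, hM⟩⟩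
  have hex : ∀ n, ∃ q : Fin (M - L) → Fin M, T.suspects n ≠ none → ∃ H, T.Phase n H q := by
    intro n
    rcases T.exists_phase_or_explore n with h1 | ⟨H, q, hph, -⟩
    · exact ⟨fun _ => default, fun h2 => absurd h1 h2⟩
    · exact ⟨q, fun _ => ⟨H, hph⟩⟩
  choose q hq using hex
  set κ := young dg df δ with hκ
  set G := (Finset.range m).filter (Settled T κ m) with hG
  set G₁ := G.filter (Stale T q) with hG₁
  set F := G.filter fun n => ¬ Stale T q n with hF
  have hGset : ∀ n ∈ G, Settled T κ m n := fun n hn => (Finset.mem_filter.1 hn).2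
  have hGph : ∀ n ∈ G, ∃ H, T.Phase n H (q n) := fun n hn => hq n (hGset n hn).2.1
  have hFG : ∀ n ∈ F, n ∈ G := fun n hn => (Finset.mem_filter.1 hn).1
  -- The steps are those of exploration, those with an unsettled cell, the stale ones in `G₁`, and
  -- the rest `F`. Only `F` contributes more than an error term.
  have hsub : Finset.range m ⊆
      (((Finset.range m).filter fun n => T.suspects n = none) ∪
      ((Finset.range m).filter fun n => ∃ i ∈ T.probe n, T.count n i < κ)) ∪ G := by
    intro n hn
    rw [← Finset.filter_or, Finset.mem_union, Finset.mem_filter]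
    by_cases h1 : T.suspects n = none ∨ ∃ i ∈ T.probe n, T.count n i < κ
    · exact Or.inl ⟨hn, h1⟩
    · push Not at h1
      exact Or.inr (Finset.mem_filter.2 ⟨hn, Finset.mem_range.1 hn, h1⟩)
  have hcard : (m : ℝ) ≤ M * (κ + 1) + M * κ + (G₁.card + F.card) := by
    have h1 := Finset.card_le_card hsub
    rw [Finset.card_range] at h1
    have h2 : G₁.card + F.card = G.card := Finset.card_filter_add_card_filter_not _
    have h3 := card_explore_le (T := T) hT.zero hT.one_le hT.card_eq hT.signsSettled m
    have h4 := T.card_young_le κ m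
    have h5 : m ≤ M * (κ + 1) + M * κ + (G₁.card + F.card) := by
      rw [h2]
      refine h1.trans ((Finset.card_union_le _ _).trans (add_le_add ?_ le_rfl))
      exact (Finset.card_union_le _ _).trans (add_le_add h3 h4)
    exact_mod_cast h5
  have hG₁c : (G₁.card : ℝ) ≤ N * M * M * (δ / df + 1) :=
    hT.card_stale_le (q := q) (fun n hn => hGset n (Finset.mem_filter.1 hn).1)
      (fun n hn => hGph n (Finset.mem_filter.1 hn).1) (fun n hn => (Finset.mem_filter.1 hn).2)
  have hFc : (F.card : ℝ) ≤ t + (M + 2) * (δ / dg + δ / df + 1) := by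
    rcases F.eq_empty_or_nonempty with h1 | h1
    · rw [h1, Finset.card_empty, Nat.cast_zero]; positivity
    have hmem := F.max'_mem h1
    -- At the last step of `F` either some machine is still at work, and `F` is bounded by the time
    -- for a piece, or all have finished, and the anomalous cells decide. Both times are at most
    -- `t`.
    by_cases h2 : ∃ r : Fin N, InMachine M L N r (T.pos (F.max' h1) r)
    · obtain ⟨r, hr⟩ := h2
      have h3 := hT.card_le_of_unfinished hNM (fun n hn => hGset n (hFG n hn))
        (fun n hn => hGph n (hFG n hn)) (fun n hn => (Finset.mem_filter.1 hn).2) hmem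
        (fun n hn => F.le_max' n hn) hr
      have h4 : ((M : ℝ) - L) / N * v / df ≤ t := by
        rw [div_le_iff₀ hdf, mul_comm t]
        exact ht' ((Nat.zero_le _).trans_lt r.2)
      have h5 : ((M : ℝ) + 2) * (δ / df + 1) ≤ (M + 2) * (δ / dg + δ / df + 1) := by
        gcongr; linarith
      linarith
    · push Not at h2
      have h3 := hT.card_le_of_finished hv0 (fun n hn => hGset n (hFG n hn))
        (fun n hn => hGph n (hFG n hn)) hmem (fun n hn => F.le_max' n hn) h2 ht
      have h5 : 1 * (δ / dg + δ / df + 1) ≤ ((M : ℝ) + 2) * (δ / dg + δ / df + 1) := by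
        gcongr
        have : (0 : ℝ) ≤ M := by positivity
        linarith
      linarith
  have hκ' := hT.young_le
  rw [← hκ] at hκ'
  have h1 : (M : ℝ) * (κ + 1) + M * κ ≤ 3 * M * (δ / dg + δ / df + 1) := by
    have : (M : ℝ) * κ ≤ M * (δ / dg + δ / df + 1) := by gcongr
    have h2 : (M : ℝ) * 1 ≤ M * (δ / dg + δ / df + 1) := by gcongr; linarith
    linarith
  have h2 : (N : ℝ) * M * M * (δ / df + 1) ≤ N * M * M * (δ / dg + δ / df + 1) := by
    gcongr; linarith
  linarith

end Trajectory.Regular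

/-! ### The runs of the CCS policy -/

section History

variable {M : ℕ} {Y : Type*}

theorem probeCount_cons (X : Fin M × ℕ → Y) (A : Finset (Fin M)) (h : List (Record M Y))
    (i : Fin M) : probeCount (nextRecord X A h :: h) i =
      if i ∈ A then probeCount h i + 1 else probeCount h i := by
  unfold probeCount nextRecord
  rw [List.countP_cons]
  by_cases hi : i ∈ A <;> simp [hi]

/-- The sum of the log-likelihood ratios of the first `k` observations in cell `i`. -/
def walk [MeasurableSpace Y] (f g : Measure Y) (X : Fin M × ℕ → Y) (i : Fin M) (k : ℕ) : ℝ :=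
  ∑ r ∈ Finset.range k, llr g f (X (i, r))

theorem Policy.natCast_le_stopTime {Γ : Policy M Y} {ω : Sample M Y} {m : ℕ} :
    (m : ℕ∞) ≤ Γ.stopTime ω ↔ ∀ n < m, ∀ D, Γ.action ω n ≠ Action.declare D := by
  unfold Policy.stopTime
  simp only [le_iInf_iff, Nat.cast_le]
  constructor
  · intro h n hn D e
    exact absurd (h n ⟨D, e⟩) (not_le.2 hn)
  · rintro h n ⟨D, e⟩
    by_contra hlt
    exact h n (not_le.1 hlt) D e

theorem Policy.stopTime_le_ofReal {Γ : Policy M Y} {ω : Sample M Y} {x : ℝ}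
    (h : ∀ m : ℕ, (m : ℕ∞) ≤ Γ.stopTime ω → (m : ℝ) ≤ x) :
    ((Γ.stopTime ω : ℕ∞) : ℝ≥0∞) ≤ ENNReal.ofReal x := by
  cases hτ : Γ.stopTime ω with
  | top =>
    exfalso
    obtain ⟨m, hm⟩ := exists_nat_gt x
    exact absurd (h m (by rw [hτ]; exact le_top)) (not_le.2 hm)
  | coe m =>
    have := h m hτ.ge
    rw [ENat.toENNReal_coe, ← ENNReal.ofReal_natCast]
    exact ENNReal.ofReal_le_ofReal this

theorem Policy.history_succ_of_declare {Γ : Policy M Y} {ω : Sample M Y} {n : ℕ}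
    {D : Finset (Fin M)} (h : Γ.action ω n = Action.declare D) :
    Γ.history ω (n + 1) = Γ.history ω n := by
  rw [Policy.history]
  unfold Policy.action at h
  rw [h]

theorem Policy.action_of_declare {Γ : Policy M Y} {ω : Sample M Y} {n : ℕ} {D : Finset (Fin M)}
    (h : Γ.action ω n = Action.declare D) {m : ℕ} (hm : n ≤ m) :
    Γ.history ω m = Γ.history ω n ∧ Γ.action ω m = Action.declare D := by
  induction m, hm using Nat.le_induction with
  | base => exact ⟨rfl, h⟩
  | succ m _ ih =>
    have h1 := Policy.history_succ_of_declare ih.2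
    refine ⟨h1.trans ih.1, ?_⟩
    have := ih.2
    unfold Policy.action at this ⊢
    rw [h1, this]

end History

/-! ### The unstopped run of CCS as a trajectory. -/

section State

variable {M L N : ℕ} {Y : Type*} [MeasurableSpace Y] (f g : Measure Y) (b : ℝ)
  (R : OrderingRule M L) (X : Fin M × ℕ → Y)

theorem ccsUpdate_llr (st : CCSState M L N) (row : Record M Y) (i : Fin M) :
    (ccsUpdate f g b R st row).llr i = st.llr i + (row i).elim 0 (llr g f) := by
  unfold ccsUpdate
  simp only
  split_ifs <;> first | rfl | (split <;> rfl)

theorem ccsUpdate_turn (st : CCSState M L N) (row : Record M Y) :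
    (ccsUpdate f g b R st row).turn = if st.suspects = none then st.turn + 1 else st.turn := by
  unfold ccsUpdate
  simp only
  split_ifs <;> first | rfl | (split <;> rfl)

theorem ccsUpdate_of_card_ne (st : CCSState M L N) (row : Record M Y)
    (hc : (positives (ccsUpdate f g b R st row).llr).card ≠ L) :
    (ccsUpdate f g b R st row).suspects = none ∧ (ccsUpdate f g b R st row).plan = st.plan ∧
      ∀ r, (ccsUpdate f g b R st row).pos r = 0 := by
  rw [show (ccsUpdate f g b R st row).llr = fun i => st.llr i + (row i).elim 0 (llr g f) from
    funext fun i => ccsUpdate_llr f g b R st row i] at hc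
  unfold ccsUpdate
  simp only [if_neg hc]
  exact ⟨trivial, trivial, fun _ => trivial⟩

theorem ccsUpdate_of_eq (st : CCSState M L N) (row : Record M Y) (q : Fin (M - L) → Fin M)
    (hc : (positives (ccsUpdate f g b R st row).llr).card = L)
    (hs : st.suspects = some (positives (ccsUpdate f g b R st row).llr)) (hq : st.plan = some q) :
    (ccsUpdate f g b R st row).suspects = st.suspects ∧
      (ccsUpdate f g b R st row).plan = some q ∧
      ∀ r, (ccsUpdate f g b R st row).pos r =
        advance (N := N) b (ccsUpdate f g b R st row).llr q r (st.pos r) := by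
  have e : (ccsUpdate f g b R st row).llr = fun i => st.llr i + (row i).elim 0 (llr g f) :=
    funext fun i => ccsUpdate_llr f g b R st row i
  rw [e] at hc hs ⊢
  unfold ccsUpdate
  simp only [if_pos hc, hq, hs, decide_true]
  exact ⟨trivial, trivial, fun _ => trivial⟩

theorem ccsUpdate_of_ne (st : CCSState M L N) (row : Record M Y)
    (hc : (positives (ccsUpdate f g b R st row).llr).card = L)
    (hs : st.suspects ≠ some (positives (ccsUpdate f g b R st row).llr)) :
    (ccsUpdate f g b R st row).suspects = some (positives (ccsUpdate f g b R st row).llr) ∧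
      (ccsUpdate f g b R st row).plan =
        some (R.order st.plan (positives (ccsUpdate f g b R st row).llr)) ∧
      ∀ r, (ccsUpdate f g b R st row).pos r = advance (N := N) b (ccsUpdate f g b R st row).llr
        (R.order st.plan (positives (ccsUpdate f g b R st row).llr)) r (firstPlace M L N r) := by
  have e : (ccsUpdate f g b R st row).llr = fun i => st.llr i + (row i).elim 0 (llr g f) :=
    funext fun i => ccsUpdate_llr f g b R st row i
  rw [e] at hc hs ⊢
  unfold ccsUpdate
  simp only [if_pos hc, hs, decide_false]
  split
  · simp at *
  · exact ⟨rfl, rfl, fun _ => rfl⟩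

/-- The sum LLRs of the state after a history whose records come from the observations `X`. -/
theorem llr_ccsState_cons (A : Finset (Fin M)) (h : List (Record M Y))
    (hh : ∀ i, (ccsState N f g b R h).llr i = walk f g X i (probeCount h i)) (i : Fin M) :
    (ccsState N f g b R (nextRecord X A h :: h)).llr i =
      walk f g X i (probeCount (nextRecord X A h :: h) i) := by
  rw [ccsState, ccsUpdate_llr, hh, probeCount_cons]
  by_cases hi : i ∈ A
  · simp [nextRecord, hi, walk, Finset.sum_range_succ]
  · simp [nextRecord, hi]

/-- The history of the CCS policy if it does not stop. -/
def ccsRun (N : ℕ) : ℕ → List (Record M Y)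
  | 0 => []
  | n + 1 => nextRecord X (ccsProbe f g (ccsState N f g b R (ccsRun N n))) (ccsRun N n) ::
      ccsRun N n

theorem llr_ccsRun (n : ℕ) (i : Fin M) :
    (ccsState N f g b R (ccsRun f g b R X N n)).llr i =
      walk f g X i (probeCount (ccsRun f g b R X N n) i) := by
  induction n generalizing i with
  | zero => simp [ccsRun, ccsState, ccsInit, probeCount, walk]
  | succ n ih => exact llr_ccsState_cons f g b R X _ _ ih i

theorem llr_ccsRun_eq (n : ℕ) :
    (ccsState N f g b R (ccsRun f g b R X N n)).llr =
      fun i => walk f g X i (probeCount (ccsRun f g b R X N n) i) :=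
  funext (llr_ccsRun f g b R X n)

/-- The run of the state machine of CCS for the observations `X`. -/
def ccsTrajectory (N : ℕ) : Trajectory M L N (CaseOne f g M L) b R (walk f g X) where
  count n := probeCount (ccsRun f g b R X N n)
  turn n := (ccsState N f g b R (ccsRun f g b R X N n)).turn
  plan n := (ccsState N f g b R (ccsRun f g b R X N n)).plan
  suspects n := (ccsState N f g b R (ccsRun f g b R X N n)).suspects
  pos n := (ccsState N f g b R (ccsRun f g b R X N n)).pos
  probe n := ccsProbe f g (ccsState N f g b R (ccsRun f g b R X N n))
  count_zero i := rfl
  turn_zero := rfl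
  suspects_zero := rfl
  pos_zero r := rfl
  count_succ n i := probeCount_cons _ _ _ _
  turn_succ n := ccsUpdate_turn f g b R _ _
  lost n hc := by
    rw [← llr_ccsRun_eq] at hc
    exact ccsUpdate_of_card_ne f g b R _ _ hc
  goOn n q hc hs hq := by
    rw [← llr_ccsRun_eq] at hc hs ⊢
    exact ccsUpdate_of_eq f g b R _ _ q hc hs hq
  renew n hc hs := by
    rw [← llr_ccsRun_eq] at hc hs ⊢
    exact ccsUpdate_of_ne f g b R _ _ hc hs
  explore n hs i := by
    simp [ccsProbe, hs]
  exploit n H q hs hq i := by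
    simp only [ccsProbe, hs, hq]
    by_cases h1 : CaseOne f g M L <;> simp [h1]

end State

/-! ### Comparison of the stopped policy with the unstopped run. -/

section Stopping

variable {M K L : ℕ} {Y : Type*} [MeasurableSpace Y] (f g : Measure Y)
  (R : OrderingRule M L) (c : ℝ)

/-- The run of the state machine of `ccs K f g R c`. -/
abbrev ccsTraj (K : ℕ) (X : Fin M × ℕ → Y) : Trajectory M L (normalMachines f g M K L)
    (CaseOne f g M L) (level f g M K L c) R (walk f g X) :=
  ccsTrajectory f g (level f g M K L c) R X (normalMachines f g M K L)

variable {f g R c}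

theorem ccs_history_eq {ω : Sample M Y} {n : ℕ}
    (hn : ∀ m < n, ∀ D, (ccs K f g R c).action ω m ≠ Action.declare D) :
    (ccs K f g R c).history ω n =
      ccsRun f g (level f g M K L c) R ω.2 (normalMachines f g M K L) n := by
  induction n with
  | zero => rfl
  | succ n ih =>
    have h1 := ih fun m hm => hn m (by omega)
    have h2 := hn n (by omega)
    have h3 : (ccs K f g R c) ω.1 ((ccs K f g R c).history ω n) = Action.probe
        (ccsProbe f g (ccsState (normalMachines f g M K L) f g (level f g M K L c) R
          ((ccs K f g R c).history ω n))) := by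
      unfold Policy.action at h2
      simp only [ccs] at h2 ⊢
      split_ifs with h4
      · simp only [h4, if_true] at h2
        exact absurd rfl (h2 _)
      · rfl
    rw [Policy.history, h3]
    simp only
    rw [h1]
    rfl

theorem ccs_not_gap {ω : Sample M Y} {n : ℕ}
    (hn : ∀ m ≤ n, ∀ D, (ccs K f g R c).action ω m ≠ Action.declare D) :
    ¬ GapAtLeast L ((ccsTraj f g R c K ω.2).sums n) (-Real.log c) ∧
      (ccs K f g R c).action ω n = Action.probe ((ccsTraj f g R c K ω.2).probe n) := by
  have h1 := ccs_history_eq fun m (hm : m < n) => hn m hm.le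
  have h2 := hn n le_rfl
  unfold Policy.action at h2 ⊢
  rw [h1] at h2 ⊢
  have e : (ccsTraj f g R c K ω.2).sums n = (ccsState (normalMachines f g M K L) f g
      (level f g M K L c) R (ccsRun f g (level f g M K L c) R ω.2
      (normalMachines f g M K L) n)).llr := (llr_ccsRun_eq _ _ _ _ _ _).symm
  rw [e]
  simp only [ccs] at h2 ⊢
  split_ifs at h2 ⊢ with h4
  · exact absurd rfl (h2 _)
  · exact ⟨h4, rfl⟩

theorem not_gap_of_le_stopTime {ω : Sample M Y} {m : ℕ}
    (hm : (m : ℕ∞) ≤ (ccs K f g R c).stopTime ω) :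
    ∀ n < m, ¬ GapAtLeast L ((ccsTraj f g R c K ω.2).sums n) (-Real.log c) := by
  intro n hn
  rw [Policy.natCast_le_stopTime] at hm
  exact (ccs_not_gap fun k hk => hm k (by omega)).1

theorem ccs_switchings_le {X : Fin M × ℕ → Y} {u : unitInterval} {D : Finset (Fin M)} {κ : ℕ}
    (hL : 1 ≤ L) (hD : D.card = L) (hκ : Trajectory.SignsSettled (walk f g X) D κ) :
    (ccs K f g R c).switchings (u, X) ≤
      ((M * (normalMachines f g M K L * M) + M * (1 + normalMachines f g M K L * M) *
        (M * (κ + 1) + M * κ) : ℕ) : ℝ≥0∞) := by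
  have hterm : ∀ n, ((ccs K f g R c).probed (u, X) (n + 1) \ (ccs K f g R c).probed (u, X) n).card
      ≤ ((ccsTraj f g R c K X).probe (n + 1) \ (ccsTraj f g R c K X).probe n).card := by
    intro n
    -- From the declaration on the probed set is empty, so no further switching is counted.
    by_cases hτ : ∃ m ≤ n + 1, ∃ D, (ccs K f g R c).action (u, X) m = Action.declare D
    · obtain ⟨m, hm, D, h1⟩ := hτ
      have h2 := (Policy.action_of_declare h1 hm).2
      have : (ccs K f g R c).probed (u, X) (n + 1) = ∅ := by
        unfold Policy.probed
        rw [h2]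
      rw [this]; simp
    · push Not at hτ
      have h1 := (ccs_not_gap (ω := (u, X)) hτ).2
      have h2 := (ccs_not_gap (ω := (u, X)) (n := n) fun m hm => hτ m (by omega)).2
      unfold Policy.probed
      rw [h1, h2]
  unfold Policy.switchings
  refine ENNReal.tsum_le_of_sum_range_le fun m => ?_
  rw [← Nat.cast_sum]
  refine Nat.cast_le.2 ((Finset.sum_le_sum fun n _ => hterm n).trans ?_)
  exact Trajectory.sum_switchings_le (fun i => by simp [walk]) hL hD hκ m

end Stopping

/-! ### Product measures -/

section ProductMeasure

variable {ι Y : Type*} [MeasurableSpace Y]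

theorem lintegral_prod_infinitePi (μ : ι → Measure Y) [∀ p, IsProbabilityMeasure (μ p)]
    (φ : ι → Y → ℝ≥0∞) (hφ : ∀ p, Measurable (φ p)) (S : Finset ι) :
    ∫⁻ x, ∏ p ∈ S, φ p (x p) ∂(Measure.infinitePi μ) = ∏ p ∈ S, ∫⁻ y, φ p y ∂(μ p) := by
  refine (ProbabilityTheory.lintegral_prod_eq_prod_lintegral_of_indepFun S
    (fun p (x : ι → Y) => φ p (x p)) (ProbabilityTheory.iIndepFun_infinitePi hφ)
    (fun p => by fun_prop)).trans ?_
  refine Finset.prod_congr rfl fun p _ => ?_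
  rw [← (measurePreserving_eval_infinitePi μ p).lintegral_comp (hφ p)]

/-- Replacing the factors with index in `S` by absolutely continuous ones amounts to a density. -/
theorem infinitePi_withDensity (μ ν : ι → Measure Y) [∀ p, IsProbabilityMeasure (μ p)]
    [∀ p, IsProbabilityMeasure (ν p)] (S : Finset ι) (ρ : ι → Y → ℝ≥0∞)
    (hρ : ∀ p, Measurable (ρ p)) (hS : ∀ p ∈ S, ν p = (μ p).withDensity (ρ p))
    (hS' : ∀ p ∉ S, ν p = μ p) :
    (Measure.infinitePi μ).withDensity (fun x => ∏ p ∈ S, ρ p (x p)) = Measure.infinitePi ν := by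
  classical
  refine Measure.eq_infinitePi ν fun s t ht => ?_
  have hmeas : MeasurableSet (Set.pi (s : Set ι) t) :=
    MeasurableSet.pi s.countable_toSet fun p _ => ht p
  have hone : ∀ p ∈ S, ∫⁻ y, ρ p y ∂(μ p) = 1 := by
    intro p hp
    have h1 : ν p Set.univ = 1 := measure_univ
    rw [hS p hp, withDensity_apply _ MeasurableSet.univ, Measure.restrict_univ] at h1
    exact h1
  -- The indicator of the cylinder and the density are merged into one product over `s ∪ S`; the
  -- coordinates of `S` outside `s` integrate to 1 by `hone`.
  set φ : ι → Y → ℝ≥0∞ := fun p y =>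
    (if p ∈ s then (t p).indicator 1 y else 1) * (if p ∈ S then ρ p y else 1) with hφ
  have hφm : ∀ p, Measurable (φ p) := by
    intro p
    refine Measurable.mul ?_ ?_
    · split_ifs
      · exact measurable_one.indicator (ht p)
      · exact measurable_const
    · split_ifs
      · exact hρ p
      · exact measurable_const
  have hint : ∀ x : ι → Y, (Set.pi (s : Set ι) t).indicator (fun x => ∏ p ∈ S, ρ p (x p)) x =
      ∏ p ∈ s ∪ S, φ p (x p) := by
    intro x
    simp only [hφ, Finset.prod_mul_distrib]
    rw [← Finset.prod_subset (Finset.subset_union_left (s₁ := s) (s₂ := S)) (fun p _ hp => by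
      rw [if_neg hp]), ← Finset.prod_subset (Finset.subset_union_right (s₁ := s) (s₂ := S))
      (fun p _ hp => by rw [if_neg hp])]
    rw [Finset.prod_congr rfl (fun p hp => if_pos hp),
      Finset.prod_congr (s₁ := S) rfl (fun p hp => if_pos hp)]
    by_cases hx : x ∈ Set.pi (s : Set ι) t
    · have h1 : ∏ p ∈ s, (t p).indicator (1 : Y → ℝ≥0∞) (x p) = 1 :=
        Finset.prod_eq_one fun p hp => by rw [Set.indicator_of_mem (hx p hp), Pi.one_apply]
      rw [Set.indicator_of_mem hx, h1, one_mul]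
    · rw [Set.indicator_of_notMem hx]
      simp only [Set.mem_pi, Finset.mem_coe, not_forall] at hx
      obtain ⟨p, hp, hxp⟩ := hx
      rw [Finset.prod_eq_zero hp (Set.indicator_of_notMem hxp _), zero_mul]
  rw [withDensity_apply _ hmeas, ← lintegral_indicator hmeas, lintegral_congr hint,
    lintegral_prod_infinitePi μ φ hφm]
  rw [← Finset.prod_subset (Finset.subset_union_left (s₁ := s) (s₂ := S))]
  · refine Finset.prod_congr rfl fun p hp => ?_
    simp only [hφ, if_pos hp]
    by_cases hpS : p ∈ S
    · simp only [if_pos hpS]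
      rw [hS p hpS, withDensity_apply _ (ht p), ← lintegral_indicator (ht p)]
      refine lintegral_congr fun y => ?_
      by_cases hy : y ∈ t p <;> simp [hy]
    · simp only [if_neg hpS, mul_one]
      rw [hS' p hpS, lintegral_indicator_one (ht p)]
  · intro p hp hps
    have hpS : p ∈ S := (Finset.mem_union.1 hp).resolve_left hps
    simp only [hφ, if_neg hps, if_pos hpS, one_mul]
    exact hone p hpS

/-- Any function of the coordinates in `S` is a function of the restriction to `S`. -/
theorem exists_comp_restrict_of_dependsOn {β : Type*} [MeasurableSpace β] [Nonempty Y]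
    {S : Finset ι} {G : (ι → Y) → β} (hG : Measurable G) (hdep : DependsOn G (S : Set ι)) :
    ∃ G' : (S → Y) → β, Measurable G' ∧ ∀ x, G x = G' (S.restrict x) := by
  classical
  obtain ⟨y₀⟩ := ‹Nonempty Y›
  refine ⟨fun y => G fun p => if hp : p ∈ S then y ⟨p, hp⟩ else y₀, hG.comp ?_, fun x => ?_⟩
  · refine measurable_pi_lambda _ fun p => ?_
    by_cases hp : p ∈ S
    · simp only [hp, dif_pos]; fun_prop
    · simp only [hp]; exact measurable_const
  · refine hdep fun p hp => ?_
    have hp' : p ∈ S := hp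
    simp [hp']

theorem lintegral_infinitePi_congr (μ ν : ι → Measure Y) [∀ p, IsProbabilityMeasure (μ p)]
    [∀ p, IsProbabilityMeasure (ν p)] {S : Finset ι} (hS : ∀ p ∈ S, μ p = ν p)
    {G : (ι → Y) → ℝ≥0∞} (hG : Measurable G) (hdep : DependsOn G (S : Set ι)) :
    ∫⁻ x, G x ∂(Measure.infinitePi μ) = ∫⁻ x, G x ∂(Measure.infinitePi ν) := by
  rcases isEmpty_or_nonempty Y with hY | hY
  · rcases isEmpty_or_nonempty ι with hι | ⟨⟨p⟩⟩
    · rw [show μ = ν from funext fun p => hι.elim p]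
    · have h1 : (μ p) Set.univ = 1 := measure_univ
      rw [Set.univ_eq_empty_iff.2 hY, measure_empty] at h1
      exact absurd h1 zero_ne_one
  obtain ⟨G', hG', h⟩ := exists_comp_restrict_of_dependsOn hG hdep
  simp only [h]
  rw [lintegral_restrict_infinitePi μ hG', lintegral_restrict_infinitePi ν hG']
  congr 2
  funext p
  exact hS p p.2

/-- Change of measure for functions of finitely many coordinates. -/
theorem lintegral_infinitePi_change (μ ν : ι → Measure Y) [∀ p, IsProbabilityMeasure (μ p)]
    [∀ p, IsProbabilityMeasure (ν p)] (S : Finset ι) (ρ : ι → Y → ℝ≥0∞)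
    (hρ : ∀ p, Measurable (ρ p)) (hS : ∀ p ∈ S, ν p = (μ p).withDensity (ρ p))
    {G : (ι → Y) → ℝ≥0∞} (hG : Measurable G) (hdep : DependsOn G (S : Set ι)) :
    ∫⁻ x, G x ∂(Measure.infinitePi ν) =
      ∫⁻ x, G x * ∏ p ∈ S, ρ p (x p) ∂(Measure.infinitePi μ) := by
  classical
  -- The two products may differ in infinitely many coordinates and then be mutually singular. `ν'`
  -- changes only the coordinates in `S`, and `G` does not see the others.
  set ν' : ι → Measure Y := fun p => if p ∈ S then ν p else μ p with hν'
  have : ∀ p, IsProbabilityMeasure (ν' p) := by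
    intro p; simp only [hν']; split_ifs <;> infer_instance
  rw [lintegral_infinitePi_congr ν ν' (S := S) (fun p hp => by simp [hν', hp]) hG hdep,
    ← infinitePi_withDensity μ ν' S ρ hρ (fun p hp => by simp [hν', hp, hS p hp])
      (fun p hp => by simp [hν', hp]),
    lintegral_withDensity_eq_lintegral_mul _ (by fun_prop) hG]
  simp only [Pi.mul_apply, mul_comm]

theorem integral_mul_infinitePi (μ : ι → Measure Y) [∀ p, IsProbabilityMeasure (μ p)]
    {S : Finset ι} {p : ι} (hp : p ∉ S) {φ : Y → ℝ} (hφ : Measurable φ)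
    {G : (ι → Y) → ℝ} (hG : Measurable G) (hdep : DependsOn G (S : Set ι)) :
    ∫ x, φ (x p) * G x ∂(Measure.infinitePi μ) =
      (∫ y, φ y ∂(μ p)) * ∫ x, G x ∂(Measure.infinitePi μ) := by
  classical
  have hY : Nonempty Y := nonempty_of_isProbabilityMeasure (μ p)
  obtain ⟨G', hG', h⟩ := exists_comp_restrict_of_dependsOn hG hdep
  have hind := (ProbabilityTheory.iIndepFun_infinitePi (P := μ) (X := fun _ y => y)
    (fun _ => measurable_id)).indepFun_finset {p} S
    (Finset.disjoint_singleton_left.2 hp) (fun q => by fun_prop)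
  have hind' := hind.comp (φ := fun z : ({p} : Finset ι) → Y => φ (z ⟨p, Finset.mem_singleton_self p⟩))
    (ψ := G') (by fun_prop) hG'
  have e : ∀ x, G x = (G' ∘ fun (a : ι → Y) (i : S) => a i) x := h
  simp only [e]
  have hm : Measurable fun (a : ι → Y) (i : S) => a i := by fun_prop
  refine (hind'.integral_fun_mul_eq_mul_integral
    (by fun_prop : Measurable fun x : ι → Y => φ (x p)).aestronglyMeasurable
    (hG'.comp hm).aestronglyMeasurable).trans ?_
  congr 1
  rw [← (measurePreserving_eval_infinitePi μ p).map_eq,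
    integral_map (measurable_pi_apply p).aemeasurable hφ.aestronglyMeasurable]
  rfl

end ProductMeasure

/-! ### Densities -/

section Density

variable {Y : Type*} [MeasurableSpace Y] (f g : Measure Y) [IsProbabilityMeasure f]
  [IsProbabilityMeasure g]

/-- Mutual absolute continuity is needed because of log 0 = 0: where dg/df vanishes, the exponential
of `llr g f` would be 1 instead of 0. -/
theorem withDensity_exp_llr (hgf : g ≪ f) (hfg : f ≪ g) :
    f.withDensity (fun y => ENNReal.ofReal (Real.exp (llr g f y))) = g := by
  conv_rhs => rw [← Measure.withDensity_rnDeriv_eq g f hgf]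
  refine withDensity_congr_ae ?_
  filter_upwards [exp_llr_of_ac' g f hfg, Measure.rnDeriv_lt_top g f] with y h1 h2
  rw [h1, ENNReal.ofReal_toReal h2.ne]

theorem withDensity_exp_neg_llr (hgf : g ≪ f) (hfg : f ≪ g) :
    g.withDensity (fun y => ENNReal.ofReal (Real.exp (-llr g f y))) = f := by
  conv_rhs => rw [← Measure.withDensity_rnDeriv_eq f g hfg]
  refine withDensity_congr_ae ?_
  filter_upwards [exp_neg_llr hgf, Measure.rnDeriv_lt_top f g] with y h1 h2
  rw [h1, ENNReal.ofReal_toReal h2.ne]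

end Density

/-! ### Laws of the observations -/

section Laws

variable {M : ℕ} {Y : Type*} [MeasurableSpace Y] (f g : Measure Y) [IsProbabilityMeasure f]
  [IsProbabilityMeasure g]

instance isProbabilityMeasure_ite (p : Prop) [Decidable p] :
    IsProbabilityMeasure (if p then g else f) := by
  split_ifs <;> infer_instance

instance isProbabilityMeasure_hypLaw (D : Finset (Fin M)) :
    IsProbabilityMeasure (hypLaw f g D) := by
  unfold hypLaw; infer_instance

/-- The number of probes of cell `i` in the first `n` time steps. -/
def Policy.count {M : ℕ} {Y : Type*} (Γ : Policy M Y) (ω : Sample M Y) (n : ℕ) (i : Fin M) : ℕ :=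
  probeCount (Γ.history ω n) i

end Laws

namespace Policy

section Count

variable {M : ℕ} {Y : Type*} (Γ : Policy M Y)

theorem count_succ (ω : Sample M Y) (n : ℕ) (i : Fin M) :
    Γ.count ω (n + 1) i = Γ.count ω n i + if i ∈ Γ.probed ω n then 1 else 0 := by
  unfold count probed action
  rw [history]
  cases h : Γ ω.1 (Γ.history ω n) with
  | probe A =>
    simp only
    rw [probeCount_cons]
    split_ifs <;> rfl
  | declare D => simp

theorem count_le (ω : Sample M Y) (n : ℕ) (i : Fin M) : Γ.count ω n i ≤ n := by
  induction n with
  | zero => simp [count, history, probeCount]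
  | succ n ih => rw [count_succ]; split_ifs <;> omega

/-- The history depends only on the observations which it contains. -/
theorem history_congr {u : unitInterval} {X X' : Fin M × ℕ → Y} {n : ℕ}
    (h : ∀ i, ∀ r < Γ.count (u, X) n i, X (i, r) = X' (i, r)) :
    Γ.history (u, X') n = Γ.history (u, X) n := by
  induction n with
  | zero => rfl
  | succ n ih =>
    have h1 := ih fun i r hr => h i r (hr.trans_le (by rw [count_succ]; omega))
    have h2 : ∀ i ∈ Γ.probed (u, X) n,
        X (i, probeCount (Γ.history (u, X) n) i) = X' (i, probeCount (Γ.history (u, X) n) i) := by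
      intro i hi
      refine h i _ ?_
      rw [count_succ, if_pos hi]
      exact Nat.lt_succ_self _
    unfold probed action at h2
    rw [history, history, h1]
    cases h3 : Γ u (Γ.history (u, X) n) with
    | declare D => simp only
    | probe A =>
      simp only [h3] at h2 ⊢
      congr 1
      funext i
      unfold nextRecord
      split_ifs with hi
      · rw [h2 i hi]
      · rfl

end Count

section Measurability

variable {M : ℕ} {Y : Type*} [MeasurableSpace Y] {Γ : Policy M Y}

theorem measurableSet_mem_probed
    (hΓ : ∀ (n : ℕ) (a : Action M), MeasurableSet {ω : Sample M Y | Γ.action ω n = a})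
    (n : ℕ) (i : Fin M) : MeasurableSet {ω | i ∈ Γ.probed ω n} := by
  have : {ω : Sample M Y | i ∈ Γ.probed ω n} =
      ⋃ A : {A : Finset (Fin M) // i ∈ A}, {ω | Γ.action ω n = Action.probe A} := by
    ext ω
    simp only [Set.mem_ofPred_eq, Set.mem_iUnion, probed]
    constructor
    · intro h
      cases h1 : Γ.action ω n with
      | probe A => rw [h1] at h; exact ⟨⟨A, h⟩, rfl⟩
      | declare D => rw [h1] at h; simp at h
    · rintro ⟨⟨A, hA⟩, h⟩
      rw [h]; exact hA
  rw [this]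
  exact MeasurableSet.iUnion fun A => hΓ n _

theorem measurable_count
    (hΓ : ∀ (n : ℕ) (a : Action M), MeasurableSet {ω : Sample M Y | Γ.action ω n = a})
    (n : ℕ) (i : Fin M) : Measurable fun ω => Γ.count ω n i := by
  induction n with
  | zero => simp [count, history, probeCount]
  | succ n ih =>
    simp only [count_succ]
    exact ih.add (Measurable.ite (measurableSet_mem_probed hΓ n i) measurable_const
      measurable_const)

theorem measurable_walk (f g : Measure Y) (i : Fin M) (k : ℕ) :
    Measurable fun X : Fin M × ℕ → Y => walk f g X i k := by
  unfold walk
  refine Finset.measurable_sum _ fun r _ => ?_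
  exact (measurable_llr g f).comp (measurable_pi_apply _)

theorem measurable_walk_count (f g : Measure Y)
    (hΓ : ∀ (n : ℕ) (a : Action M), MeasurableSet {ω : Sample M Y | Γ.action ω n = a})
    (n : ℕ) (i : Fin M) : Measurable fun ω : Sample M Y => walk f g ω.2 i (Γ.count ω n i) := by
  have h1 : Measurable fun z : (Fin M × ℕ → Y) × ℕ => walk f g z.1 i z.2 :=
    measurable_from_prod_countable_left fun k => measurable_walk f g i k
  exact h1.comp (measurable_snd.prodMk (measurable_count hΓ n i))

end Measurability

/-! ### Change of measure and Wald's identity -/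

section Change

variable {M : ℕ} {Y : Type*} [MeasurableSpace Y] (f g : Measure Y) [IsProbabilityMeasure f]
  [IsProbabilityMeasure g] {Γ : Policy M Y}

/-- The exponent of the likelihood ratio of the hypotheses `D'` and `D` in cell `i`. -/
def swapSign (D D' : Finset (Fin M)) (i : Fin M) : ℝ :=
  (if i ∈ D' then 1 else 0) - if i ∈ D then 1 else 0

theorem withDensity_swapSign (hgf : g ≪ f) (hfg : f ≪ g) (D D' : Finset (Fin M)) (i : Fin M) :
    (if i ∈ D' then g else f) = (if i ∈ D then g else f).withDensity
      fun y => ENNReal.ofReal (Real.exp (swapSign D D' i * llr g f y)) := by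
  unfold swapSign
  by_cases h1 : i ∈ D <;> by_cases h2 : i ∈ D' <;> simp only [h1, h2, if_true, if_false]
  · simp
  · simpa using (withDensity_exp_neg_llr f g hgf hfg).symm
  · simpa using (withDensity_exp_llr f g hgf hfg).symm
  · simp

/-- Split according to the vector `κ` of probe counts. For a fixed seed, the event that the counts
are `κ`, and the history on it, are determined by the finitely many observations (i, r) with `r < κ
i`. So the change of measure in finitely many coordinates applies, and its density is the
exponential of the stopped walks. The seed has the same law under both hypotheses. -/
theorem lintegral_hypLaw_change (hgf : g ≪ f) (hfg : f ≪ g)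
    (hΓ : ∀ (n : ℕ) (a : Action M), MeasurableSet {ω : Sample M Y | Γ.action ω n = a}) (n : ℕ)
    {F : Sample M Y → ℝ≥0∞} (hF : Measurable F)
    (hdep : ∀ u X X', Γ.history (u, X) n = Γ.history (u, X') n → F (u, X) = F (u, X'))
    (D D' : Finset (Fin M)) :
    ∫⁻ ω, F ω ∂(hypLaw f g D') = ∫⁻ ω, F ω * ENNReal.ofReal (Real.exp
      (∑ i, swapSign D D' i * walk f g ω.2 i (Γ.count ω n i))) ∂(hypLaw f g D) := by
  classical
  have hcount : Measurable fun ω : Sample M Y => (fun i => Γ.count ω n i : Fin M → ℕ) :=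
    measurable_pi_lambda _ fun i => measurable_count hΓ n i
  have hset : ∀ κ : Fin M → ℕ, MeasurableSet {ω : Sample M Y | (fun i => Γ.count ω n i) = κ} :=
    fun κ => hcount (measurableSet_singleton κ)
  have hFw : Measurable fun ω : Sample M Y => F ω * ENNReal.ofReal (Real.exp
      (∑ i, swapSign D D' i * walk f g ω.2 i (Γ.count ω n i))) := by
    refine hF.mul (ENNReal.measurable_ofReal.comp (Real.measurable_exp.comp ?_))
    exact Finset.measurable_sum _ fun i _ => (measurable_walk_count f g hΓ n i).const_mul _
  have hdecomp : ∀ (G : Sample M Y → ℝ≥0∞) (ω : Sample M Y), G ω =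
      ∑' κ : Fin M → ℕ, {ω : Sample M Y | (fun i => Γ.count ω n i) = κ}.indicator G ω := by
    intro G ω
    rw [tsum_eq_single (fun i => Γ.count ω n i)]
    · rw [Set.indicator_of_mem]; rfl
    · intro κ hκ
      rw [Set.indicator_of_notMem]
      exact fun h => hκ h.symm
  rw [lintegral_congr (hdecomp F), lintegral_congr (hdecomp fun ω => F ω * _),
    lintegral_tsum fun κ => (hF.indicator (hset κ)).aemeasurable,
    lintegral_tsum fun κ => (hFw.indicator (hset κ)).aemeasurable]
  refine tsum_congr fun κ => ?_
  unfold hypLaw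
  rw [lintegral_prod _ (hF.indicator (hset κ)).aemeasurable,
    lintegral_prod _ (hFw.indicator (hset κ)).aemeasurable]
  refine lintegral_congr fun u => ?_
  set S : Finset (Fin M × ℕ) := (Finset.univ ×ˢ Finset.range (∑ i, κ i)).filter
    fun p => p.2 < κ p.1 with hS
  have hmemS : ∀ p : Fin M × ℕ, p ∈ S ↔ p.1 ∈ Finset.univ ∧ p.2 ∈ Finset.range (κ p.1) := by
    intro p
    simp only [hS, Finset.mem_filter, Finset.mem_product, Finset.mem_univ, Finset.mem_range,
      true_and, and_iff_right_iff_imp]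
    exact fun h => h.trans_le (Finset.single_le_sum (f := κ) (fun _ _ => Nat.zero_le _)
      (Finset.mem_univ p.1))
  have hhist : ∀ X X' : Fin M × ℕ → Y, (∀ p ∈ S, X p = X' p) →
      (fun i => Γ.count (u, X) n i) = κ → Γ.history (u, X') n = Γ.history (u, X) n := by
    intro X X' hXX h1
    refine Γ.history_congr fun i r hr => hXX _ ((hmemS _).2 ⟨Finset.mem_univ _, ?_⟩)
    rw [Finset.mem_range, ← h1]; exact hr
  have hG : DependsOn (fun X => {ω : Sample M Y | (fun i => Γ.count ω n i) = κ}.indicator F (u, X))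
      (S : Set (Fin M × ℕ)) := by
    have key : ∀ X X' : Fin M × ℕ → Y, (∀ p ∈ S, X p = X' p) →
        (fun i => Γ.count (u, X) n i) = κ →
        {ω : Sample M Y | (fun i => Γ.count ω n i) = κ}.indicator F (u, X) =
        {ω : Sample M Y | (fun i => Γ.count ω n i) = κ}.indicator F (u, X') := by
      intro X X' hXX h1
      have h2 := hhist X X' hXX h1
      have h3 : (fun i => Γ.count (u, X') n i) = κ := by
        rw [← h1]; unfold count; rw [h2]
      rw [Set.indicator_of_mem (by exact h1), Set.indicator_of_mem (by exact h3)]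
      exact hdep u X X' h2.symm
    intro X X' hXX
    by_cases h1 : (fun i => Γ.count (u, X) n i) = κ
    · exact key X X' hXX h1
    by_cases h2 : (fun i => Γ.count (u, X') n i) = κ
    · exact (key X' X (fun p hp => (hXX p hp).symm) h2).symm
    · simp only
      rw [Set.indicator_of_notMem (by exact h1), Set.indicator_of_notMem (by exact h2)]
  refine (lintegral_infinitePi_change (fun p : Fin M × ℕ => if p.1 ∈ D then g else f)
    (fun p : Fin M × ℕ => if p.1 ∈ D' then g else f) S
    (fun p y => ENNReal.ofReal (Real.exp (swapSign D D' p.1 * llr g f y)))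
    (fun p => by fun_prop) (fun p _ => withDensity_swapSign f g hgf hfg D D' p.1)
    ((hF.indicator (hset κ)).comp measurable_prodMk_left) hG).trans ?_
  refine lintegral_congr fun X => ?_
  simp only [Function.comp_apply]
  by_cases h1 : (fun i => Γ.count (u, X) n i) = κ
  · rw [Set.indicator_of_mem (by exact h1), Set.indicator_of_mem (by exact h1)]
    congr 1
    rw [← ENNReal.ofReal_prod_of_nonneg fun p _ => (Real.exp_pos _).le, ← Real.exp_sum,
      Finset.sum_finset_product S Finset.univ (fun i => Finset.range (κ i)) hmemS]
    simp only [walk, Finset.mul_sum]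
    rw [← h1]
  · rw [Set.indicator_of_notMem (by exact h1), Set.indicator_of_notMem (by exact h1), zero_mul]

/-- Wald's identity with the horizon cut off at `n`: the stopped walk is the sum over `r < n` of the
LLR of observation (i, r) times the indicator of `r < count`, and this indicator is independent of
that observation. -/
theorem integral_walk_count (D : Finset (Fin M)) (i : Fin M) {d : ℝ}
    (hint : Integrable (llr g f) (if i ∈ D then g else f))
    (hd : ∫ y, llr g f y ∂(if i ∈ D then g else f) = d)
    (hΓ : ∀ (n : ℕ) (a : Action M), MeasurableSet {ω : Sample M Y | Γ.action ω n = a}) (n : ℕ) :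
    Integrable (fun ω => walk f g ω.2 i (Γ.count ω n i)) (hypLaw f g D) ∧
    ∫ ω, walk f g ω.2 i (Γ.count ω n i) ∂(hypLaw f g D) =
      d * ∫ ω, (Γ.count ω n i : ℝ) ∂(hypLaw f g D) := by
  classical
  set μ : Fin M × ℕ → Measure Y := fun p => if p.1 ∈ D then g else f with hμ
  set B : ℕ → Sample M Y → ℝ := fun r ω => if r < Γ.count ω n i then 1 else 0 with hB
  have hBm : ∀ r, Measurable (B r) := fun r =>
    Measurable.ite (measurableSet_lt measurable_const (measurable_count hΓ n i)) measurable_const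
      measurable_const
  have hBle : ∀ r ω, ‖B r ω‖ ≤ 1 := by
    intro r ω; simp only [hB]; split_ifs <;> simp
  have hBint : ∀ r, Integrable (B r) (hypLaw f g D) := fun r =>
    Integrable.of_bound (hBm r).aestronglyMeasurable 1 (ae_of_all _ (hBle r))
  have hlint : ∀ r, Integrable (fun ω : Sample M Y => llr g f (ω.2 (i, r))) (hypLaw f g D) := by
    intro r
    have h1 : Integrable (fun X : Fin M × ℕ → Y => llr g f (X (i, r))) (Measure.infinitePi μ) :=
      (measurePreserving_eval_infinitePi μ (i, r)).integrable_comp_of_integrable hint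
    exact h1.comp_snd _
  have hprod : ∀ r, Integrable (fun ω : Sample M Y => llr g f (ω.2 (i, r)) * B r ω)
      (hypLaw f g D) := fun r =>
    (hlint r).mul_bdd (c := 1) (hBm r).aestronglyMeasurable (ae_of_all _ (hBle r))
  have hwalk : ∀ ω : Sample M Y, walk f g ω.2 i (Γ.count ω n i) =
      ∑ r ∈ Finset.range n, llr g f (ω.2 (i, r)) * B r ω := by
    intro ω
    unfold walk
    have h1 := Γ.count_le ω n i
    rw [← Finset.sum_subset (Finset.range_subset_range.2 h1)]
    · refine Finset.sum_congr rfl fun r hr => ?_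
      simp [hB, Finset.mem_range.1 hr]
    · intro r _ hr
      have : ¬ r < Γ.count ω n i := by simpa using hr
      simp [hB, this]
  have hcnt : ∀ ω : Sample M Y, (Γ.count ω n i : ℝ) = ∑ r ∈ Finset.range n, B r ω := by
    intro ω
    have h1 := Γ.count_le ω n i
    simp only [hB, Finset.sum_boole]
    congr 1
    rw [show (Finset.range n).filter (fun r => r < Γ.count ω n i) =
      Finset.range (Γ.count ω n i) by ext r; simp; omega]
    simp
  have hterm : ∀ r ∈ Finset.range n, ∫ ω, llr g f (ω.2 (i, r)) * B r ω ∂(hypLaw f g D) =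
      d * ∫ ω, B r ω ∂(hypLaw f g D) := by
    intro r hr
    have e1 : ∫ ω, llr g f (ω.2 (i, r)) * B r ω ∂(hypLaw f g D) =
        ∫ u, ∫ X, llr g f (X (i, r)) * B r (u, X) ∂(Measure.infinitePi μ) := by
      have := hprod r
      unfold hypLaw at this ⊢
      exact integral_prod _ this
    have e2 : ∫ ω, B r ω ∂(hypLaw f g D) = ∫ u, ∫ X, B r (u, X) ∂(Measure.infinitePi μ) := by
      have := hBint r
      unfold hypLaw at this ⊢
      exact integral_prod _ this
    rw [e1, e2, ← integral_const_mul]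
    refine integral_congr_ae (ae_of_all _ fun u => ?_)
    simp only
    set S : Finset (Fin M × ℕ) := (Finset.univ ×ˢ Finset.range n).erase (i, r) with hS
    -- Whether probe `r` of cell `i` takes place is decided without its outcome: along a path
    -- without this probe, observation (i, r) is not used, so altering it does not alter the
    -- history.
    have hdep : DependsOn (fun X => B r (u, X)) (S : Set (Fin M × ℕ)) := by
      have key : ∀ X X' : Fin M × ℕ → Y, (∀ p ∈ S, X p = X' p) → ¬ r < Γ.count (u, X) n i →
          Γ.count (u, X') n i = Γ.count (u, X) n i := by
        intro X X' hXX h1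
        unfold count
        rw [Γ.history_congr (X := X) (X' := X')]
        intro j r' hr'
        refine hXX _ (Finset.mem_erase.2 ⟨?_, ?_⟩)
        · intro e
          obtain ⟨rfl, rfl⟩ := Prod.mk.inj e
          exact h1 hr'
        · have := Γ.count_le (u, X) n j
          simp; omega
      intro X X' hXX
      simp only [hB]
      by_cases h1 : r < Γ.count (u, X) n i
      · by_cases h2 : r < Γ.count (u, X') n i
        · simp [h1, h2]
        · rw [key X' X (fun p hp => (hXX p hp).symm) h2] at h1
          exact absurd h1 h2
      · rw [key X X' hXX h1]
    refine (integral_mul_infinitePi μ (S := S) (p := (i, r)) (by simp [hS]) (measurable_llr g f)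
      ((hBm r).comp measurable_prodMk_left) hdep).trans ?_
    rw [← hd]
    rfl
  refine ⟨?_, ?_⟩
  · simp only [hwalk]
    exact integrable_finsetSum _ fun r _ => hprod r
  · simp only [hwalk, hcnt]
    rw [integral_finsetSum _ fun r _ => hprod r, integral_finsetSum _ fun r _ => hBint r,
      Finset.sum_congr rfl hterm, Finset.mul_sum]

end Change

end Policy

namespace Policy

/-! ### Declarations -/

section Declare

variable {M : ℕ} {Y : Type*} {Γ : Policy M Y}

theorem declares_eq_iUnion (D : Finset (Fin M)) :
    {ω | Γ.Declares ω D} = ⋃ n, {ω | Γ.action ω n = Action.declare D} := by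
  ext ω; simp [Declares]

theorem monotone_declare (D : Finset (Fin M)) :
    Monotone fun n => {ω | Γ.action ω n = Action.declare D} :=
  fun _ _ hmn _ h => (action_of_declare h hmn).2

theorem eq_of_declares {ω : Sample M Y} {D D' : Finset (Fin M)} (h : Γ.Declares ω D)
    (h' : Γ.Declares ω D') : D = D' := by
  obtain ⟨n, hn⟩ := h
  obtain ⟨m, hm⟩ := h'
  rcases le_total n m with hle | hle
  · have := (action_of_declare hn hle).2
    rw [hm] at this
    exact (Action.declare.inj this).symm
  · have := (action_of_declare hm hle).2
    rw [hn] at this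
    exact Action.declare.inj this

open scoped Classical in
variable (Γ) in
/-- The number of time steps, among the first `n`, in which the policy probes. -/
def steps (ω : Sample M Y) (n : ℕ) : ℕ :=
  ((Finset.range n).filter fun m => ∀ D, Γ.action ω m ≠ Action.declare D).card

open scoped Classical in
theorem steps_succ (ω : Sample M Y) (n : ℕ) : Γ.steps ω (n + 1) =
    Γ.steps ω n + if ∀ D, Γ.action ω n ≠ Action.declare D then 1 else 0 := by
  unfold steps
  rw [Finset.range_add_one, Finset.filter_insert]
  split_ifs
  · rw [Finset.card_insert_of_notMem (by simp)]
  · rfl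

theorem steps_le (ω : Sample M Y) (n : ℕ) : Γ.steps ω n ≤ n := by
  classical
  unfold steps
  exact (Finset.card_filter_le _ _).trans (by simp)

theorem steps_le_stopTime (ω : Sample M Y) (n : ℕ) : (Γ.steps ω n : ℕ∞) ≤ Γ.stopTime ω := by
  rw [natCast_le_stopTime]
  intro m hm D h
  classical
  have : (Finset.range n).filter (fun m => ∀ D, Γ.action ω m ≠ Action.declare D) ⊆
      Finset.range m := by
    intro k hk
    rw [Finset.mem_filter] at hk
    rw [Finset.mem_range]
    by_contra hle
    exact hk.2 D (action_of_declare h (not_lt.1 hle)).2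
  have := Finset.card_le_card this
  rw [Finset.card_range] at this
  unfold steps at hm
  omega

theorem probed_of_declare {ω : Sample M Y} {n : ℕ} {D : Finset (Fin M)}
    (h : Γ.action ω n = Action.declare D) : Γ.probed ω n = ∅ := by
  unfold probed; rw [h]

theorem count_le_steps (ω : Sample M Y) (n : ℕ) (i : Fin M) : Γ.count ω n i ≤ Γ.steps ω n := by
  induction n with
  | zero => simp [count, history, probeCount]
  | succ n ih =>
    rw [count_succ, steps_succ]
    by_cases h : ∀ D, Γ.action ω n ≠ Action.declare D
    · rw [if_pos h]; split_ifs <;> omega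
    · rw [if_neg h]
      push Not at h
      obtain ⟨D, hD⟩ := h
      rw [probed_of_declare hD]
      simpa using ih

theorem sum_count_le {K : ℕ} (hK : ∀ u h A, Γ u h = Action.probe A → A.card ≤ K)
    (ω : Sample M Y) (n : ℕ) : ∑ i, Γ.count ω n i ≤ K * Γ.steps ω n := by
  induction n with
  | zero => simp [count, history, probeCount]
  | succ n ih =>
    simp only [count_succ, Finset.sum_add_distrib]
    rw [steps_succ, mul_add]
    refine add_le_add ih ?_
    rw [Finset.sum_boole, Finset.filter_univ_mem]
    cases h : Γ.action ω n with
    | declare D => simp [probed_of_declare h]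
    | probe A =>
      rw [if_pos (by simp), mul_one]
      have : Γ.probed ω n = A := by unfold probed; rw [h]
      rw [this]
      exact_mod_cast hK _ _ A h

end Declare

/-! ### Lower bound for the detection delay -/

section Swap

variable {M : ℕ}

theorem sum_swapSign_mul {D : Finset (Fin M)} {i j : Fin M} (hi : i ∈ D) (hj : j ∉ D)
    (w : Fin M → ℝ) : ∑ x, swapSign D (insert j (D.erase i)) x * w x = w j - w i := by
  have h1 : ∀ E : Finset (Fin M), ∑ x, (if x ∈ E then (1 : ℝ) else 0) * w x = ∑ x ∈ E, w x := by
    intro E; simp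
  simp only [swapSign, sub_mul, Finset.sum_sub_distrib, h1]
  rw [Finset.sum_insert (fun h => hj (Finset.mem_of_mem_erase h)), Finset.sum_erase_eq_sub hi]
  ring

end Swap

section LowerBound

variable {M : ℕ} {Y : Type*} [MeasurableSpace Y] {f g : Measure Y} [IsProbabilityMeasure f]
  [IsProbabilityMeasure g] {Γ : Policy M Y}

theorem integral_llr_eq (hgf : klDiv g f ≠ ⊤) : ∫ y, llr g f y ∂g = klReal g f := by
  rw [klReal, toReal_klDiv_of_measure_eq (klDiv_ne_top_iff.1 hgf).1 (by simp)]

theorem integrable_llr_swap (hfg : klDiv f g ≠ ⊤) :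
    Integrable (llr g f) f := by
  have h1 := (klDiv_ne_top_iff.1 hfg)
  refine h1.2.neg.congr ?_
  filter_upwards [neg_llr h1.1] with y hy
  exact hy

theorem integral_llr_swap (hfg : klDiv f g ≠ ⊤) : ∫ y, llr g f y ∂f = -klReal f g := by
  have h1 := (klDiv_ne_top_iff.1 hfg)
  rw [klReal, toReal_klDiv_of_measure_eq h1.1 (by simp), ← integral_neg]
  refine integral_congr_ae ?_
  filter_upwards [neg_llr h1.1] with y hy
  exact hy.symm

/-- A set which is likely under `D` and unlikely under `D'` forces the expected log-likelihood
ratio to be large. -/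
theorem le_integral_llr (hgf : klDiv g f ≠ ⊤) (hfg : klDiv f g ≠ ⊤)
    (hΓ : ∀ (n : ℕ) (a : Action M), MeasurableSet {ω : Sample M Y | Γ.action ω n = a}) (n : ℕ)
    (D D' E : Finset (Fin M)) {lam : ℝ}
    (hsmall : hypLaw f g D' {ω | Γ.action ω n = Action.declare E} ≤
      ENNReal.ofReal (Real.exp (-lam)))
    (hint : ∀ i, Integrable (fun ω => walk f g ω.2 i (Γ.count ω n i)) (hypLaw f g D)) :
    lam * (hypLaw f g D).real {ω | Γ.action ω n = Action.declare E} - 1 ≤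
      -∫ ω, ∑ i, swapSign D D' i * walk f g ω.2 i (Γ.count ω n i) ∂(hypLaw f g D) := by
  classical
  set A : Set (Sample M Y) := {ω | Γ.action ω n = Action.declare E} with hA
  have hAm : MeasurableSet A := hΓ n _
  set Z : Sample M Y → ℝ := fun ω => ∑ i, swapSign D D' i * walk f g ω.2 i (Γ.count ω n i) with hZ
  set φ : Sample M Y → ℝ := A.indicator fun _ => lam with hφ
  have hφm : Measurable φ := measurable_const.indicator hAm
  have hZm : Measurable Z :=
    Finset.measurable_sum _ fun i _ => (measurable_walk_count f g hΓ n i).const_mul _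
  have hZint : Integrable Z (hypLaw f g D) :=
    integrable_finsetSum _ fun i _ => (hint i).const_mul _
  have hφint : Integrable φ (hypLaw f g D) := (integrable_const lam).indicator hAm
  have hac := (klDiv_ne_top_iff.1 hgf).1
  have hac' := (klDiv_ne_top_iff.1 hfg).1
  have hchange := lintegral_hypLaw_change f g hac hac' hΓ n
    (F := fun ω => ENNReal.ofReal (Real.exp (φ ω))) (by fun_prop) (fun u X X' h => by
      have : (u, X) ∈ A ↔ (u, X') ∈ A := by
        simp only [hA, Set.mem_ofPred_eq, action, h]
      by_cases h1 : (u, X) ∈ A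
      · simp only [hφ, Set.indicator_of_mem h1, Set.indicator_of_mem (this.1 h1)]
      · simp only [hφ, Set.indicator_of_notMem h1, Set.indicator_of_notMem (mt this.2 h1)]) D D'
  -- The event carries the weight exp `lam`, the reciprocal of the bound for its probability under
  -- `D'`, so the expectation is at most 1 + 1.
  have hbound : ∫⁻ ω, ENNReal.ofReal (Real.exp (φ ω)) ∂(hypLaw f g D') ≤ 2 := by
    calc ∫⁻ ω, ENNReal.ofReal (Real.exp (φ ω)) ∂(hypLaw f g D')
        ≤ ∫⁻ ω, (1 + A.indicator (fun _ => ENNReal.ofReal (Real.exp lam)) ω)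
            ∂(hypLaw f g D') := by
          refine lintegral_mono fun ω => ?_
          by_cases h1 : ω ∈ A
          · simp [hφ, h1]
          · simp [hφ, h1]
      _ = 1 + ENNReal.ofReal (Real.exp lam) * hypLaw f g D' A := by
          rw [lintegral_add_left measurable_const, lintegral_indicator_const hAm]
          simp
      _ ≤ 1 + ENNReal.ofReal (Real.exp lam) * ENNReal.ofReal (Real.exp (-lam)) := by
          gcongr
      _ = 2 := by
          rw [← ENNReal.ofReal_mul (Real.exp_pos _).le, ← Real.exp_add]
          simp
          norm_num
  have heq : ∀ ω, ENNReal.ofReal (Real.exp (φ ω)) * ENNReal.ofReal (Real.exp (Z ω)) =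
      ENNReal.ofReal (Real.exp (φ ω + Z ω)) := by
    intro ω
    rw [← ENNReal.ofReal_mul (Real.exp_pos _).le, ← Real.exp_add]
  have hfin : ∫⁻ ω, ENNReal.ofReal (Real.exp (φ ω + Z ω)) ∂(hypLaw f g D) ≤ 2 := by
    rw [hchange] at hbound
    exact (lintegral_congr fun ω => (heq ω).symm).trans_le hbound
  have hexpint : Integrable (fun ω => Real.exp (φ ω + Z ω)) (hypLaw f g D) := by
    refine ⟨(by fun_prop : Measurable fun ω => Real.exp (φ ω + Z ω)).aestronglyMeasurable, ?_⟩
    rw [hasFiniteIntegral_iff_ofReal (ae_of_all _ fun ω => (Real.exp_pos _).le)]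
    exact hfin.trans_lt (by simp)
  have hexp : ∫ ω, Real.exp (φ ω + Z ω) ∂(hypLaw f g D) ≤ 2 := by
    rw [integral_eq_lintegral_of_nonneg_ae (ae_of_all _ fun ω => (Real.exp_pos _).le)
      hexpint.aestronglyMeasurable]
    exact ENNReal.toReal_le_of_le_ofReal (by norm_num) (by simpa using hfin)
  -- The inequality x + 1 ≤ exp x stands in for Jensen's inequality and costs only the additive
  -- constant 1.
  have hmain : ∫ ω, (φ ω + Z ω) ∂(hypLaw f g D) ≤
      ∫ ω, (Real.exp (φ ω + Z ω) - 1) ∂(hypLaw f g D) :=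
    integral_mono (hφint.add hZint) (hexpint.sub (integrable_const 1)) fun ω => by
      have := Real.add_one_le_exp (φ ω + Z ω)
      simp only
      linarith
  rw [integral_add hφint hZint, integral_sub hexpint (integrable_const 1), hφ,
    integral_indicator_const _ hAm, smul_eq_mul, integral_const, smul_eq_mul] at hmain
  simp only [probReal_univ, mul_one] at hmain
  linarith

theorem integrable_natCast_of_le {ν : Measure (Sample M Y)} [IsFiniteMeasure ν]
    {N : Sample M Y → ℕ} (hN : Measurable N) {n : ℕ} (h : ∀ ω, N ω ≤ n) :
    Integrable (fun ω => (N ω : ℝ)) ν :=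
  Integrable.of_bound (measurable_from_top.comp hN).aestronglyMeasurable (n : ℝ)
    (ae_of_all _ fun ω => by
      simpa using h ω)

theorem measurable_steps
    (hΓ : ∀ (n : ℕ) (a : Action M), MeasurableSet {ω : Sample M Y | Γ.action ω n = a}) (n : ℕ) :
    Measurable fun ω => Γ.steps ω n := by
  induction n with
  | zero => simp [steps]
  | succ n ih =>
    simp only [steps_succ]
    refine ih.add (Measurable.ite ?_ measurable_const measurable_const)
    have : {ω : Sample M Y | ∀ D, Γ.action ω n ≠ Action.declare D} =
        ⋂ D, {ω | Γ.action ω n = Action.declare D}ᶜ := by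
      ext ω; simp
    rw [this]
    exact MeasurableSet.iInter fun D => (hΓ n _).compl

omit [IsProbabilityMeasure f] [IsProbabilityMeasure g] in
/-- Optimality of the rate function, for the expected numbers of probes. -/
theorem rate_bound {K L : ℕ} (hL : 1 ≤ L) (hLM : L < M) {D : Finset (Fin M)} (hD : D.card = L)
    (hgpos : 0 < klReal g f) (x : Fin M → ℝ) (hx : ∀ i, 0 ≤ x i) {t a : ℝ} (hxt : ∀ i, x i ≤ t)
    (hsum : ∑ i, x i ≤ K * t)
    (h : ∀ i ∈ D, ∀ j ∉ D, a ≤ klReal g f * x i + klReal f g * x j) :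
    a ≤ rate f g M K L * t := by
  set dg := klReal g f with hdg
  set df := klReal f g with hdf
  have hdf0 : 0 ≤ df := ENNReal.toReal_nonneg
  have hML : (0 : ℝ) < (M : ℝ) - L := by
    have : (L : ℝ) < M := by exact_mod_cast hLM
    linarith
  have hL' : (0 : ℝ) < L := by exact_mod_cast hL
  set p := ∑ i ∈ D, x i with hp
  set r := ∑ j ∈ Dᶜ, x j with hr
  have hpr : p + r ≤ K * t := by rw [hp, hr, Finset.sum_add_sum_compl]; exact hsum
  have hp0 : 0 ≤ p := Finset.sum_nonneg fun i _ => hx i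
  have hpt : p ≤ L * t := by
    calc p ≤ ∑ _i ∈ D, t := Finset.sum_le_sum fun i _ => hxt i
      _ = L * t := by simp [hD]
  have hDc : ((Dᶜ).card : ℝ) = (M : ℝ) - L := by
    rw [Finset.card_compl, hD, Fintype.card_fin, Nat.cast_sub hLM.le]
  -- Sum of the constraints `h` over all pairs of an anomalous and a normal cell.
  have h1 : L * (((M : ℝ) - L) * a) ≤ ((M : ℝ) - L) * dg * p + L * df * r := by
    have h2 : ∑ i ∈ D, ∑ j ∈ Dᶜ, a ≤ ∑ i ∈ D, ∑ j ∈ Dᶜ, (dg * x i + df * x j) :=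
      Finset.sum_le_sum fun i hi => Finset.sum_le_sum fun j hj =>
        h i hi j (Finset.mem_compl.1 hj)
    simp only [Finset.sum_add_distrib, Finset.sum_const, nsmul_eq_mul, hDc, hD,
      ← Finset.mul_sum] at h2
    rw [← hp, ← hr] at h2
    linarith
  have h2 : L * df * r ≤ L * df * (K * t - p) := by gcongr; linarith
  have h3 : 0 < L * ((M : ℝ) - L) := by positivity
  unfold rate
  -- After elimination of `r` the bound is linear in `p` with coefficient `(M - L) * dg - L * df`,
  -- whose sign is what distinguishes the cases. The extreme value is at `p = L * t` in Case 1 and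
  -- at `p = 0` in Case 2.
  by_cases hc : CaseOne f g M L
  · rw [if_pos hc]
    have h4 : L * df ≤ ((M : ℝ) - L) * dg := by
      have : (L : ℝ) * (df / dg + 1) ≤ M := hc
      have h5 : (L : ℝ) * df / dg ≤ (M : ℝ) - L := by
        have : (L : ℝ) * (df / dg + 1) = L * df / dg + L := by ring
        linarith
      exact (div_le_iff₀ hgpos).1 h5
    have h6 : (((M : ℝ) - L) * dg - L * df) * p ≤ (((M : ℝ) - L) * dg - L * df) * (L * t) := by
      gcongr
    have h7 : L * ((M : ℝ) - L) * a ≤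
        L * ((M : ℝ) - L) * ((dg + ((K : ℝ) - L) * df / ((M : ℝ) - L)) * t) := by
      have : L * ((M : ℝ) - L) * ((dg + ((K : ℝ) - L) * df / ((M : ℝ) - L)) * t) =
          L * (((M : ℝ) - L) * dg + ((K : ℝ) - L) * df) * t := by
        field_simp
      rw [this]
      linarith
    exact le_of_mul_le_mul_left h7 h3
  · rw [if_neg hc]
    have h4 : ((M : ℝ) - L) * dg ≤ L * df := by
      have : (M : ℝ) < L * (df / dg + 1) := not_le.1 hc
      have h5 : (M : ℝ) - L ≤ L * df / dg := by
        have : (L : ℝ) * (df / dg + 1) = L * df / dg + L := by ring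
        linarith
      exact (le_div_iff₀ hgpos).1 h5
    have h6 : (((M : ℝ) - L) * dg - L * df) * p ≤ 0 :=
      mul_nonpos_of_nonpos_of_nonneg (by linarith) hp0
    have h7 : L * ((M : ℝ) - L) * a ≤ L * ((M : ℝ) - L) * (K * df / ((M : ℝ) - L) * t) := by
      have : L * ((M : ℝ) - L) * (K * df / ((M : ℝ) - L) * t) = L * K * df * t := by
        field_simp
      rw [this]
      linarith
    exact le_of_mul_le_mul_left h7 h3

/-- The linear program `rate_bound` is applied to the expected numbers of probes up to time `n`. The
truncation makes everything integrable, and `steps` instead of `n` keeps the bound useful as `n`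
grows. -/
theorem rate_mul_steps_ge {K L : ℕ} (hgf : klDiv g f ≠ ⊤) (hfg : klDiv f g ≠ ⊤)
    (hgpos : 0 < klReal g f) (hL : 1 ≤ L) (hLM : L < M) (hΓ : Γ.IsAdmissible K)
    {D : Finset (Fin M)} (hD : D.card = L) {lam : ℝ} (n : ℕ)
    (hsmall : ∀ i ∈ D, ∀ j ∉ D, hypLaw f g (insert j (D.erase i))
      {ω | Γ.action ω n = Action.declare D} ≤ ENNReal.ofReal (Real.exp (-lam))) :
    lam * (hypLaw f g D).real {ω | Γ.action ω n = Action.declare D} - 1 ≤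
      rate f g M K L * ∫ ω, (Γ.steps ω n : ℝ) ∂(hypLaw f g D) := by
  have hm := hΓ.measurable
  have hcint : ∀ i, Integrable (fun ω => (Γ.count ω n i : ℝ)) (hypLaw f g D) := fun i =>
    integrable_natCast_of_le (measurable_count hm n i) fun ω => Γ.count_le ω n i
  have hsint : Integrable (fun ω => (Γ.steps ω n : ℝ)) (hypLaw f g D) :=
    integrable_natCast_of_le (measurable_steps hm n) (n := n) fun ω => steps_le ω n
  have hin : ∀ i ∈ D, Integrable (fun ω => walk f g ω.2 i (Γ.count ω n i)) (hypLaw f g D) ∧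
      ∫ ω, walk f g ω.2 i (Γ.count ω n i) ∂(hypLaw f g D) =
        klReal g f * ∫ ω, (Γ.count ω n i : ℝ) ∂(hypLaw f g D) := fun i hi =>
    integral_walk_count f g D i (by rw [if_pos hi]; exact (klDiv_ne_top_iff.1 hgf).2)
      (by rw [if_pos hi]; exact integral_llr_eq hgf) hm n
  have hout : ∀ i ∉ D, Integrable (fun ω => walk f g ω.2 i (Γ.count ω n i)) (hypLaw f g D) ∧
      ∫ ω, walk f g ω.2 i (Γ.count ω n i) ∂(hypLaw f g D) =
        -klReal f g * ∫ ω, (Γ.count ω n i : ℝ) ∂(hypLaw f g D) := fun i hi =>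
    integral_walk_count f g D i (by rw [if_neg hi]; exact integrable_llr_swap hfg)
      (by rw [if_neg hi]; exact integral_llr_swap hfg) hm n
  have hint : ∀ i, Integrable (fun ω => walk f g ω.2 i (Γ.count ω n i)) (hypLaw f g D) := by
    intro i
    by_cases hi : i ∈ D
    · exact (hin i hi).1
    · exact (hout i hi).1
  refine rate_bound hL hLM hD hgpos (fun i => ∫ ω, (Γ.count ω n i : ℝ) ∂(hypLaw f g D))
    (fun i => integral_nonneg fun ω => by positivity)
    (fun i => integral_mono (hcint i) hsint fun ω => by
      simp only
      exact_mod_cast Γ.count_le_steps ω n i) ?_ ?_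
  · rw [← integral_finsetSum _ fun i _ => hcint i, ← integral_const_mul]
    refine integral_mono (integrable_finsetSum _ fun i _ => hcint i) (hsint.const_mul _) fun ω => ?_
    simp only
    exact_mod_cast sum_count_le hΓ.card_le ω n
  · intro i hi j hj
    refine (le_integral_llr hgf hfg hm n D (insert j (D.erase i)) D (hsmall i hi j hj) hint).trans
      (le_of_eq ?_)
    simp only [sum_swapSign_mul hi hj]
    rw [integral_sub (hint j) (hint i), (hin i hi).2, (hout j hj).2]
    ring

/-- Lower bound for the expected detection delay under the hypothesis `D`. -/
theorem rate_mul_delay_ge {K L : ℕ} (hgf : klDiv g f ≠ ⊤) (hfg : klDiv f g ≠ ⊤)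
    (hgpos : 0 < klReal g f) (hrate : 0 ≤ rate f g M K L) (hL : 1 ≤ L) (hLM : L < M)
    (hΓ : Γ.IsAdmissible K) {D : Finset (Fin M)} (hD : D.card = L) {lam ε : ℝ} (hlam : 0 ≤ lam)
    (hlarge : hypLaw f g D {ω | ¬ Γ.Declares ω D} ≤ ENNReal.ofReal ε)
    (hε : 0 ≤ ε)
    (hsmall : ∀ i ∈ D, ∀ j ∉ D, hypLaw f g (insert j (D.erase i)) {ω | Γ.Declares ω D} ≤
      ENNReal.ofReal (Real.exp (-lam))) :
    ENNReal.ofReal (lam * (1 - ε) - 1) ≤ ENNReal.ofReal (rate f g M K L) *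
      ∫⁻ ω, ((Γ.stopTime ω : ℕ∞) : ℝ≥0∞) ∂(hypLaw f g D) := by
  have hm := hΓ.measurable
  have hDm : MeasurableSet {ω | Γ.Declares ω D} := by
    rw [declares_eq_iUnion]
    exact MeasurableSet.iUnion fun n => hm n _
  have hreal : 1 - ε ≤ (hypLaw f g D).real {ω | Γ.Declares ω D} := by
    have h1 : (hypLaw f g D).real {ω | Γ.Declares ω D}ᶜ ≤ ε :=
      ENNReal.toReal_le_of_le_ofReal hε hlarge
    rw [probReal_compl_eq_one_sub hDm] at h1
    linarith
  have hlim : Tendsto (fun n => lam * (hypLaw f g D).real {ω | Γ.action ω n = Action.declare D} - 1)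
      atTop (𝓝 (lam * (hypLaw f g D).real {ω | Γ.Declares ω D} - 1)) := by
    have h1 := tendsto_measure_iUnion_atTop (μ := hypLaw f g D) (monotone_declare (Γ := Γ) D)
    rw [← declares_eq_iUnion] at h1
    have h2 := (ENNReal.tendsto_toReal (measure_ne_top _ _)).comp h1
    exact (h2.const_mul lam).sub_const 1
  have hstep : ∀ n, ENNReal.ofReal (lam * (hypLaw f g D).real
      {ω | Γ.action ω n = Action.declare D} - 1) ≤ ENNReal.ofReal (rate f g M K L) *
      ∫⁻ ω, ((Γ.stopTime ω : ℕ∞) : ℝ≥0∞) ∂(hypLaw f g D) := by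
    intro n
    have h1 := rate_mul_steps_ge hgf hfg hgpos hL hLM hΓ hD (lam := lam) n fun i hi j hj =>
      (measure_mono (fun ω (hω : Γ.action ω n = Action.declare D) =>
        (⟨n, hω⟩ : Γ.Declares ω D))).trans
        (hsmall i hi j hj)
    refine (ENNReal.ofReal_le_ofReal h1).trans ?_
    rw [ENNReal.ofReal_mul hrate]
    gcongr
    rw [ofReal_integral_eq_lintegral_ofReal (integrable_natCast_of_le (measurable_steps hm n)
      (n := n) fun ω => steps_le ω n) (ae_of_all _ fun ω => by positivity)]
    refine lintegral_mono fun ω => ?_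
    rw [ENNReal.ofReal_natCast, ← ENat.toENNReal_coe]
    exact ENat.toENNReal_le.2 (steps_le_stopTime ω n)
  have h3 := le_of_tendsto ((ENNReal.continuous_ofReal.tendsto _).comp hlim)
    (Eventually.of_forall hstep)
  refine (ENNReal.ofReal_le_ofReal ?_).trans h3
  have := mul_le_mul_of_nonneg_left hreal hlam
  linarith

end LowerBound

end Policy

/-! ### Discrete measurable maps -/

section Discrete

variable {α β γ : Type*} [MeasurableSpace α] [MeasurableSpace β]

/-- All preimages under `F` are measurable. -/
def DiscreteMeasurable (F : α → γ) : Prop := ∀ s : Set γ, MeasurableSet (F ⁻¹' s)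

namespace DiscreteMeasurable

theorem of_singleton [Countable γ] {F : α → γ} (h : ∀ e, MeasurableSet {x | F x = e}) :
    DiscreteMeasurable F := by
  intro s
  have : F ⁻¹' s = ⋃ e : s, {x | F x = e} := by ext x; simp
  rw [this]
  exact MeasurableSet.iUnion fun e => h e

theorem const (e : γ) : DiscreteMeasurable fun _ : α => e := fun s => by
  by_cases h : e ∈ s <;> simp [h]

theorem map {δ : Type*} {F : α → γ} (hF : DiscreteMeasurable F) (h : γ → δ) :
    DiscreteMeasurable fun x => h (F x) := fun s => hF (h ⁻¹' s)

theorem comp {F : β → γ} (hF : DiscreteMeasurable F) {φ : α → β} (hφ : Measurable φ) :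
    DiscreteMeasurable fun x => F (φ x) := fun s => hφ (hF s)

/-- A decision that depends on an intermediate result with countably many values is examined
separately on each of these values. This carries measurability through the state machine. -/
theorem bind {δ : Type*} [Countable γ] {F : α → γ} (hF : DiscreteMeasurable F) {G : γ → α → δ}
    (hG : ∀ d, DiscreteMeasurable (G d)) : DiscreteMeasurable fun x => G (F x) x := by
  intro s
  have : (fun x => G (F x) x) ⁻¹' s = ⋃ d, F ⁻¹' {d} ∩ G d ⁻¹' s := by ext x; simp
  rw [this]
  exact MeasurableSet.iUnion fun d => (hF _).inter (hG d s)

theorem pi {ι : Type*} [Finite ι] [Countable γ] {F : ι → α → γ}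
    (hF : ∀ i, DiscreteMeasurable (F i)) : DiscreteMeasurable fun x i => F i x := by
  refine of_singleton fun e => ?_
  have : {x | (fun i => F i x) = e} = ⋂ i, F i ⁻¹' {e i} := by
    ext x; simp [funext_iff]
  rw [this]
  exact MeasurableSet.iInter fun i => hF i _

theorem prop {F : α → Prop} (hF : MeasurableSet {x | F x}) : DiscreteMeasurable F := by
  refine of_singleton fun e => ?_
  by_cases he : e
  · simpa [he] using hF
  · convert hF.compl using 1
    ext x
    simp [he]

theorem measurableSet {F : α → Prop} (hF : DiscreteMeasurable F) : MeasurableSet {x | F x} := by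
  have := hF {True}
  simpa [Set.preimage] using this

end DiscreteMeasurable

variable {M L N : ℕ}

theorem discreteMeasurable_positives :
    DiscreteMeasurable fun S : Fin M → ℝ => positives S := by
  have h : DiscreteMeasurable fun (S : Fin M → ℝ) (i : Fin M) => 0 < S i :=
    .pi fun i => .prop (measurableSet_lt measurable_const (measurable_pi_apply i))
  classical
  intro s
  convert (h.map fun p : Fin M → Prop => ({i | p i} : Finset (Fin M))) s using 2
  funext S
  ext i
  simp [positives]

theorem discreteMeasurable_top :
    DiscreteMeasurable fun S : Fin M → ℝ => top L S := by
  have h : DiscreteMeasurable fun (S : Fin M → ℝ) (i j : Fin M) =>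
      S i < S j ∨ (S i = S j ∧ j < i) :=
    .pi fun i => .pi fun j => .prop
      ((measurableSet_lt (measurable_pi_apply i) (measurable_pi_apply j)).union
        ((measurableSet_eq_fun (measurable_pi_apply i) (measurable_pi_apply j)).inter
          (.const _)))
  classical
  intro s
  convert (h.map fun p : Fin M → Fin M → Prop =>
    ({i | ({j | p i j} : Finset (Fin M)).card < L} : Finset (Fin M))) s using 2
  funext S
  ext i
  simp [top]

theorem discreteMeasurable_gapAtLeast (b : ℝ) :
    DiscreteMeasurable fun S : Fin M → ℝ => GapAtLeast L S b := by
  have h : DiscreteMeasurable fun (S : Fin M → ℝ) (i j : Fin M) => b ≤ S i - S j :=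
    .pi fun i => .pi fun j => .prop (measurableSet_le measurable_const
      ((measurable_pi_apply i).sub (measurable_pi_apply j)))
  exact (discreteMeasurable_top (L := L)).bind
    (G := fun t S => ∀ i ∈ t, ∀ j ∉ t, b ≤ S i - S j)
    fun t => h.map fun p => ∀ i ∈ t, ∀ j ∉ t, p i j

theorem discreteMeasurable_advance (b : ℝ) (q : Fin (M - L) → Fin M) (r p : ℕ) :
    DiscreteMeasurable fun S : Fin M → ℝ => advance (N := N) b S q r p := by
  have h1 : ∀ p, DiscreteMeasurable fun S : Fin M → ℝ => advanceOnce (N := N) b S q r p := by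
    intro p
    unfold advanceOnce
    by_cases h : InMachine M L N r p
    · simp only [h, dif_pos]
      have h2 : DiscreteMeasurable fun S : Fin M → ℝ => S (q ⟨p, h.1⟩) < share M L N r p * b :=
        .prop (measurableSet_lt (measurable_pi_apply _) measurable_const)
      classical
      intro s
      convert (h2.map fun a : Prop => if a then p + 1 else p) s using 2
    · simp only [h, dif_neg, not_false_iff]
      exact .const _
  have h2 : ∀ k, DiscreteMeasurable fun S : Fin M → ℝ => (advanceOnce (N := N) b S q r)^[k] p := by
    intro k
    induction k with
    | zero => exact .const _
    | succ k ih =>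
      simp only [Function.iterate_succ_apply']
      exact ih.bind h1
  exact h2 M

end Discrete

/-! ### The CCS policy is admissible -/

section Admissible

variable {M L N : ℕ} {Y : Type*} [MeasurableSpace Y] {f g : Measure Y}

theorem card_of_ccsUpdate_suspects {b : ℝ} {R : OrderingRule M L} {st : CCSState M L N}
    {row : Record M Y} {H : Finset (Fin M)} (h : (ccsUpdate f g b R st row).suspects = some H) :
    H.card = L := by
  unfold ccsUpdate at h
  simp only at h
  by_cases h1 : (positives fun i => st.llr i + (row i).elim 0 (llr g f)).card = L
  · rw [if_pos h1] at h
    split at h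
    all_goals
      obtain rfl := Option.some.inj h
      exact h1
  · rw [if_neg h1] at h
    cases h

theorem card_of_ccsState_suspects {b : ℝ} {R : OrderingRule M L} {h : List (Record M Y)}
    {H : Finset (Fin M)} (hH : (ccsState N f g b R h).suspects = some H) : H.card = L := by
  cases h with
  | nil => simp [ccsState, ccsInit] at hH
  | cons row h => exact card_of_ccsUpdate_suspects hH

theorem card_machineCells_le (q : Fin (M - L) → Fin M) (pos : Fin N → ℕ) :
    (machineCells q pos).card ≤ N := by
  classical
  have : (machineCells q pos).map Function.Embedding.some ⊆
      (Finset.univ : Finset (Fin N)).image fun r : Fin N =>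
        if h : InMachine M L N r (pos r) then some (q ⟨pos r, h.1⟩) else none := by
    intro x hx
    obtain ⟨i, hi, rfl⟩ := Finset.mem_map.1 hx
    simp only [machineCells, Finset.mem_filter, Finset.mem_univ, true_and] at hi
    obtain ⟨r, h, rfl⟩ := hi
    exact Finset.mem_image.2 ⟨r, Finset.mem_univ _, by simp [h]⟩
  have := (Finset.card_le_card this).trans Finset.card_image_le
  simpa using this

theorem card_ccsProbe_le {K : ℕ} (hL : 1 ≤ L) (hLK : L ≤ K)
    {st : CCSState M L (normalMachines f g M K L)}
    (hst : ∀ H, st.suspects = some H → H.card = L) : (ccsProbe f g st).card ≤ K := by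
  classical
  have hone : ∀ t, ({i | (i : ℕ) = t} : Finset (Fin M)).card ≤ K := fun t =>
    (Finset.card_le_one.2 fun i hi j hj => by
      simp only [Finset.mem_filter, Finset.mem_univ, true_and] at hi hj
      exact Fin.ext (hi.trans hj.symm)).trans (hL.trans hLK)
  unfold ccsProbe
  split
  · rename_i H q hH hq
    refine (Finset.card_union_le _ _).trans ((add_le_add_right (card_machineCells_le q st.pos) _).trans ?_)
    unfold normalMachines
    split_ifs
    · rw [hst H hH]; omega
    · simp
  · exact hone _

/-- All components of a state except the sum LLRs, together with the numbers of probes. -/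
abbrev DiscreteState (M L N : ℕ) :=
  (Fin M → ℕ) × ℕ × Option (Fin (M - L) → Fin M) × Option (Finset (Fin M)) × (Fin N → ℕ)

/-- The state with given sum LLRs and discrete components. -/
def DiscreteState.toState (d : DiscreteState M L N) (S : Fin M → ℝ) : CCSState M L N :=
  ⟨S, d.2.1, d.2.2.1, d.2.2.2.1, d.2.2.2.2⟩

/-- The discrete components of a state. -/
def CCSState.discrete (st : CCSState M L N) (κ : Fin M → ℕ) : DiscreteState M L N :=
  (κ, st.turn, st.plan, st.suspects, st.pos)

/-- The update uses the new record only through the new sums. So the new discrete components are a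
function of the old ones and of a real vector. -/
theorem ccsUpdate_eq (b : ℝ) (R : OrderingRule M L) (st : CCSState M L N) (row : Record M Y) :
    ccsUpdate f g b R st row = ccsUpdate f g b R
      { st with llr := (ccsUpdate f g b R st row).llr } fun _ => none := by
  rw [show (ccsUpdate f g b R st row).llr = fun i => st.llr i + (row i).elim 0 (llr g f) from
    funext fun i => ccsUpdate_llr f g b R st row i]
  unfold ccsUpdate
  simp

theorem discreteMeasurable_ccsUpdate (b : ℝ) (R : OrderingRule M L) (d : DiscreteState M L N)
    (κ : Fin M → ℕ) : DiscreteMeasurable fun S : Fin M → ℝ =>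
      (ccsUpdate f g b R (d.toState S) fun _ => none).discrete κ := by
  classical
  have hadv : ∀ (q : Fin (M - L) → Fin M) (pos : Fin N → ℕ), DiscreteMeasurable
      fun (S : Fin M → ℝ) (r : Fin N) => advance (N := N) b S q r (pos r) := fun q pos =>
    .pi fun r => discreteMeasurable_advance b q r (pos r)
  have key := (discreteMeasurable_positives (M := M)).bind (G := fun H S =>
    CCSState.discrete (if H.card = L then
      match d.2.2.1, decide (d.2.2.2.1 = some H) with
      | some q, true =>
        { llr := S, turn := if d.2.2.2.1 = none then d.2.1 + 1 else d.2.1, plan := some q,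
          suspects := some H, pos := fun r => advance (N := N) b S q r (d.2.2.2.2 r) }
      | prev, _ =>
        { llr := S, turn := if d.2.2.2.1 = none then d.2.1 + 1 else d.2.1,
          plan := some (R.order prev H), suspects := some H,
          pos := fun r => advance (N := N) b S (R.order prev H) r (r * (M - L) / N) }
    else
      { llr := S, turn := if d.2.2.2.1 = none then d.2.1 + 1 else d.2.1, plan := d.2.2.1,
        suspects := none, pos := fun _ => 0 } : CCSState M L N) κ) (fun H => by
      by_cases h1 : H.card = L
      · simp only [if_pos h1]
        split
        · exact (hadv _ _).map fun pos => (_, _, _, _, pos)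
        · exact (hadv _ _).map fun pos => (_, _, _, _, pos)
      · simp only [if_neg h1]
        exact DiscreteMeasurable.const (α := Fin M → ℝ) (_, _, _, _, _))
  intro s
  convert key s using 2
  funext S
  unfold ccsUpdate DiscreteState.toState
  simp only [Option.elim_none, add_zero]

theorem measurable_walk_of_discrete {κ : (Fin M × ℕ → Y) → Fin M → ℕ} (hκ : DiscreteMeasurable κ) :
    Measurable fun X => (fun i => walk f g X i (κ X i) : Fin M → ℝ) := by
  refine measurable_pi_lambda _ fun i => ?_
  have h1 : Measurable fun z : (Fin M × ℕ → Y) × ℕ => walk f g z.1 i z.2 :=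
    measurable_from_prod_countable_left fun k => Policy.measurable_walk f g i k
  exact h1.comp (measurable_id.prodMk fun s _ => DiscreteMeasurable.map hκ (fun k => k i) s)

-- The probe counts are carried along among the discrete components: given the old components, the
-- new counts are fixed, the new sums are walks at fixed indices and hence measurable, and the new
-- components are a measurable function of these sums.
variable (f g) in
theorem discreteMeasurable_ccsRun (b : ℝ) (R : OrderingRule M L) (n : ℕ) :
    DiscreteMeasurable fun X : Fin M × ℕ → Y =>
      (ccsState N f g b R (ccsRun f g b R X N n)).discrete
        (probeCount (ccsRun f g b R X N n)) := by
  induction n with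
  | zero =>
    exact DiscreteMeasurable.const (α := Fin M × ℕ → Y) ((ccsInit M L N).discrete fun _ => 0)
  | succ n ih =>
    set κ : DiscreteState M L N → Fin M → ℕ := fun d i =>
      if i ∈ ccsProbe f g (d.toState 0) then d.1 i + 1 else d.1 i with hκ
    have key := ih.bind (G := fun d X => (ccsUpdate f g b R
      (d.toState fun i => walk f g X i (κ d i)) fun _ => none).discrete (κ d)) fun d =>
        (discreteMeasurable_ccsUpdate b R d (κ d)).comp
          (measurable_walk_of_discrete (f := f) (g := g) (κ := fun _ => κ d)
            (DiscreteMeasurable.const (α := Fin M × ℕ → Y) (κ d)))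
    intro s
    convert key s using 2
    funext X
    have hcount : probeCount (ccsRun f g b R X N (n + 1)) = κ ((ccsState N f g b R
        (ccsRun f g b R X N n)).discrete (probeCount (ccsRun f g b R X N n))) := by
      funext i
      exact probeCount_cons _ _ _ _
    rw [← hcount]
    congr 1
    have hllr := llr_ccsRun_eq f g b R X (N := N) (n + 1)
    rw [ccsRun, ccsState] at hllr ⊢
    rw [ccsUpdate_eq, hllr]
    rfl

variable {K : ℕ} {R : OrderingRule M L} {c : ℝ}

theorem measurable_ccs_sums (n : ℕ) :
    Measurable fun X : Fin M × ℕ → Y => (ccsTraj f g R c K X).sums n :=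
  measurable_walk_of_discrete ((discreteMeasurable_ccsRun f g (level f g M K L c) R n).map Prod.fst)

theorem ccs_action_eq {ω : Sample M Y} {n : ℕ}
    (h : ∀ m < n, ¬ GapAtLeast L ((ccsTraj f g R c K ω.2).sums m) (-Real.log c)) :
    (GapAtLeast L ((ccsTraj f g R c K ω.2).sums n) (-Real.log c) →
      (ccs K f g R c).action ω n = Action.declare (top L ((ccsTraj f g R c K ω.2).sums n))) ∧
    (¬ GapAtLeast L ((ccsTraj f g R c K ω.2).sums n) (-Real.log c) →
      (ccs K f g R c).action ω n = Action.probe ((ccsTraj f g R c K ω.2).probe n)) := by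
  induction n using Nat.strong_induction_on with
  | _ n ih =>
    have h1 := ccs_history_eq (ω := ω) (n := n) (K := K) (f := f) (g := g) (R := R) (c := c)
      fun m hm D e => by
        rw [(ih m hm fun k hk => h k (hk.trans hm)).2 (h m hm)] at e
        cases e
    have e : (ccsTraj f g R c K ω.2).sums n = (ccsState (normalMachines f g M K L) f g
      (level f g M K L c) R (ccsRun f g (level f g M K L c) R ω.2
      (normalMachines f g M K L) n)).llr := (llr_ccsRun_eq _ _ _ _ _ _).symm
    unfold Policy.action
    rw [h1, e]
    refine ⟨fun h2 => ?_, fun h2 => ?_⟩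
    · simp only [ccs, if_pos h2]
    · simp only [ccs, if_neg h2]
      rfl

/-- Decomposition by the first time up to `n` at which the gap criterion holds along the unstopped
run, which is already known to be measurable. -/
theorem discreteMeasurable_ccs_action (n : ℕ) :
    DiscreteMeasurable fun ω : Sample M Y => (ccs K f g R c).action ω n := by
  have hgap : ∀ m, DiscreteMeasurable fun ω : Sample M Y =>
      GapAtLeast L ((ccsTraj f g R c K ω.2).sums m) (-Real.log c) := fun m =>
    (discreteMeasurable_gapAtLeast _).comp ((measurable_ccs_sums m).comp measurable_snd)
  have htop : ∀ m, DiscreteMeasurable fun ω : Sample M Y =>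
      top L ((ccsTraj f g R c K ω.2).sums m) := fun m =>
    discreteMeasurable_top.comp ((measurable_ccs_sums m).comp measurable_snd)
  have hprobe : DiscreteMeasurable fun ω : Sample M Y => (ccsTraj f g R c K ω.2).probe n :=
    ((discreteMeasurable_ccsRun (N := normalMachines f g M K L) f g (level f g M K L c) R n).map
      fun d => ccsProbe f g (DiscreteState.toState d 0)).comp measurable_snd
  intro s
  have hset : (fun ω : Sample M Y => (ccs K f g R c).action ω n) ⁻¹' s =
      (⋃ m ∈ Finset.range (n + 1),
        {ω | GapAtLeast L ((ccsTraj f g R c K ω.2).sums m) (-Real.log c)} ∩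
        (⋂ k ∈ Finset.range m,
          {ω | GapAtLeast L ((ccsTraj f g R c K ω.2).sums k) (-Real.log c)}ᶜ) ∩
        (fun ω : Sample M Y => top L ((ccsTraj f g R c K ω.2).sums m)) ⁻¹'
          (Action.declare ⁻¹' s)) ∪
      ((⋂ k ∈ Finset.range (n + 1),
          {ω | GapAtLeast L ((ccsTraj f g R c K ω.2).sums k) (-Real.log c)}ᶜ) ∩
        (fun ω : Sample M Y => (ccsTraj f g R c K ω.2).probe n) ⁻¹' (Action.probe ⁻¹' s)) := by
    ext ω
    simp only [Set.mem_preimage, Set.mem_union, Set.mem_iUnion, Set.mem_inter_iff, Set.mem_iInter,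
      Set.mem_compl_iff, Set.mem_ofPred_eq, Finset.mem_range, exists_prop]
    by_cases hex : ∃ m, m < n + 1 ∧ GapAtLeast L ((ccsTraj f g R c K ω.2).sums m) (-Real.log c)
    · classical
      have hm := Nat.find_spec hex
      have hmin : ∀ k < Nat.find hex,
          ¬ GapAtLeast L ((ccsTraj f g R c K ω.2).sums k) (-Real.log c) := fun k hk hg =>
        Nat.find_min hex hk ⟨hk.trans hm.1, hg⟩
      have hact := (Policy.action_of_declare ((ccs_action_eq hmin).1 hm.2)
        (Nat.lt_succ_iff.1 hm.1)).2
      rw [hact]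
      constructor
      · exact fun h => Or.inl ⟨_, hm.1, ⟨hm.2, hmin⟩, h⟩
      · rintro (⟨m, hmn, ⟨hg, hlt⟩, h⟩ | ⟨h, -⟩)
        · have : m = Nat.find hex :=
            le_antisymm (not_lt.1 fun h' => hlt _ h' hm.2) (Nat.find_min' hex ⟨hmn, hg⟩)
          rw [← this]; exact h
        · exact absurd hm.2 (h _ hm.1)
    · push Not at hex
      rw [(ccs_action_eq fun m hm => hex m (by omega)).2 (hex n (by omega))]
      constructor
      · exact fun h => Or.inr ⟨hex, h⟩
      · rintro (⟨m, hmn, ⟨hg, -⟩, -⟩ | ⟨-, h⟩)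
        · exact absurd hg (hex m hmn)
        · exact h
  rw [hset]
  refine MeasurableSet.union ?_ ?_
  · exact Finset.measurableSet_biUnion _ fun m _ => ((hgap m).measurableSet.inter
      (Finset.measurableSet_biInter _ fun k _ => (hgap k).measurableSet.compl)).inter (htop m _)
  · exact (Finset.measurableSet_biInter _ fun k _ => (hgap k).measurableSet.compl).inter (hprobe _)

theorem ccs_isAdmissible (hL : 1 ≤ L) (hLK : L ≤ K) : (ccs K f g R c).IsAdmissible K where
  card_le u h A hA := by
    unfold ccs at hA
    simp only at hA
    split_ifs at hA
    obtain rfl := Action.probe.inj hA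
    exact card_ccsProbe_le hL hLK fun H hH => card_of_ccsState_suspects hH
  measurable n a := discreteMeasurable_ccs_action n {a}

end Admissible

/-! ### The error probability of the CCS policy -/

section Rank

variable {M L : ℕ}

/-- Because ties are broken, the number of cells ranked higher is an injective function with values
below `M`, hence takes each of these values once; `top` collects the first `L`. -/
theorem card_top (S : Fin M → ℝ) (hLM : L ≤ M) : (top L S).card = L := by
  set rk : Fin M → ℕ := fun i =>
    ({j | S i < S j ∨ (S i = S j ∧ j < i)} : Finset (Fin M)).card with hrk
  have hlt : ∀ i j, S i < S j ∨ (S i = S j ∧ j < i) → rk j < rk i := by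
    intro i j hij
    refine Finset.card_lt_card ((Finset.ssubset_iff_of_subset ?_).2 ⟨j, ?_, ?_⟩)
    · intro k hk
      simp only [Finset.mem_filter, Finset.mem_univ, true_and] at hk ⊢
      rcases hij with h1 | ⟨h1, h1'⟩ <;> rcases hk with h2 | ⟨h2, h2'⟩
      · exact Or.inl (h1.trans h2)
      · exact Or.inl (h2 ▸ h1)
      · exact Or.inl (h1 ▸ h2)
      · exact Or.inr ⟨h1.trans h2, h2'.trans h1'⟩
    · simpa using hij
    · simp
  have hinj : Function.Injective rk := by
    intro i j hij
    by_contra hne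
    rcases lt_trichotomy (S i) (S j) with h | h | h
    · exact absurd (hlt i j (Or.inl h)) (by omega)
    · rcases lt_or_gt_of_ne hne with h' | h'
      · exact absurd (hlt j i (Or.inr ⟨h.symm, h'⟩)) (by omega)
      · exact absurd (hlt i j (Or.inr ⟨h, h'⟩)) (by omega)
    · exact absurd (hlt j i (Or.inl h)) (by omega)
  have hrkM : ∀ i, rk i < M := by
    intro i
    have : ({j | S i < S j ∨ (S i = S j ∧ j < i)} : Finset (Fin M)) ⊂ Finset.univ :=
      (Finset.ssubset_iff_of_subset (Finset.subset_univ _)).2 ⟨i, Finset.mem_univ _, by simp⟩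
    simpa using Finset.card_lt_card this
  have himage : Finset.univ.image rk = Finset.range M :=
    Finset.eq_of_subset_of_card_le (fun x hx => by
      obtain ⟨i, -, rfl⟩ := Finset.mem_image.1 hx
      exact Finset.mem_range.2 (hrkM i))
      (by rw [Finset.card_image_of_injective _ hinj]; simp)
  have htop : (top L S).image rk = Finset.range L := by
    ext x
    simp only [Finset.mem_image, Finset.mem_range]
    constructor
    · rintro ⟨i, hi, rfl⟩
      simpa [top] using hi
    · intro hx
      have : x ∈ Finset.univ.image rk := by
        rw [himage]; exact Finset.mem_range.2 (hx.trans_le hLM)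
      obtain ⟨i, -, rfl⟩ := Finset.mem_image.1 this
      exact ⟨i, by simpa [top] using hx, rfl⟩
  rw [← Finset.card_image_of_injective _ hinj, htop, Finset.card_range]

end Rank

section Declares

variable {M : ℕ} {Y : Type*}

theorem Policy.exists_declares_of_stopTime_ne_top {Γ : Policy M Y} {ω : Sample M Y}
    (h : Γ.stopTime ω ≠ ⊤) : ∃ D, Γ.Declares ω D := by
  by_contra! hne
  refine h ?_
  unfold Policy.stopTime
  simp only [iInf_eq_top]
  rintro n ⟨D, hD⟩
  exact absurd ⟨n, hD⟩ (hne D)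

end Declares

section ErrorProb

variable {M K L : ℕ} {Y : Type*} [MeasurableSpace Y] {f g : Measure Y} {R : OrderingRule M L}
  {c : ℝ}

theorem llr_ccsState_history (Γ : Policy M Y) (N : ℕ) (b : ℝ) (ω : Sample M Y) (n : ℕ)
    (i : Fin M) : (ccsState N f g b R (Γ.history ω n)).llr i = walk f g ω.2 i (Γ.count ω n i) := by
  unfold Policy.count
  induction n generalizing i with
  | zero => simp [Policy.history, ccsState, ccsInit, probeCount, walk]
  | succ n ih =>
    rw [Policy.history]
    cases Γ ω.1 (Γ.history ω n) with
    | probe A => exact llr_ccsState_cons f g b R ω.2 A _ ih i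
    | declare D => exact ih i

theorem ccs_action_declare {ω : Sample M Y} {n : ℕ} {D : Finset (Fin M)}
    (h : (ccs K f g R c).action ω n = Action.declare D) :
    D = top L (fun i => walk f g ω.2 i ((ccs K f g R c).count ω n i)) ∧
      GapAtLeast L (fun i => walk f g ω.2 i ((ccs K f g R c).count ω n i)) (-Real.log c) := by
  rw [← funext fun i => llr_ccsState_history (R := R) (ccs K f g R c) (normalMachines f g M K L)
    (level f g M K L c) ω n i]
  unfold Policy.action at h
  generalize (ccs K f g R c).history ω n = l at h ⊢
  unfold ccs at h
  simp only at h
  split_ifs at h with h1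
  exact ⟨(Action.declare.inj h).symm, h1⟩

theorem ccs_declares_card (hLM : L ≤ M) {ω : Sample M Y} {D : Finset (Fin M)}
    (h : (ccs K f g R c).Declares ω D) : D.card = L := by
  obtain ⟨n, hn⟩ := h
  rw [(ccs_action_declare hn).1, card_top _ hLM]

variable [IsProbabilityMeasure f] [IsProbabilityMeasure g]

/-- Take `i` in `D'` but not in `D`, and `j` in `D` but not in `D'`. When `D'` is declared, the gap
gives `S i - S j ≥ -log c`, and this difference is the log-likelihood ratio of `D` with `j` replaced
by `i` against `D`. So the event is at least 1/c times as probable under the swapped set, where its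
probability is at most 1. No comparison with `D'` itself is needed. -/
theorem measure_ccs_declares_le (hgf : g ≪ f) (hfg : f ≪ g) (hL : 1 ≤ L) (hLK : L ≤ K)
    (hc : 0 < c) {D D' : Finset (Fin M)} (hD : D.card = L) (hD' : D'.card = L) (hne : D' ≠ D) :
    hypLaw f g D {ω | (ccs K f g R c).Declares ω D'} ≤ ENNReal.ofReal c := by
  have hadm : (ccs K f g R c).IsAdmissible K := ccs_isAdmissible hL hLK
  obtain ⟨i, hi', hi⟩ : ∃ i ∈ D', i ∉ D := by
    by_contra! h
    exact hne (Finset.eq_of_subset_of_card_le h (by rw [hD, hD']))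
  obtain ⟨j, hj, hj'⟩ : ∃ j ∈ D, j ∉ D' := by
    by_contra! h
    exact hne (Finset.eq_of_subset_of_card_le h (by rw [hD, hD'])).symm
  have hn : ∀ n, hypLaw f g D {ω | (ccs K f g R c).action ω n = Action.declare D'} ≤
      ENNReal.ofReal c := by
    intro n
    set A := {ω : Sample M Y | (ccs K f g R c).action ω n = Action.declare D'} with hA
    have hAm : MeasurableSet A := hadm.measurable n _
    have hchange := Policy.lintegral_hypLaw_change f g hgf hfg hadm.measurable n
      (F := A.indicator 1) (measurable_one.indicator hAm) (fun u X X' h => by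
        have : (u, X) ∈ A ↔ (u, X') ∈ A := by
          simp only [hA, Set.mem_ofPred_eq, Policy.action, h]
        by_cases h1 : (u, X) ∈ A
        · rw [Set.indicator_of_mem h1, Set.indicator_of_mem (this.1 h1)]; rfl
        · rw [Set.indicator_of_notMem h1, Set.indicator_of_notMem (mt this.2 h1)])
      D (insert i (D.erase j))
    rw [lintegral_indicator_one hAm] at hchange
    have h1 : ENNReal.ofReal c⁻¹ * hypLaw f g D A ≤ 1 := by
      calc ENNReal.ofReal c⁻¹ * hypLaw f g D A
          = ∫⁻ ω, A.indicator (fun _ => ENNReal.ofReal c⁻¹) ω ∂(hypLaw f g D) := by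
            rw [lintegral_indicator_const hAm]
        _ ≤ hypLaw f g (insert i (D.erase j)) A := by
            rw [hchange]
            refine lintegral_mono fun ω => ?_
            by_cases hω : ω ∈ A
            · rw [Set.indicator_of_mem hω, Set.indicator_of_mem hω, Pi.one_apply, one_mul,
                Policy.sum_swapSign_mul hj hi]
              refine ENNReal.ofReal_le_ofReal ?_
              obtain ⟨htop, hgap⟩ := ccs_action_declare hω
              have := hgap i (htop ▸ hi') j (htop ▸ hj')
              have h2 : c⁻¹ = Real.exp (-Real.log c) := by rw [Real.exp_neg, Real.exp_log hc]
              rw [h2]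
              exact Real.exp_le_exp.2 this
            · rw [Set.indicator_of_notMem hω]
              exact zero_le
        _ ≤ 1 := prob_le_one
    have hc' : ENNReal.ofReal c ≠ 0 := by simpa using hc
    rw [ENNReal.ofReal_inv_of_pos hc, mul_comm, ← div_eq_mul_inv,
      ENNReal.div_le_iff hc' ENNReal.ofReal_ne_top, one_mul] at h1
    exact h1
  have h1 := tendsto_measure_iUnion_atTop (μ := hypLaw f g D)
    (Policy.monotone_declare (Γ := ccs K f g R c) D')
  rw [← Policy.declares_eq_iUnion] at h1
  exact le_of_tendsto h1 (Eventually.of_forall hn)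

theorem measure_ccs_not_declares_le (hgf : g ≪ f) (hfg : f ≪ g) (hL : 1 ≤ L) (hLK : L ≤ K)
    (hLM : L ≤ M) (hc : 0 < c) {D : Finset (Fin M)} (hD : D.card = L)
    (hτ : ∀ᵐ ω ∂(hypLaw f g D), (ccs K f g R c).stopTime ω ≠ ⊤) :
    hypLaw f g D {ω | ¬ (ccs K f g R c).Declares ω D} ≤ 2 ^ M * ENNReal.ofReal c := by
  have hsub : {ω | ¬ (ccs K f g R c).Declares ω D} ≤ᵐ[hypLaw f g D]
      ⋃ D' ∈ (Finset.powersetCard L (Finset.univ : Finset (Fin M))).erase D,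
        {ω | (ccs K f g R c).Declares ω D'} := by
    filter_upwards [hτ] with ω hω h
    obtain ⟨D', hD'⟩ := Policy.exists_declares_of_stopTime_ne_top hω
    refine Set.mem_iUnion₂.2 ⟨D', ?_, hD'⟩
    refine Finset.mem_erase.2 ⟨?_, Finset.mem_powersetCard.2 ⟨Finset.subset_univ _,
      ccs_declares_card hLM hD'⟩⟩
    rintro rfl
    exact h hD'
  refine (measure_mono_ae hsub).trans ((measure_biUnion_finset_le _ _).trans ?_)
  calc ∑ D' ∈ (Finset.powersetCard L (Finset.univ : Finset (Fin M))).erase D,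
        hypLaw f g D {ω | (ccs K f g R c).Declares ω D'}
      ≤ ∑ _D' ∈ (Finset.powersetCard L (Finset.univ : Finset (Fin M))).erase D,
        ENNReal.ofReal c := Finset.sum_le_sum fun D' hD' => by
          rw [Finset.mem_erase, Finset.mem_powersetCard] at hD'
          exact measure_ccs_declares_le hgf hfg hL hLK hc hD hD'.2.2 hD'.1
    _ ≤ 2 ^ M * ENNReal.ofReal c := by
        rw [Finset.sum_const, nsmul_eq_mul]
        gcongr
        have h1 : ((Finset.powersetCard L (Finset.univ : Finset (Fin M))).erase D).card ≤ 2 ^ M := by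
          refine (Finset.card_le_univ _).trans ?_
          simp
        exact_mod_cast h1

end ErrorProb

/-! ### Large deviations of the sum LLRs -/

section Chernoff

variable {Y : Type*} [MeasurableSpace Y]

/-- The moment generating function of `a - φ` is 1 at 0 with right derivative `a - ∫ φ < 0`. The
derivative is computed along `s = 1 / (n + 1)` by dominated convergence: with `x = φ - a`, convexity
puts the difference quotients between `-x` and `exp (-x)`. So one exponential moment on one side is
enough. -/
theorem exists_lintegral_exp_lt_one {μ : Measure Y} [IsProbabilityMeasure μ] {φ : Y → ℝ}
    (hφ : Integrable φ μ) (hexp : Integrable (fun y => Real.exp (-φ y)) μ) {a : ℝ}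
    (ha : a < ∫ y, φ y ∂μ) :
    ∃ s : ℝ, 0 < s ∧ ∫⁻ y, ENNReal.ofReal (Real.exp (s * (a - φ y))) ∂μ < 1 := by
  set x : Y → ℝ := fun y => φ y - a with hx
  have hxint : Integrable x μ := hφ.sub (integrable_const a)
  have hxexp : Integrable (fun y => Real.exp (-x y)) μ := by
    refine (hexp.const_mul (Real.exp a)).congr (ae_of_all _ fun y => ?_)
    simp only [hx]
    rw [← Real.exp_add]
    ring_nf
  set s : ℕ → ℝ := fun n => 1 / ((n : ℝ) + 1) with hs
  have hs0 : ∀ n, 0 < s n := fun n => Nat.one_div_pos_of_nat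
  have hs1 : ∀ n, s n ≤ 1 := fun n => by
    rw [hs, div_le_one (by positivity)]
    linarith [(Nat.cast_nonneg n : (0 : ℝ) ≤ n)]
  set F : ℕ → Y → ℝ := fun n y => (Real.exp (-(s n * x y)) - 1) / s n with hF
  have hlow : ∀ n y, -x y ≤ F n y := by
    intro n y
    rw [hF, le_div_iff₀ (hs0 n)]
    have := Real.add_one_le_exp (-(s n * x y))
    linarith
  have hconv : ∀ n y, Real.exp (-(s n * x y)) ≤ s n * Real.exp (-x y) + (1 - s n) := by
    intro n y
    have := convexOn_exp.2 (Set.mem_univ (-x y)) (Set.mem_univ 0) (hs0 n).le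
      (sub_nonneg.2 (hs1 n)) (by ring)
    simpa [smul_eq_mul] using this
  have hup : ∀ n y, F n y ≤ Real.exp (-x y) := by
    intro n y
    rw [hF, div_le_iff₀ (hs0 n)]
    have := hconv n y
    nlinarith [hs0 n]
  have hxm := hxint.aestronglyMeasurable
  have hEint : ∀ n, Integrable (fun y => Real.exp (-(s n * x y))) μ := fun n => by
    refine ((hxexp.const_mul (s n)).add (integrable_const (1 - s n))).mono'
      (Real.continuous_exp.comp_aestronglyMeasurable (hxm.const_mul (s n)).neg)
      (ae_of_all _ fun y => ?_)
    rw [Real.norm_of_nonneg (Real.exp_pos _).le]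
    exact hconv n y
  have hlim : Tendsto (fun n => ∫ y, F n y ∂μ) atTop (𝓝 (∫ y, -x y ∂μ)) := by
    refine tendsto_integral_of_dominated_convergence (fun y => |x y| + Real.exp (-x y))
      (fun n => (((hEint n).sub (integrable_const 1)).div_const (s n)).aestronglyMeasurable)
      (hxint.abs.add hxexp) (fun n => ae_of_all _ fun y => ?_) (ae_of_all _ fun y => ?_)
    · rw [Real.norm_eq_abs, abs_le]
      constructor
      · have := hlow n y
        have := neg_abs_le (x y)
        have := le_abs_self (x y)
        have := Real.exp_pos (-x y)
        linarith
      · have := hup n y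
        have := abs_nonneg (x y)
        linarith
    · have h1 : HasDerivAt (fun t : ℝ => Real.exp (-(t * x y))) (-x y) 0 := by
        have h2 : HasDerivAt (fun t : ℝ => -(t * x y)) (-x y) 0 := by
          simpa using (hasDerivAt_id (0 : ℝ)).mul_const (-x y)
        simpa using h2.exp
      have h3 := h1.tendsto_slope.comp (tendsto_nhdsWithin_iff.2
        ⟨tendsto_one_div_add_atTop_nhds_zero_nat (𝕜 := ℝ),
          Eventually.of_forall fun n => (hs0 n).ne'⟩)
      refine h3.congr fun n => ?_
      simp only [Function.comp_apply, slope_def_field, hF, hs]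
      simp
  have hneg : ∫ y, -x y ∂μ < 0 := by
    rw [integral_neg, hx, integral_sub hφ (integrable_const a)]
    simp only [integral_const, probReal_univ, smul_eq_mul, one_mul]
    linarith
  obtain ⟨n, hn⟩ := (hlim.eventually_lt_const hneg).exists
  refine ⟨s n, hs0 n, ?_⟩
  have h1 : ∫ y, F n y ∂μ = ((∫ y, Real.exp (-(s n * x y)) ∂μ) - 1) / s n := by
    rw [hF, integral_div, integral_sub (hEint n) (integrable_const 1)]
    simp
  rw [h1, div_neg_iff] at hn
  have h2 : ∫ y, Real.exp (-(s n * x y)) ∂μ < 1 := by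
    rcases hn with ⟨-, h⟩ | ⟨h, -⟩
    · exact absurd h (hs0 n).le.not_gt
    · linarith
  have h3 : ∀ y, ENNReal.ofReal (Real.exp (s n * (a - φ y))) =
      ENNReal.ofReal (Real.exp (-(s n * x y))) := fun y => by
    congr 2; simp only [hx]; ring
  rw [lintegral_congr h3, ← ofReal_integral_eq_lintegral_ofReal (hEint n)
    (ae_of_all _ fun y => (Real.exp_pos _).le)]
  rwa [← ENNReal.ofReal_one, ENNReal.ofReal_lt_ofReal_iff one_pos]

end Chernoff

/-! ### One integrable variable for all fluctuations. -/

section Envelope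

variable {M : ℕ} {Y : Type*} [MeasurableSpace Y] (f g : Measure Y)

/-- The sign of the drift of the sum LLR of cell `i`. -/
def driftSign (D : Finset (Fin M)) (i : Fin M) : ℝ := if i ∈ D then 1 else -1

/-- The absolute value of the drift of the sum LLR of cell `i`. -/
def drift (D : Finset (Fin M)) (i : Fin M) : ℝ := if i ∈ D then klReal g f else klReal f g

/-- A bound for how much the sum LLRs fall behind their drifts, on all time intervals. -/
def envelope (D : Finset (Fin M)) (ε : ℝ) (X : Fin M × ℕ → Y) : ℝ≥0∞ :=
  ∑ i, ∑' k : ℕ, ∑' m : ℕ, ENNReal.ofReal ((drift f g D i - ε) * m - ε * k -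
    driftSign D i * (walk f g X i (k + m) - walk f g X i k))

variable {f g}

theorem le_of_envelope_le {D : Finset (Fin M)} {ε ρ : ℝ} {X : Fin M × ℕ → Y} (hρ : 0 ≤ ρ)
    (h : envelope f g D ε X ≤ ENNReal.ofReal ρ) (i : Fin M) (k m : ℕ) :
    (drift f g D i - ε) * m - ε * k - ρ ≤
      driftSign D i * (walk f g X i (k + m) - walk f g X i k) := by
  have h1 : ENNReal.ofReal ((drift f g D i - ε) * m - ε * k -
      driftSign D i * (walk f g X i (k + m) - walk f g X i k)) ≤ ENNReal.ofReal ρ := by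
    refine le_trans ?_ h
    unfold envelope
    refine le_trans ?_ (Finset.single_le_sum (f := fun i => ∑' k : ℕ, ∑' m : ℕ,
      ENNReal.ofReal ((drift f g D i - ε) * m - ε * k -
        driftSign D i * (walk f g X i (k + m) - walk f g X i k))) (fun _ _ => zero_le)
      (Finset.mem_univ i))
    exact (ENNReal.le_tsum m).trans (ENNReal.le_tsum (f := fun k : ℕ => ∑' m : ℕ,
      ENNReal.ofReal ((drift f g D i - ε) * m - ε * k -
        driftSign D i * (walk f g X i (k + m) - walk f g X i k))) k)
  have := (ENNReal.ofReal_le_ofReal_iff hρ).1 h1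
  linarith

theorem measurable_envelope (D : Finset (Fin M)) (ε : ℝ) :
    Measurable fun X : Fin M × ℕ → Y => envelope f g D ε X := by
  unfold envelope
  refine Finset.measurable_sum _ fun i _ => ?_
  refine Measurable.tsum fun k => Measurable.tsum fun m => ?_
  exact ENNReal.measurable_ofReal.comp (measurable_const.sub
    (((Policy.measurable_walk f g i (k + m)).sub (Policy.measurable_walk f g i k)).const_mul _))

theorem measurable_envelope_snd (D : Finset (Fin M)) (ε : ℝ) :
    Measurable fun ω : Sample M Y => envelope f g D ε ω.2 :=
  (measurable_envelope D ε).comp measurable_snd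

variable [IsProbabilityMeasure f] [IsProbabilityMeasure g]

theorem integrable_exp_of_withDensity {μ ν : Measure Y} [IsProbabilityMeasure ν] {φ : Y → ℝ}
    (hφ : Measurable φ) (h : μ.withDensity (fun y => ENNReal.ofReal (Real.exp (φ y))) = ν) :
    Integrable (fun y => Real.exp (φ y)) μ := by
  refine ⟨(Real.measurable_exp.comp hφ).aestronglyMeasurable, ?_⟩
  rw [hasFiniteIntegral_iff_ofReal (ae_of_all _ fun ω => (Real.exp_pos _).le)]
  have h1 : ν Set.univ = 1 := measure_univ
  rw [← h, withDensity_apply _ MeasurableSet.univ, Measure.restrict_univ] at h1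
  rw [h1]
  exact ENNReal.one_lt_top

/-- Bounding the positive part of z by exp (s z) / s, each term has expectation at most a constant
times `θ ^ k * ρ ^ m`. Here `ρ < 1` comes from the drift reduced by `ε`, and `θ = exp (-s ε) < 1`
from the slack `ε * k`, without which the sum over the starting points `k` would diverge. The
required exponential moments are integrals of dg/df under `f` and of df/dg under `g`. -/
theorem lintegral_envelope_lt_top (hgf : klDiv g f ≠ ⊤) (hfg : klDiv f g ≠ ⊤)
    (D : Finset (Fin M)) {ε : ℝ} (hε : 0 < ε) :
    ∫⁻ ω, envelope f g D ε ω.2 ∂(hypLaw f g D) < ⊤ := by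
  have hac := klDiv_ne_top_iff.1 hgf
  have hac' := klDiv_ne_top_iff.1 hfg
  unfold hypLaw
  rw [measurePreserving_snd.lintegral_comp (measurable_envelope D ε)]
  unfold envelope
  have hmeas : ∀ i k m, Measurable fun X : Fin M × ℕ → Y =>
      ENNReal.ofReal ((drift f g D i - ε) * m - ε * k -
        driftSign D i * (walk f g X i (k + m) - walk f g X i k)) := fun i k m =>
    ENNReal.measurable_ofReal.comp (measurable_const.sub
      (((Policy.measurable_walk f g i (k + m)).sub (Policy.measurable_walk f g i k)).const_mul _))
  rw [lintegral_finsetSum _ fun i _ => Measurable.tsum fun k =>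
    Measurable.tsum fun m => hmeas i k m]
  refine ENNReal.sum_lt_top.2 fun i _ => ?_
  set μ : Measure Y := if i ∈ D then g else f with hμ
  obtain ⟨s, hs, hlt⟩ : ∃ s : ℝ, 0 < s ∧ ∫⁻ y, ENNReal.ofReal (Real.exp
      (s * ((drift f g D i - ε) - driftSign D i * llr g f y))) ∂μ < 1 := by
    by_cases hi : i ∈ D
    · simp only [hμ, drift, driftSign, if_pos hi]
      refine exists_lintegral_exp_lt_one (hac.2.const_mul 1) ?_ ?_
      · simpa using integrable_exp_of_withDensity (measurable_llr g f).neg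
          (withDensity_exp_neg_llr f g hac.1 hac'.1)
      · simp only [one_mul]
        rw [Policy.integral_llr_eq hgf]
        linarith
    · simp only [hμ, drift, driftSign, if_neg hi]
      refine exists_lintegral_exp_lt_one ((Policy.integrable_llr_swap hfg).const_mul (-1)) ?_ ?_
      · simpa using integrable_exp_of_withDensity (measurable_llr g f)
          (withDensity_exp_llr f g hac.1 hac'.1)
      · rw [integral_const_mul, Policy.integral_llr_swap hfg]
        linarith
  set ψ : Y → ℝ≥0∞ := fun y => ENNReal.ofReal (Real.exp
      (s * ((drift f g D i - ε) - driftSign D i * llr g f y))) with hψ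
  have hψm : Measurable ψ := by
    have := measurable_llr g f
    fun_prop
  set ρ := ∫⁻ y, ψ y ∂μ with hρ
  set θ : ℝ≥0∞ := ENNReal.ofReal (Real.exp (-(s * ε))) with hθ
  have hθ1 : θ < 1 := by
    rw [hθ, ← ENNReal.ofReal_one, ENNReal.ofReal_lt_ofReal_iff one_pos, Real.exp_lt_one_iff]
    have := mul_pos hs hε
    linarith
  have hterm : ∀ k m : ℕ, ∫⁻ X, ENNReal.ofReal ((drift f g D i - ε) * m - ε * k -
      driftSign D i * (walk f g X i (k + m) - walk f g X i k))
      ∂(Measure.infinitePi fun p : Fin M × ℕ => if p.1 ∈ D then g else f) ≤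
      ENNReal.ofReal s⁻¹ * θ ^ k * ρ ^ m := by
    intro k m
    set e : ℕ ↪ Fin M × ℕ := ⟨fun r => (i, k + r), fun a b h => by simpa using h⟩ with he
    calc _ ≤ ∫⁻ X, ENNReal.ofReal s⁻¹ * θ ^ k * ∏ p ∈ (Finset.range m).map e, ψ (X p)
          ∂(Measure.infinitePi fun p : Fin M × ℕ => if p.1 ∈ D then g else f) := by
          refine lintegral_mono fun X => ?_
          rw [Finset.prod_map, hψ, hθ]
          simp only
          rw [← ENNReal.ofReal_prod_of_nonneg fun p _ => (Real.exp_pos _).le, ← Real.exp_sum,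
            ← ENNReal.ofReal_pow (Real.exp_pos _).le, ← Real.exp_nat_mul,
            ← ENNReal.ofReal_mul (by positivity), ← ENNReal.ofReal_mul (by positivity),
            mul_assoc, ← Real.exp_add]
          refine ENNReal.ofReal_le_ofReal ?_
          have h1 : walk f g X i (k + m) - walk f g X i k =
              ∑ r ∈ Finset.range m, llr g f (X (i, k + r)) := by
            unfold walk
            rw [Finset.sum_range_add]
            ring
          rw [h1, inv_mul_eq_div, le_div_iff₀ hs]
          refine le_trans (le_of_eq ?_) ((le_add_of_nonneg_right zero_le_one).trans
            (Real.add_one_le_exp _))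
          have h2 : ∀ r, e r = (i, k + r) := fun r => rfl
          simp only [h2]
          rw [← Finset.mul_sum, Finset.sum_sub_distrib, ← Finset.mul_sum, Finset.sum_const,
            Finset.card_range, nsmul_eq_mul]
          ring
      _ = ENNReal.ofReal s⁻¹ * θ ^ k * ρ ^ m := by
          rw [lintegral_const_mul _ (by fun_prop),
            lintegral_prod_infinitePi _ (fun _ => ψ) fun _ => hψm, Finset.prod_map]
          have h2 : ∀ r, e r = (i, k + r) := fun r => rfl
          simp only [h2, Finset.prod_const, Finset.card_range]
          rfl
  rw [lintegral_tsum fun k => (Measurable.tsum fun m => hmeas i k m).aemeasurable]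
  calc _ = ∑' k : ℕ, ∑' m : ℕ, ∫⁻ X, ENNReal.ofReal ((drift f g D i - ε) * m - ε * k -
      driftSign D i * (walk f g X i (k + m) - walk f g X i k))
      ∂(Measure.infinitePi fun p : Fin M × ℕ => if p.1 ∈ D then g else f) :=
        tsum_congr fun k => lintegral_tsum fun m => (hmeas i k m).aemeasurable
    _ ≤ ∑' k : ℕ, ∑' m : ℕ, ENNReal.ofReal s⁻¹ * θ ^ k * ρ ^ m :=
        ENNReal.tsum_le_tsum fun k => ENNReal.tsum_le_tsum fun m => hterm k m
    _ = ENNReal.ofReal s⁻¹ * (1 - θ)⁻¹ * (1 - ρ)⁻¹ := by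
        simp only [ENNReal.tsum_mul_left, ENNReal.tsum_mul_right, ENNReal.tsum_geometric]
    _ < ⊤ := by
        refine ENNReal.mul_lt_top (ENNReal.mul_lt_top ENNReal.ofReal_lt_top ?_) ?_ <;>
        · rw [ENNReal.inv_lt_top]
          exact tsub_pos_of_lt (by assumption)

end Envelope

/-! ### Bounds for the runs of the CCS policy -/

section Rate

variable {M K L : ℕ} {Y : Type*} [MeasurableSpace Y] {f g : Measure Y}

theorem normalMachines_le (hKM : K ≤ M) (hK2 : ¬ CaseOne f g M L → K ≤ M - L) :
    normalMachines f g M K L ≤ M - L := by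
  unfold normalMachines
  split_ifs with h
  · omega
  · exact hK2 h

theorem normalMachines_pos (h : ¬ CaseOne f g M L) (hL : 1 ≤ L) (hLK : L ≤ K) :
    0 < normalMachines f g M K L := by
  unfold normalMachines
  rw [if_neg h]
  omega

theorem rate_of_caseOne (h : CaseOne f g M L) (hLK : L ≤ K) : rate f g M K L =
    klReal g f + (normalMachines f g M K L : ℝ) * klReal f g / ((M : ℝ) - L) := by
  unfold rate normalMachines
  rw [if_pos h, if_pos h, Nat.cast_sub hLK]

theorem rate_of_not_caseOne (h : ¬ CaseOne f g M L) : rate f g M K L =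
    (normalMachines f g M K L : ℝ) * klReal f g / ((M : ℝ) - L) := by
  unfold rate normalMachines
  rw [if_neg h, if_neg h]

theorem rate_pos (hL : 1 ≤ L) (hLK : L ≤ K) (hLM : L < M) (hg : 0 < klReal g f)
    (hf : 0 < klReal f g) : 0 < rate f g M K L := by
  have hML : (0 : ℝ) < (M : ℝ) - L := by
    have : (L : ℝ) < M := by exact_mod_cast hLM
    linarith
  by_cases h : CaseOne f g M L
  · rw [rate_of_caseOne h hLK]
    positivity
  · rw [rate_of_not_caseOne h]
    have : (0 : ℝ) < normalMachines f g M K L := by exact_mod_cast normalMachines_pos h hL hLK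
    positivity

theorem level_eq (c : ℝ) : level f g M K L c = -(-Real.log c *
    ((normalMachines f g M K L : ℝ) * klReal f g / ((M : ℝ) - L) / rate f g M K L)) := by
  unfold level
  rw [div_div]
  ring

theorem level_of_not_caseOne (h : ¬ CaseOne f g M L) (hL : 1 ≤ L) (hLK : L ≤ K) (hLM : L < M)
    (hg : 0 < klReal g f) (hf : 0 < klReal f g) (c : ℝ) :
    level f g M K L c = -(-Real.log c) := by
  rw [level_eq, ← rate_of_not_caseOne h, div_self (rate_pos hL hLK hLM hg hf).ne', mul_one]

theorem klReal_pos {μ ν : Measure Y} [IsProbabilityMeasure μ] [IsProbabilityMeasure ν]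
    (hne : μ ≠ ν) (h : klDiv μ ν ≠ ⊤) : 0 < klReal μ ν :=
  ENNReal.toReal_pos (fun h0 => hne (klDiv_eq_zero_iff.1 h0)) h

end Rate

section Paths

variable {M K L : ℕ} {Y : Type*} [MeasurableSpace Y] {f g : Measure Y} {R : OrderingRule M L}
  {c e ε ρ : ℝ} {D : Finset (Fin M)} {X : Fin M × ℕ → Y}

theorem le_drift_sub (heg : 2 * e ≤ klReal g f) (hef : 2 * e ≤ klReal f g) (hε : ε ≤ e)
    (i : Fin M) : e ≤ drift f g D i - ε := by
  unfold drift
  split_ifs <;> linarith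

theorem lt_walk_of_envelope_le (he : 0 < e) (heg : 2 * e ≤ klReal g f) (hef : 2 * e ≤ klReal f g)
    (hε : ε ≤ e) (hρ : 0 ≤ ρ) (hU : envelope f g D ε X ≤ ENNReal.ofReal ρ) {y : ℝ} {k : ℕ}
    (hk : (y + ρ) / e < k) (i : Fin M) : y < driftSign D i * walk f g X i k := by
  have h1 := le_of_envelope_le hρ hU i 0 k
  have h2 : e * k ≤ (drift f g D i - ε) * k := by
    gcongr
    exact le_drift_sub heg hef hε i
  have h3 : y + ρ < k * e := (div_lt_iff₀ he).1 hk
  simp only [Nat.cast_zero, mul_zero, sub_zero, zero_add] at h1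
  have h4 : walk f g X i 0 = 0 := by simp [walk]
  rw [h4, sub_zero] at h1
  linarith

/-- The signs are settled after about `envelope / e` probes of each cell, a number that does not
involve `c`. Where the envelope is infinite the bound is void. -/
theorem ccs_switchings_le_of_envelope (he : 0 < e) (heg : 2 * e ≤ klReal g f)
    (hef : 2 * e ≤ klReal f g) (hε : ε ≤ e) (hL : 1 ≤ L) (hD : D.card = L) {ω : Sample M Y} :
    (ccs K f g R c).switchings ω ≤
      ENNReal.ofReal (M * (normalMachines f g M K L * M) +
        M * (1 + normalMachines f g M K L * M) * M * 3) +
      ENNReal.ofReal (M * (1 + normalMachines f g M K L * M) * M * 2 / e) *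
        envelope f g D ε ω.2 := by
  by_cases hM : M = 0
  · subst hM
    have : D.card ≤ 0 := by simpa using Finset.card_le_univ D
    omega
  have hMpos : (0 : ℝ) < M := by exact_mod_cast Nat.pos_of_ne_zero hM
  by_cases hU : envelope f g D ε ω.2 = ⊤
  · rw [hU, ENNReal.mul_top, add_top]
    · exact le_top
    · rw [Ne, ENNReal.ofReal_eq_zero, not_le]
      positivity
  set ρ := (envelope f g D ε ω.2).toReal with hρ
  have hρ0 : 0 ≤ ρ := ENNReal.toReal_nonneg
  have hUρ : envelope f g D ε ω.2 = ENNReal.ofReal ρ := (ENNReal.ofReal_toReal hU).symm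
  set κ := ⌊(0 + ρ) / e⌋₊ + 1 with hκ
  have hsettled : Trajectory.SignsSettled (walk f g ω.2) D κ := by
    intro i k hk
    have h1 : (0 + ρ) / e < k := by
      refine (Nat.lt_floor_add_one _).trans_le ?_
      exact_mod_cast hk
    have h2 := lt_walk_of_envelope_le he heg hef hε hρ0 hUρ.le h1 i
    unfold driftSign at h2
    split_ifs at h2 with hi
    · simp only [hi, iff_true]; linarith
    · simp only [hi, iff_false]; linarith
  have hκle : (κ : ℝ) ≤ ρ / e + 1 := by
    rw [hκ]
    push_cast
    have := Nat.floor_le (show 0 ≤ (0 + ρ) / e by positivity)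
    rw [zero_add] at this ⊢
    linarith
  refine (ccs_switchings_le (u := ω.1) hL hD hsettled).trans ?_
  rw [hUρ, ← ENNReal.ofReal_mul (by positivity), ← ENNReal.ofReal_add (by positivity)
    (by positivity), ← ENNReal.ofReal_natCast]
  refine ENNReal.ofReal_le_ofReal ?_
  push_cast
  have h3 : (M : ℝ) * (1 + normalMachines f g M K L * M) * (M * (κ + 1) + M * κ) ≤
      M * (1 + normalMachines f g M K L * M) * (M * (ρ / e + 1 + 1) + M * (ρ / e + 1)) := by
    gcongr
  refine (add_le_add_right h3 _).trans (le_of_eq ?_)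
  field_simp
  ring

/-- The crude bound for the detection delay. -/
theorem ccs_le_of_envelope (he : 0 < e) (heg : 2 * e ≤ klReal g f)
    (hef : 2 * e ≤ klReal f g) (hε : ε ≤ e) (hL : 1 ≤ L) (hLK : L ≤ K) (hLM : L < M)
    (hD : D.card = L) (hc : 0 < -Real.log c) (hρ : 0 ≤ ρ) {ω : Sample M Y}
    (hU : envelope f g D ε ω.2 ≤ ENNReal.ofReal ρ) {m : ℕ}
    (hm : (m : ℕ∞) ≤ (ccs K f g R c).stopTime ω) :
    (m : ℝ) ≤ M * (3 + 2 * ((-Real.log c + ρ) / e)) := by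
  have hg : 0 < klReal g f := by linarith
  have hf : 0 < klReal f g := by linarith
  set κ := ⌊(-Real.log c + ρ) / e⌋₊ + 1 with hκ
  have hκle : (κ : ℝ) ≤ (-Real.log c + ρ) / e + 1 := by
    rw [hκ]
    push_cast
    have := Nat.floor_le (show 0 ≤ (-Real.log c + ρ) / e by positivity)
    linarith
  have hlt : ∀ i k, κ ≤ k → -Real.log c < driftSign D i * walk f g ω.2 i k := fun i k hk =>
    lt_walk_of_envelope_le he heg hef hε hρ hU ((Nat.lt_floor_add_one _).trans_le
      (by exact_mod_cast hk)) i
  have h1 := (ccsTraj f g R c K ω.2).le_of_not_gap (fun i => by simp [walk]) hL hLM hD hc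
    (fun h => ⟨level_of_not_caseOne h hL hLK hLM hg hf c, normalMachines_pos h hL hLK⟩)
    (κ := κ) (fun i hi k hk => by
      have := hlt i k hk
      simp only [driftSign, if_pos hi] at this
      linarith)
    (fun i hi k hk => by
      have := hlt i k hk
      simp only [driftSign, if_neg hi] at this
      linarith)
    (not_gap_of_le_stopTime hm)
  have h2 : (m : ℝ) ≤ M * (κ + 1) + M * κ := by exact_mod_cast h1
  have h3 : (M : ℝ) * κ ≤ M * ((-Real.log c + ρ) / e + 1) := by gcongr
  linarith

/-- The sharp bound for the detection delay when the sum LLRs follow their drifts closely. -/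
theorem ccs_le_of_envelope_le_mul (he : 0 < e) (heg : 2 * e ≤ klReal g f)
    (hef : 2 * e ≤ klReal f g) (hε0 : 0 < ε) (hε : ε ≤ e) (hL : 1 ≤ L) (hLK : L ≤ K)
    (hKM : K ≤ M) (hLM : L < M) (hK2 : ¬ CaseOne f g M L → K ≤ M - L)
    (hR : ¬ CaseOne f g M L → R.IsStable) (hD : D.card = L) (hc : 1 ≤ -Real.log c)
    {C : ℝ} (hC : C = M * (3 + 2 * ((1 + e) / e)) + 1) (hεC : M * (ε * C) < 1)
    {ω : Sample M Y} (hU : envelope f g D ε ω.2 ≤ ENNReal.ofReal (ε * -Real.log c)) {m : ℕ}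
    (hm : (m : ℕ∞) ≤ (ccs K f g R c).stopTime ω) :
    (m : ℝ) ≤ -Real.log c / rate f g M K L * (1 + ε / e) +
      (4 * M + M * M * M + 2) * (2 * (ε * C * -Real.log c / e) + 1) := by
  set b := -Real.log c with hb
  set N := normalMachines f g M K L with hN
  set I := rate f g M K L with hI
  have hg : 0 < klReal g f := by linarith
  have hf : 0 < klReal f g := by linarith
  have hIpos : 0 < I := rate_pos hL hLK hLM hg hf
  have hb0 : 0 < b := by linarith
  have hML : (0 : ℝ) < (M : ℝ) - L := by
    have : (L : ℝ) < M := by exact_mod_cast hLM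
    linarith
  have hNM : N ≤ M - L := normalMachines_le hKM hK2
  have hNM' : (N : ℝ) ≤ M := by exact_mod_cast hNM.trans (Nat.sub_le _ _)
  have hC1 : 1 ≤ C := by rw [hC]; have : (0 : ℝ) ≤ M * (3 + 2 * ((1 + e) / e)) := by positivity
                         linarith
  have hδ0 : 0 ≤ ε * C * b := by positivity
  have hcrude := ccs_le_of_envelope he heg hef hε hL hLK hLM hD hb0 (by positivity) hU hm
  -- The crude bound starts the sharp one: it gives a time of order `b`, so on the relevant range
  -- the slack `ε * k₀` of the envelope is at most `ε` times a multiple of `b`. The summand 1 in `C`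
  -- absorbs the envelope itself.
  have hmδ : ε * m + ε * b ≤ ε * C * b := by
    have h1 : (m : ℝ) ≤ M * (3 + 2 * ((1 + e) / e)) * b := by
      refine hcrude.trans ?_
      rw [mul_assoc]
      gcongr
      have h2 : (b + ε * b) / e ≤ (1 + e) / e * b := by
        rw [div_mul_eq_mul_div]
        gcongr
        nlinarith
      linarith
    have h2 : (m : ℝ) + b ≤ C * b := by rw [hC, add_mul, one_mul]; linarith
    calc ε * m + ε * b = ε * (m + b) := by ring
      _ ≤ ε * (C * b) := by gcongr
      _ = ε * C * b := by ring
  have hfollow : ∀ i, ∀ k₀ ≤ m, ∀ k, k₀ ≤ k → (drift f g D i - ε) * ((k : ℝ) - k₀) - ε * C * b ≤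
      driftSign D i * (walk f g ω.2 i k - walk f g ω.2 i k₀) := by
    intro i k₀ hk₀ k hk
    have h1 := le_of_envelope_le (by positivity) hU i k₀ (k - k₀)
    rw [Nat.add_sub_cancel' hk, Nat.cast_sub hk] at h1
    have h2 : ε * (k₀ : ℝ) ≤ ε * m := by gcongr
    linarith
  have hlev : level f g M K L c = -(b * (N * klReal f g / ((M : ℝ) - L) / I)) := level_eq c
  have hreg : (ccsTraj f g R c K ω.2).Regular D (klReal g f - ε) (klReal f g - ε) (ε * C * b)
      (b * (N * klReal f g / ((M : ℝ) - L) / I)) b m :=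
    { zero := fun i => by simp [walk]
      one_le := hL
      lt := hLM
      card_eq := hD
      dg_pos := by linarith
      df_pos := by linarith
      nonneg := hδ0
      level := hlev
      level_nonneg := by positivity
      anomalous := fun i hi k₀ hk₀ k hk => by
        have := hfollow i k₀ hk₀ k hk
        simp only [drift, driftSign, if_pos hi] at this
        linarith
      normal := fun i hi k₀ hk₀ k hk => by
        have := hfollow i k₀ hk₀ k hk
        simp only [drift, driftSign, if_neg hi] at this
        linarith
      two := fun h => by
        have h1 : b * (N * klReal f g / ((M : ℝ) - L) / I) = b := by
          rw [hI, hN, ← rate_of_not_caseOne h, div_self hIpos.ne', mul_one]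
        refine ⟨h1, normalMachines_pos h hL hLK, hR h, ?_⟩
        rw [h1]
        have h2 : (N : ℝ) * (ε * C * b) ≤ M * (ε * C * b) := by gcongr
        nlinarith
      notGap := not_gap_of_le_stopTime hm }
  -- Reducing a drift by `ε` prolongs the time by a factor of at most `1 + ε / e`.
  have hfac : ∀ d, 2 * e ≤ d → d ≤ (d - ε) * (1 + ε / e) := by
    intro d hd
    have h1 : (d - ε) * (1 + ε / e) - d = ε / e * (d - e - ε) := by field_simp; ring
    have h2 : 0 ≤ ε / e * (d - e - ε) := mul_nonneg (by positivity) (by linarith)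
    linarith
  -- The level balances two ideal times, both equal to `b / I`: with drift D(f||g) each machine
  -- works off its piece times `v`, and in Case 1 an anomalous sum climbs to `b - v` with drift
  -- D(g||f).
  have htime := hreg.time_le (t := b / I * (1 + ε / e)) hNM ?_ (by positivity) ?_ ?_
  · refine htime.trans ?_
    have h1 : ε * C * b / (klReal g f - ε) ≤ ε * C * b / e := by gcongr; linarith
    have h2 : ε * C * b / (klReal f g - ε) ≤ ε * C * b / e := by gcongr; linarith
    have h3 : (4 * M + N * M * M + 2) * (ε * C * b / (klReal g f - ε) +
        ε * C * b / (klReal f g - ε) + 1) ≤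
        (4 * M + M * M * M + 2) * (2 * (ε * C * b / e) + 1) := by
      have h4 : 0 ≤ ε * C * b / (klReal g f - ε) := div_nonneg hδ0 (by linarith)
      have h5 : 0 ≤ ε * C * b / (klReal f g - ε) := div_nonneg hδ0 (by linarith)
      gcongr
      linarith
    linarith
  · rcases Nat.eq_zero_or_pos N with h | h
    · right; rw [h]; simp
    · exact Or.inl h
  · intro h
    have h1 : I = klReal g f + N * klReal f g / ((M : ℝ) - L) := rate_of_caseOne h hLK
    have h2 : b - b * (N * klReal f g / ((M : ℝ) - L) / I) = b / I * klReal g f := by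
      have h3 : N * klReal f g / ((M : ℝ) - L) = I - klReal g f := by rw [h1]; ring
      rw [h3]
      field_simp
      ring
    rw [h2]
    calc b / I * klReal g f ≤ b / I * ((klReal g f - ε) * (1 + ε / e)) := by
          gcongr; exact hfac _ heg
      _ = _ := by ring
  · intro h
    have hNpos : (0 : ℝ) < N := by exact_mod_cast h
    have h2 : ((M : ℝ) - L) / N * (b * (N * klReal f g / ((M : ℝ) - L) / I)) =
        b / I * klReal f g := by
      field_simp
    rw [h2]
    calc b / I * klReal f g ≤ b / I * ((klReal f g - ε) * (1 + ε / e)) := by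
          gcongr; exact hfac _ hef
      _ = _ := by ring

/-- The sharp bound applies if the envelope is at most `ε * b` with `b = -log c`. Otherwise `b` is
less than the envelope divided by `ε`, and the crude bound becomes a constant plus a multiple of the
envelope, both independent of `c`. -/
theorem ccs_stopTime_le (he : 0 < e) (heg : 2 * e ≤ klReal g f)
    (hef : 2 * e ≤ klReal f g) (hε0 : 0 < ε) (hε : ε ≤ e) (hL : 1 ≤ L) (hLK : L ≤ K)
    (hKM : K ≤ M) (hLM : L < M) (hK2 : ¬ CaseOne f g M L → K ≤ M - L)
    (hR : ¬ CaseOne f g M L → R.IsStable) (hD : D.card = L) (hc : 1 ≤ -Real.log c)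
    {C : ℝ} (hC : C = M * (3 + 2 * ((1 + e) / e)) + 1) (hεC : M * (ε * C) < 1)
    (ω : Sample M Y) :
    (((ccs K f g R c).stopTime ω : ℕ∞) : ℝ≥0∞) ≤
      ENNReal.ofReal (-Real.log c / rate f g M K L * (1 + ε / e) +
        (4 * M + M * M * M + 2) * (2 * (ε * C * -Real.log c / e) + 1) + M * 3) +
      ENNReal.ofReal (M * 2 * (1 / ε + 1) / e) * envelope f g D ε ω.2 := by
  have hMpos : (0 : ℝ) < M := by exact_mod_cast (Nat.zero_le L).trans_lt hLM
  have hg : 0 < klReal g f := by linarith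
  have hf : 0 < klReal f g := by linarith
  have hIpos : 0 < rate f g M K L := rate_pos hL hLK hLM hg hf
  have hC0 : 0 ≤ C := by rw [hC]; positivity
  have hb0 : 0 < -Real.log c := by linarith
  have hB : 0 ≤ -Real.log c / rate f g M K L * (1 + ε / e) +
        (4 * M + M * M * M + 2) * (2 * (ε * C * -Real.log c / e) + 1) := by positivity
  by_cases hU : envelope f g D ε ω.2 ≤ ENNReal.ofReal (ε * -Real.log c)
  · refine (Policy.stopTime_le_ofReal fun m hm => ?_).trans le_self_add
    have := ccs_le_of_envelope_le_mul he heg hef hε0 hε hL hLK hKM hLM hK2 hR hD hc hC hεC hU hm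
    linarith
  by_cases hU' : envelope f g D ε ω.2 = ⊤
  · rw [hU', ENNReal.mul_top, add_top]
    · exact le_top
    · rw [Ne, ENNReal.ofReal_eq_zero, not_le]
      positivity
  set ρ := (envelope f g D ε ω.2).toReal with hρ
  have hρ0 : 0 ≤ ρ := ENNReal.toReal_nonneg
  have hUρ : envelope f g D ε ω.2 = ENNReal.ofReal ρ := (ENNReal.ofReal_toReal hU').symm
  rw [hUρ, ENNReal.ofReal_le_ofReal_iff (by positivity), not_le] at hU
  rw [hUρ, ← ENNReal.ofReal_mul (by positivity), ← ENNReal.ofReal_add (by positivity)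
    (by positivity)]
  refine Policy.stopTime_le_ofReal fun m hm => ?_
  have h1 := ccs_le_of_envelope he heg hef hε hL hLK hLM hD hb0 hρ0 hUρ.le hm
  have h2 : -Real.log c ≤ 1 / ε * ρ := by
    rw [one_div, inv_mul_eq_div, le_div_iff₀ hε0]
    linarith
  have h3 : (M : ℝ) * (3 + 2 * ((-Real.log c + ρ) / e)) ≤
      M * (3 + 2 * ((1 / ε * ρ + ρ) / e)) := by gcongr
  have h4 : (M : ℝ) * (3 + 2 * ((1 / ε * ρ + ρ) / e)) =
      M * 3 + M * 2 * (1 / ε + 1) / e * ρ := by field_simp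
  linarith

end Paths

/-! ### Expectations under the CCS policy -/

section Average

variable {M L : ℕ} {π : Finset (Fin M) → ℝ≥0}

theorem average_le (hπ : ∑ D ∈ Finset.powersetCard L Finset.univ, π D = 1)
    {v : Finset (Fin M) → ℝ≥0∞} {x : ℝ≥0∞} (h : ∀ D, D.card = L → v D ≤ x) :
    Policy.average L π v ≤ x := by
  unfold Policy.average
  calc ∑ D ∈ Finset.powersetCard L Finset.univ, (π D : ℝ≥0∞) * v D
      ≤ ∑ D ∈ Finset.powersetCard L Finset.univ, (π D : ℝ≥0∞) * x :=
        Finset.sum_le_sum fun D hD => by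
          gcongr
          exact h D (Finset.mem_powersetCard.1 hD).2
    _ = x := by
        rw [← Finset.sum_mul, ← ENNReal.ofNNReal_finsetSum, hπ, ENNReal.coe_one, one_mul]

theorem le_average (hπ : ∑ D ∈ Finset.powersetCard L Finset.univ, π D = 1)
    {v : Finset (Fin M) → ℝ≥0∞} {x : ℝ≥0∞} (h : ∀ D, D.card = L → x ≤ v D) :
    x ≤ Policy.average L π v := by
  unfold Policy.average
  calc x = ∑ D ∈ Finset.powersetCard L Finset.univ, (π D : ℝ≥0∞) * x := by
        rw [← Finset.sum_mul, ← ENNReal.ofNNReal_finsetSum, hπ, ENNReal.coe_one, one_mul]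
    _ ≤ ∑ D ∈ Finset.powersetCard L Finset.univ, (π D : ℝ≥0∞) * v D :=
        Finset.sum_le_sum fun D hD => by
          gcongr
          exact h D (Finset.mem_powersetCard.1 hD).2

theorem mul_le_average {v : Finset (Fin M) → ℝ≥0∞} {D : Finset (Fin M)} (hD : D.card = L) :
    (π D : ℝ≥0∞) * v D ≤ Policy.average L π v :=
  Finset.single_le_sum (f := fun D => (π D : ℝ≥0∞) * v D) (fun _ _ => zero_le)
    (Finset.mem_powersetCard.2 ⟨Finset.subset_univ D, hD⟩)

end Average

section Expectation

variable {M K L : ℕ} {Y : Type*} [MeasurableSpace Y] {f g : Measure Y} [IsProbabilityMeasure f]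
  [IsProbabilityMeasure g] {R : OrderingRule M L} {π : Finset (Fin M) → ℝ≥0}

theorem ccs_ae_stopTime_ne_top (hgf : klDiv g f ≠ ⊤) (hfg : klDiv f g ≠ ⊤)
    (hg : 0 < klReal g f) (hf : 0 < klReal f g) (hL : 1 ≤ L) (hLK : L ≤ K) (hLM : L < M)
    {D : Finset (Fin M)} (hD : D.card = L) {c : ℝ} (hc : 0 < -Real.log c) :
    ∀ᵐ ω ∂(hypLaw f g D), (ccs K f g R c).stopTime ω ≠ ⊤ := by
  set e := min (klReal g f) (klReal f g) / 2 with he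
  have he0 : 0 < e := half_pos (lt_min hg hf)
  have heg : 2 * e ≤ klReal g f := by rw [he]; linarith [min_le_left (klReal g f) (klReal f g)]
  have hef : 2 * e ≤ klReal f g := by rw [he]; linarith [min_le_right (klReal g f) (klReal f g)]
  filter_upwards [ae_lt_top (measurable_envelope_snd (f := f) (g := g) D e)
    (lintegral_envelope_lt_top hgf hfg D he0).ne] with ω hω
  have h1 := Policy.stopTime_le_ofReal fun m hm => ccs_le_of_envelope (R := R) he0 heg hef le_rfl
    hL hLK hLM hD hc ENNReal.toReal_nonneg (ENNReal.ofReal_toReal hω.ne).ge hm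
  intro htop
  rw [htop, ENat.toENNReal_top, top_le_iff] at h1
  exact ENNReal.ofReal_ne_top h1

theorem exists_ccs_errorProb_le (hgf : klDiv g f ≠ ⊤) (hfg : klDiv f g ≠ ⊤)
    (hg : 0 < klReal g f) (hf : 0 < klReal f g) (hL : 1 ≤ L) (hLK : L ≤ K) (hLM : L < M)
    (hπ : ∑ D ∈ Finset.powersetCard L Finset.univ, π D = 1) :
    ∃ A : ℝ≥0, ∀ c : ℝ, 0 < c →
      (ccs K f g R c).errorProb f g L π ≤ (A : ℝ≥0∞) * ENNReal.ofReal c := by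
  refine ⟨2 ^ M, fun c hc => average_le hπ fun D hD => ?_⟩
  push_cast
  rcases lt_or_ge c 1 with h | h
  · exact measure_ccs_not_declares_le (klDiv_ne_top_iff.1 hgf).1 (klDiv_ne_top_iff.1 hfg).1 hL hLK
      hLM.le hc hD (ccs_ae_stopTime_ne_top hgf hfg hg hf hL hLK hLM hD
        (neg_pos.2 (Real.log_neg hc h)))
  · calc _ ≤ (1 : ℝ≥0∞) := prob_le_one
      _ ≤ ENNReal.ofReal c := by simpa using h
      _ ≤ 2 ^ M * ENNReal.ofReal c := le_mul_of_one_le_left zero_le (one_le_pow₀ one_le_two)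

theorem exists_ccs_expectedSwitchings_le (hgf : klDiv g f ≠ ⊤) (hfg : klDiv f g ≠ ⊤)
    (hg : 0 < klReal g f) (hf : 0 < klReal f g) (hL : 1 ≤ L)
    (hπ : ∑ D ∈ Finset.powersetCard L Finset.univ, π D = 1) :
    ∃ B : ℝ≥0, ∀ c : ℝ, (ccs K f g R c).expectedSwitchings f g L π ≤ (B : ℝ≥0∞) := by
  set e := min (klReal g f) (klReal f g) / 2 with he
  have he0 : 0 < e := half_pos (lt_min hg hf)
  have heg : 2 * e ≤ klReal g f := by rw [he]; linarith [min_le_left (klReal g f) (klReal f g)]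
  have hef : 2 * e ≤ klReal f g := by rw [he]; linarith [min_le_right (klReal g f) (klReal f g)]
  set W : ℝ≥0∞ := ∑ D : Finset (Fin M), ∫⁻ ω, envelope f g D e ω.2 ∂(hypLaw f g D) with hW
  have hWtop : W ≠ ⊤ :=
    (ENNReal.sum_lt_top.2 fun D _ => lintegral_envelope_lt_top hgf hfg D he0).ne
  obtain ⟨a, b, hab⟩ : ∃ a b : ℝ, ∀ (c : ℝ) (D : Finset (Fin M)), D.card = L →
      ∀ ω : Sample M Y, (ccs K f g R c).switchings ω ≤
        ENNReal.ofReal a + ENNReal.ofReal b * envelope f g D e ω.2 :=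
    ⟨_, _, fun c D hD ω => ccs_switchings_le_of_envelope he0 heg hef le_rfl hL hD⟩
  have hfin : ENNReal.ofReal a + ENNReal.ofReal b * W ≠ ⊤ :=
    ENNReal.add_ne_top.2 ⟨ENNReal.ofReal_ne_top, ENNReal.mul_ne_top ENNReal.ofReal_ne_top hWtop⟩
  refine ⟨(ENNReal.ofReal a + ENNReal.ofReal b * W).toNNReal, fun c => ?_⟩
  rw [ENNReal.coe_toNNReal hfin]
  refine average_le hπ fun D hD => (lintegral_mono fun ω => hab c D hD ω).trans ?_
  rw [lintegral_add_left measurable_const, lintegral_const, measure_univ, mul_one,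
    lintegral_const_mul _ (measurable_envelope_snd D e)]
  gcongr
  exact Finset.single_le_sum
    (f := fun D : Finset (Fin M) => ∫⁻ ω, envelope f g D e ω.2 ∂(hypLaw f g D))
    (fun _ _ => zero_le) (Finset.mem_univ D)

theorem exists_ccs_expectedDelay_le (hgf : klDiv g f ≠ ⊤) (hfg : klDiv f g ≠ ⊤)
    (hg : 0 < klReal g f) (hf : 0 < klReal f g) (hL : 1 ≤ L) (hLK : L ≤ K) (hKM : K ≤ M)
    (hLM : L < M) (hK2 : ¬ CaseOne f g M L → K ≤ M - L) (hR : ¬ CaseOne f g M L → R.IsStable)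
    (hπ : ∑ D ∈ Finset.powersetCard L Finset.univ, π D = 1) {η : ℝ} (hη : 0 < η) :
    ∃ B : ℝ, 0 ≤ B ∧ ∀ c : ℝ, 1 ≤ -Real.log c → (ccs K f g R c).expectedDelay f g L π ≤
      ENNReal.ofReal (-Real.log c * (1 / rate f g M K L + η) + B) := by
  set e := min (klReal g f) (klReal f g) / 2 with he
  have he0 : 0 < e := half_pos (lt_min hg hf)
  have heg : 2 * e ≤ klReal g f := by rw [he]; linarith [min_le_left (klReal g f) (klReal f g)]
  have hef : 2 * e ≤ klReal f g := by rw [he]; linarith [min_le_right (klReal g f) (klReal f g)]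
  have hMpos : (0 : ℝ) < M := by exact_mod_cast (Nat.zero_le L).trans_lt hLM
  have hI := rate_pos hL hLK hLM hg hf
  set I := rate f g M K L with hIdef
  set C : ℝ := M * (3 + 2 * ((1 + e) / e)) + 1 with hC
  have hC0 : 0 < C := by positivity
  -- In the bound of `ccs_stopTime_le` the excess over `b / I` that grows with `b = -log c` is
  -- exactly `ε * Q * b`. The last term in the choice of `ε` keeps `M * ε * C` at most 1/2.
  set Q : ℝ := 1 / (I * e) + (4 * M + M * M * M + 2) * (2 * C / e) with hQ
  have hQ0 : 0 < Q := by positivity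
  set ε := min e (min (η / Q) (1 / (2 * (M * C)))) with hεdef
  have hε0 : 0 < ε := by positivity
  have hεe : ε ≤ e := min_le_left _ _
  have hεQ : ε * Q ≤ η := by
    rw [← le_div_iff₀ hQ0]
    exact (min_le_right _ _).trans (min_le_left _ _)
  have hεC : M * (ε * C) < 1 := by
    have h1 : ε ≤ 1 / (2 * (M * C)) := (min_le_right _ _).trans (min_le_right _ _)
    rw [le_div_iff₀ (by positivity)] at h1
    linarith
  set W : ℝ≥0∞ := ∑ D : Finset (Fin M), ∫⁻ ω, envelope f g D ε ω.2 ∂(hypLaw f g D) with hW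
  have hWtop : W ≠ ⊤ :=
    (ENNReal.sum_lt_top.2 fun D _ => lintegral_envelope_lt_top hgf hfg D hε0).ne
  set V : ℝ≥0∞ := ENNReal.ofReal (M * 2 * (1 / ε + 1) / e) * W with hV
  have hVtop : V ≠ ⊤ := ENNReal.mul_ne_top ENNReal.ofReal_ne_top hWtop
  refine ⟨(4 * M + M * M * M + 2) + M * 3 + V.toReal, by positivity, fun c hc => ?_⟩
  refine average_le hπ fun D hD => (lintegral_mono fun ω => ccs_stopTime_le he0 heg hef hε0 hεe hL
    hLK hKM hLM hK2 hR hD hc hC hεC ω).trans ?_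
  rw [lintegral_add_left measurable_const, lintegral_const, measure_univ, mul_one,
    lintegral_const_mul _ (measurable_envelope_snd D ε)]
  have h1 : ENNReal.ofReal (M * 2 * (1 / ε + 1) / e) *
      ∫⁻ ω, envelope f g D ε ω.2 ∂(hypLaw f g D) ≤ ENNReal.ofReal V.toReal := by
    rw [ENNReal.ofReal_toReal hVtop, hV]
    gcongr
    exact Finset.single_le_sum
      (f := fun D : Finset (Fin M) => ∫⁻ ω, envelope f g D ε ω.2 ∂(hypLaw f g D))
      (fun _ _ => zero_le) (Finset.mem_univ D)
  have hb : 0 < -Real.log c := by linarith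
  refine (add_le_add_right h1 _).trans ?_
  rw [← ENNReal.ofReal_add (by positivity) ENNReal.toReal_nonneg]
  refine ENNReal.ofReal_le_ofReal ?_
  have h2 : -Real.log c / I * (1 + ε / e) +
      (4 * M + M * M * M + 2) * (2 * (ε * C * -Real.log c / e) + 1) =
      -Real.log c * (1 / I + ε * Q) + (4 * M + M * M * M + 2) := by
    rw [hQ]
    field_simp
    ring
  rw [h2]
  have h3 : -Real.log c * (1 / I + ε * Q) ≤ -Real.log c * (1 / I + η) := by gcongr
  linarith

end Expectation

/-! ### Lower bound for the Bayes risk -/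

section RiskLower

variable {M K L : ℕ} {Y : Type*} [MeasurableSpace Y] {f g : Measure Y} [IsProbabilityMeasure f]
  [IsProbabilityMeasure g] {π : Finset (Fin M) → ℝ≥0}

/-- A policy with a small error probability has a large risk. -/
theorem Policy.le_bayesRisk_of_errorProb_le (hgf : klDiv g f ≠ ⊤) (hfg : klDiv f g ≠ ⊤)
    (hg : 0 < klReal g f) (hI : 0 < rate f g M K L) (hL : 1 ≤ L) (hLM : L < M)
    (hπ : ∑ D ∈ Finset.powersetCard L Finset.univ, π D = 1) {p : ℝ} (hp : 0 < p)
    (hpπ : ∀ D, D.card = L → p ≤ π D) {Γ : Policy M Y} (hΓ : Γ.IsAdmissible K) {c s q : ℝ}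
    (hc : 0 ≤ c) (hq : 0 < q) (hq1 : q ≤ 1)
    (herr : Γ.errorProb f g L π ≤ ENNReal.ofReal (q * p)) :
    ENNReal.ofReal (c * (-Real.log q * (1 - q) - 1) / rate f g M K L) ≤
      Γ.bayesRisk f g L π c s := by
  have hD : ∀ D : Finset (Fin M), D.card = L →
      hypLaw f g D {ω | ¬ Γ.Declares ω D} ≤ ENNReal.ofReal q := by
    intro D hD
    have h1 : ENNReal.ofReal p * hypLaw f g D {ω | ¬ Γ.Declares ω D} ≤
        ENNReal.ofReal (q * p) := by
      refine le_trans ?_ ((mul_le_average (π := π)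
        (v := fun D => hypLaw f g D {ω | ¬ Γ.Declares ω D}) hD).trans herr)
      gcongr
      rw [← ENNReal.ofReal_coe_nnreal]
      exact ENNReal.ofReal_le_ofReal (hpπ D hD)
    rw [mul_comm q, ENNReal.ofReal_mul hp.le] at h1
    exact (ENNReal.mul_le_mul_iff_right (by simpa using hp) ENNReal.ofReal_ne_top).1 h1
  have hdelay : ∀ D : Finset (Fin M), D.card = L →
      ENNReal.ofReal (-Real.log q * (1 - q) - 1) ≤ ENNReal.ofReal (rate f g M K L) *
        ∫⁻ ω, ((Γ.stopTime ω : ℕ∞) : ℝ≥0∞) ∂(hypLaw f g D) := by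
    intro D hDL
    refine Policy.rate_mul_delay_ge hgf hfg hg hI.le hL hLM hΓ hDL
      (neg_nonneg.2 (Real.log_nonpos hq.le hq1)) (hD D hDL) hq.le fun i hi j hj => ?_
    rw [neg_neg, Real.exp_log hq]
    have hcard : (insert j (D.erase i)).card = L := by
      rw [Finset.card_insert_of_notMem (fun h => hj (Finset.mem_of_mem_erase h)),
        Finset.card_erase_of_mem hi, hDL]
      omega
    -- Declaring `D` is an error under the swapped set, so the same error bound serves there.
    refine (measure_mono fun ω (hω : Γ.Declares ω D) => ?_).trans (hD _ hcard)
    intro h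
    have := Policy.eq_of_declares hω h
    exact hj (this ▸ Finset.mem_insert_self j _)
  have havg : ENNReal.ofReal ((-Real.log q * (1 - q) - 1) / rate f g M K L) ≤
      Γ.expectedDelay f g L π := by
    refine le_average hπ fun D hDL => ?_
    rw [ENNReal.ofReal_div_of_pos hI]
    exact ENNReal.div_le_of_le_mul' (hdelay D hDL)
  unfold Policy.bayesRisk
  refine le_trans ?_ le_self_add
  refine le_trans ?_ le_add_self
  rw [mul_div_assoc, ENNReal.ofReal_mul hc]
  gcongr

end RiskLower

/-! ### Asymptotics -/

section Asymptotics

theorem tendsto_one_of_eventually_le {α : Type*} {l : Filter α} {F : α → ℝ≥0∞}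
    (h : ∀ η : ℝ, 0 < η → η < 1 →
      ∀ᶠ x in l, ENNReal.ofReal (1 - η) ≤ F x ∧ F x ≤ ENNReal.ofReal (1 + η)) :
    Tendsto F l (𝓝 1) := by
  have hη : ∀ᶠ η : ℝ in 𝓝[>] 0, 0 < η ∧ η < 1 :=
    Ioo_mem_nhdsGT one_pos
  rw [tendsto_order]
  constructor
  · intro a ha
    have h1 : Tendsto (fun η : ℝ => ENNReal.ofReal (1 - η)) (𝓝[>] 0) (𝓝 1) := by
      have : Tendsto (fun η : ℝ => ENNReal.ofReal (1 - η)) (𝓝 0) (𝓝 (ENNReal.ofReal (1 - 0))) :=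
        (ENNReal.continuous_ofReal.comp (continuous_const.sub continuous_id)).tendsto 0
      simp only [sub_zero, ENNReal.ofReal_one] at this
      exact this.mono_left nhdsWithin_le_nhds
    obtain ⟨η, h2, h3⟩ := ((h1.eventually_const_lt ha).and hη).exists
    filter_upwards [h η h3.1 h3.2] with x hx
    exact h2.trans_le hx.1
  · intro a ha
    have h1 : Tendsto (fun η : ℝ => ENNReal.ofReal (1 + η)) (𝓝[>] 0) (𝓝 1) := by
      have : Tendsto (fun η : ℝ => ENNReal.ofReal (1 + η)) (𝓝 0) (𝓝 (ENNReal.ofReal (1 + 0))) :=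
        (ENNReal.continuous_ofReal.comp (continuous_const.add continuous_id)).tendsto 0
      simp only [add_zero, ENNReal.ofReal_one] at this
      exact this.mono_left nhdsWithin_le_nhds
    obtain ⟨η, h2, h3⟩ := ((h1.eventually_lt_const ha).and hη).exists
    filter_upwards [h η h3.1 h3.2] with x hx
    exact hx.2.trans_lt h2

theorem tendsto_neg_log_nhdsGT_zero : Tendsto (fun c : ℝ => -Real.log c) (𝓝[>] 0) atTop :=
  tendsto_neg_atBot_atTop.comp Real.tendsto_log_nhdsGT_zero

theorem tendsto_neg_mul_log_nhdsGT_zero :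
    Tendsto (fun c : ℝ => -(c * Real.log c)) (𝓝[>] 0) (𝓝 0) := by
  have h := ((Real.continuous_mul_log.tendsto (0 : ℝ)).mono_left
    (nhdsWithin_le_nhds (s := Set.Ioi 0))).neg
  simp only [Real.log_zero, mul_zero, neg_zero] at h
  exact h

variable {M K L : ℕ} {Y : Type*} [MeasurableSpace Y] {f g : Measure Y} [IsProbabilityMeasure f]
  [IsProbabilityMeasure g] {R : OrderingRule M L} {π : Finset (Fin M) → ℝ≥0} {s : ℝ → ℝ}

/-- Errors and switchings cost O(c), and the delay costs `c` times (1 / I + η / (2 I)) (-log c) plus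
O(c). Since -log c tends to infinity, all O(c) terms fit into the other half of `η`. -/
theorem eventually_ccs_bayesRisk_le (hgf : klDiv g f ≠ ⊤) (hfg : klDiv f g ≠ ⊤)
    (hg : 0 < klReal g f) (hf : 0 < klReal f g) (hL : 1 ≤ L) (hLK : L ≤ K) (hKM : K ≤ M)
    (hLM : L < M) (hK2 : ¬ CaseOne f g M L → K ≤ M - L) (hR : ¬ CaseOne f g M L → R.IsStable)
    (hπ : ∑ D ∈ Finset.powersetCard L Finset.univ, π D = 1) (hs : s =O[𝓝[>] 0] fun c => c)
    {η : ℝ} (hη : 0 < η) :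
    ∀ᶠ c in 𝓝[>] 0, (ccs K f g R c).bayesRisk f g L π c (s c) ≤
      ENNReal.ofReal ((1 + η) * (-(c * Real.log c) / rate f g M K L)) := by
  have hI := rate_pos hL hLK hLM hg hf
  set I := rate f g M K L with hIdef
  obtain ⟨A, hA⟩ := exists_ccs_errorProb_le (R := R) hgf hfg hg hf hL hLK hLM hπ
  obtain ⟨S, hS⟩ := exists_ccs_expectedSwitchings_le (K := K) (R := R) hgf hfg hg hf hL hπ
  obtain ⟨B, hB0, hB⟩ := exists_ccs_expectedDelay_le hgf hfg hg hf hL hLK hKM hLM hK2 hR hπ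
    (show 0 < η / (2 * I) by positivity)
  obtain ⟨T, hT⟩ := hs.bound
  have hlog := tendsto_neg_log_nhdsGT_zero.eventually_ge_atTop
    (max 1 ((A + B + |T| * S) / (η / (2 * I))))
  filter_upwards [hT, hlog, self_mem_nhdsWithin] with c hTc hlogc hc
  have hc0 : (0 : ℝ) < c := hc
  have hb1 : 1 ≤ -Real.log c := (le_max_left _ _).trans hlogc
  have hb2 : A + B + |T| * S ≤ -Real.log c * (η / (2 * I)) := by
    rw [← div_le_iff₀ (by positivity)]
    exact (le_max_right _ _).trans hlogc
  have hsc : s c ≤ |T| * c := by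
    have h1 : |s c| ≤ T * |c| := by simpa using hTc
    rw [abs_of_pos hc0] at h1
    exact (le_abs_self _).trans (h1.trans (by gcongr; exact le_abs_self T))
  unfold Policy.bayesRisk
  calc _ ≤ (A : ℝ≥0∞) * ENNReal.ofReal c + ENNReal.ofReal c *
        ENNReal.ofReal (-Real.log c * (1 / I + η / (2 * I)) + B) +
        ENNReal.ofReal (|T| * c) * (S : ℝ≥0∞) := by
        gcongr
        · exact hA c hc0
        · exact hB c hb1
        · exact hS c
    _ = ENNReal.ofReal (A * c + c * (-Real.log c * (1 / I + η / (2 * I)) + B) +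
        |T| * c * S) := by
        rw [← ENNReal.ofReal_coe_nnreal, ← ENNReal.ofReal_coe_nnreal,
          ← ENNReal.ofReal_mul (by positivity), ← ENNReal.ofReal_mul (by positivity),
          ← ENNReal.ofReal_mul (by positivity), ← ENNReal.ofReal_add (by positivity)
            (by positivity), ← ENNReal.ofReal_add (by positivity) (by positivity)]
    _ ≤ _ := by
        refine ENNReal.ofReal_le_ofReal ?_
        have h1 : (1 + η) * (-(c * Real.log c) / I) =
            c * (-Real.log c * (1 / I + η / (2 * I)) + -Real.log c * (η / (2 * I))) := by
          field_simp
          ring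
        rw [h1]
        have h2 := mul_le_mul_of_nonneg_left hb2 hc0.le
        linarith

/-- The threshold `q` is chosen such that `q * p = -c log c / I`, with `p` a lower bound of the
prior. A policy with larger error probability pays the claimed risk by errors alone. For the others
the delay bound applies with -log q, which is asymptotic to -log c. The range of `c` does not depend
on the policy, as the infimum requires. -/
theorem eventually_le_bayesRisk (hgf : klDiv g f ≠ ⊤) (hfg : klDiv f g ≠ ⊤)
    (hg : 0 < klReal g f) (hf : 0 < klReal f g) (hL : 1 ≤ L) (hLK : L ≤ K) (hLM : L < M)
    (hπ_pos : ∀ D, D.card = L → 0 < π D)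
    (hπ : ∑ D ∈ Finset.powersetCard L Finset.univ, π D = 1) {η : ℝ} (hη : 0 < η) :
    ∀ᶠ c in 𝓝[>] 0, ∀ Γ : Policy M Y, Γ.IsAdmissible K →
      ENNReal.ofReal ((1 - η) * (-(c * Real.log c) / rate f g M K L)) ≤
        Γ.bayesRisk f g L π c (s c) := by
  have hI := rate_pos hL hLK hLM hg hf
  set I := rate f g M K L with hIdef
  obtain ⟨p, hp, hpπ⟩ : ∃ p : ℝ, 0 < p ∧ ∀ D : Finset (Fin M), D.card = L → p ≤ π D := by
    have hne : (Finset.powersetCard L (Finset.univ : Finset (Fin M))).Nonempty :=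
      Finset.powersetCard_nonempty.2 (by simpa using hLM.le)
    obtain ⟨D₀, hD₀, hmin⟩ := Finset.exists_min_image _ (fun D => π D) hne
    exact ⟨π D₀, by exact_mod_cast hπ_pos D₀ (Finset.mem_powersetCard.1 hD₀).2, fun D hD => by
      exact_mod_cast hmin D (Finset.mem_powersetCard.2 ⟨Finset.subset_univ D, hD⟩)⟩
  set q : ℝ → ℝ := fun c => -(c * Real.log c) * (1 / (I * p)) with hq
  have hq0 : Tendsto q (𝓝[>] 0) (𝓝 0) := by
    simpa only [zero_mul] using tendsto_neg_mul_log_nhdsGT_zero.mul_const (1 / (I * p))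
  have hloglog : Tendsto (fun c : ℝ => Real.log (-Real.log c) / -Real.log c) (𝓝[>] 0) (𝓝 0) :=
    Real.isLittleO_log_id_atTop.tendsto_div_nhds_zero.comp tendsto_neg_log_nhdsGT_zero
  have hinv : Tendsto (fun c : ℝ => (-Real.log c)⁻¹) (𝓝[>] 0) (𝓝 0) :=
    tendsto_inv_atTop_zero.comp tendsto_neg_log_nhdsGT_zero
  have hlim : Tendsto (fun c : ℝ => (1 - Real.log (-Real.log c) / -Real.log c -
      Real.log (1 / (I * p)) * (-Real.log c)⁻¹) * (1 - q c) - (-Real.log c)⁻¹)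
      (𝓝[>] 0) (𝓝 1) := by
    have := (((hloglog.const_sub 1).sub (hinv.const_mul (Real.log (1 / (I * p))))).mul
      (hq0.const_sub 1)).sub hinv
    simpa using this
  filter_upwards [hlim.eventually_const_lt (show 1 - η < 1 by linarith),
    hq0.eventually_lt_const one_pos, tendsto_neg_log_nhdsGT_zero.eventually_gt_atTop 0,
    self_mem_nhdsWithin] with c hlimc hq1 hb hc Γ hΓ
  have hc0 : (0 : ℝ) < c := hc
  have hqpos : 0 < q c := by
    have h1 : -(c * Real.log c) = c * -Real.log c := by ring
    simp only [hq, h1]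
    positivity
  by_cases herr : Γ.errorProb f g L π ≤ ENNReal.ofReal (q c * p)
  · refine le_trans (ENNReal.ofReal_le_ofReal ?_) (Γ.le_bayesRisk_of_errorProb_le hgf hfg hg hI hL
      hLM hπ hp hpπ hΓ (s := s c) hc0.le hqpos hq1.le herr)
    have h1 : Real.log (q c) = Real.log c + Real.log (-Real.log c) + Real.log (1 / (I * p)) := by
      have h2 : q c = c * -Real.log c * (1 / (I * p)) := by simp only [hq]; ring
      rw [h2, Real.log_mul (by positivity) (by positivity), Real.log_mul hc0.ne' hb.ne']
    have h3 : ((1 - Real.log (-Real.log c) / -Real.log c -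
        Real.log (1 / (I * p)) * (-Real.log c)⁻¹) * (1 - q c) - (-Real.log c)⁻¹) * -Real.log c =
        -Real.log (q c) * (1 - q c) - 1 := by
      rw [h1]
      generalize Real.log (1 / (I * p)) = x
      generalize Real.log (-Real.log c) = y
      generalize q c = z
      obtain ⟨w, hw⟩ : ∃ w, Real.log c = -w := ⟨-Real.log c, by ring⟩
      rw [hw, neg_neg] at hb ⊢
      field_simp
      ring
    have h4 := mul_le_mul_of_nonneg_right hlimc.le hb.le
    rw [h3] at h4
    calc (1 - η) * (-(c * Real.log c) / I) = c * ((1 - η) * -Real.log c) / I := by ring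
      _ ≤ c * (-Real.log (q c) * (1 - q c) - 1) / I := by gcongr
  · refine le_trans ?_ ((not_le.1 herr).le.trans ?_)
    · refine ENNReal.ofReal_le_ofReal ?_
      have h1 : q c * p = -(c * Real.log c) / I := by
        simp only [hq]
        field_simp
      rw [h1]
      have h2 : 0 ≤ -(c * Real.log c) / I := by
        have : -(c * Real.log c) = c * -Real.log c := by ring
        rw [this]
        positivity
      nlinarith
    · unfold Policy.bayesRisk
      rw [add_assoc]
      exact le_self_add

end Asymptotics

end AnomalySearch

end

/-! ### Assembly of the claims. -/

theorem theorem1 {Y : Type*} [MeasurableSpace Y]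
    (f g : Measure Y) [IsProbabilityMeasure f] [IsProbabilityMeasure g]
    (hne : f ≠ g) (hfg : klDiv f g ≠ ⊤) (hgf : klDiv g f ≠ ⊤)
    (M K L : ℕ) (hL : 1 ≤ L) (hLK : L ≤ K) (hKM : K ≤ M) (hLM : L < M)
    (hK2 : ¬ CaseOne f g M L → K ≤ M - L)
    (π : Finset (Fin M) → ℝ≥0) (hπ_pos : ∀ D, D.card = L → 0 < π D)
    (hπ_sum : ∑ D ∈ Finset.powersetCard L Finset.univ, π D = 1)
    (s : ℝ → ℝ) (hs_nonneg : ∀ c, 0 < c → 0 ≤ s c) (hs : s =O[𝓝[>] 0] fun c => c)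
    (R : OrderingRule M L) (hR : ¬ CaseOne f g M L → R.IsStable) :
    -- CCS is a policy for `K` probing machines
    (∀ c : ℝ, 0 < c → (ccs K f g R c).IsAdmissible K) ∧
    -- finite sample error bound
    (∃ A : ℝ≥0, ∀ c : ℝ, 0 < c →
      (ccs K f g R c).errorProb f g L π ≤ (A : ℝ≥0∞) * ENNReal.ofReal c) ∧
    -- bounded expected number of switchings
    (∃ B : ℝ≥0, ∀ c : ℝ, 0 < c → (ccs K f g R c).expectedSwitchings f g L π ≤ (B : ℝ≥0∞)) ∧
    -- asymptotic optimality
    Tendsto (fun c : ℝ => (ccs K f g R c).bayesRisk f g L π c (s c) /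
      ENNReal.ofReal (-(c * Real.log c) / rate f g M K L)) (𝓝[>] 0) (𝓝 1) ∧
    Tendsto (fun c : ℝ => ENNReal.ofReal (-(c * Real.log c) / rate f g M K L) /
      ⨅ (Γ : Policy M Y) (_ : Γ.IsAdmissible K), Γ.bayesRisk f g L π c (s c))
      (𝓝[>] 0) (𝓝 1) := by
  have hgpos : 0 < klReal g f := klReal_pos hne.symm hgf
  have hfpos : 0 < klReal f g := klReal_pos hne hfg
  have hI := rate_pos (K := K) hL hLK hLM hgpos hfpos
  have hupper := fun η hη => eventually_ccs_bayesRisk_le (s := s) (η := η) hgf hfg hgpos hfpos hL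
    hLK hKM hLM hK2 hR hπ_sum hs hη
  have hlower := fun η hη => eventually_le_bayesRisk (s := s) (η := η) hgf hfg hgpos hfpos hL
    hLK hLM hπ_pos hπ_sum hη
  have hadm : ∀ c, (ccs K f g R c).IsAdmissible K := fun c => ccs_isAdmissible hL hLK
  have hpos : ∀ᶠ c : ℝ in 𝓝[>] 0, 0 < -(c * Real.log c) / rate f g M K L := by
    filter_upwards [self_mem_nhdsWithin,
      tendsto_neg_log_nhdsGT_zero.eventually_gt_atTop 0] with c hc hb
    have hc0 : (0 : ℝ) < c := hc
    have : -(c * Real.log c) = c * -Real.log c := by ring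
    rw [this]
    positivity
  -- Used twice: for the risk of CCS and for the infimum, which inherits the lower bound from all
  -- policies and the upper bound from CCS.
  have hratio : ∀ F : ℝ → ℝ≥0∞,
      (∀ η : ℝ, 0 < η → ∀ᶠ c in 𝓝[>] 0,
        ENNReal.ofReal ((1 - η) * (-(c * Real.log c) / rate f g M K L)) ≤ F c) →
      (∀ η : ℝ, 0 < η → ∀ᶠ c in 𝓝[>] 0,
        F c ≤ ENNReal.ofReal ((1 + η) * (-(c * Real.log c) / rate f g M K L))) →
      Tendsto (fun c => F c / ENNReal.ofReal (-(c * Real.log c) / rate f g M K L))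
        (𝓝[>] 0) (𝓝 1) := by
    intro F h1 h2
    refine tendsto_one_of_eventually_le fun η hη hη1 => ?_
    filter_upwards [h1 η hη, h2 η hη, hpos] with c hc1 hc2 hc
    have hne0 : ENNReal.ofReal (-(c * Real.log c) / rate f g M K L) ≠ 0 := by simpa using hc
    rw [ENNReal.le_div_iff_mul_le (Or.inl hne0) (Or.inl ENNReal.ofReal_ne_top),
      ENNReal.div_le_iff hne0 ENNReal.ofReal_ne_top, ← ENNReal.ofReal_mul (by linarith),
      ← ENNReal.ofReal_mul (by linarith)]
    exact ⟨hc1, hc2⟩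
  refine ⟨fun c _ => hadm c, exists_ccs_errorProb_le hgf hfg hgpos hfpos hL hLK hLM hπ_sum, ?_,
    hratio _ (fun η hη => ?_) hupper, ?_⟩
  · obtain ⟨B, hB⟩ := exists_ccs_expectedSwitchings_le (K := K) (R := R) hgf hfg hgpos hfpos hL
      hπ_sum
    exact ⟨B, fun c _ => hB c⟩
  · filter_upwards [hlower η hη] with c hc
    exact hc _ (hadm c)
  · have h := hratio (fun c => ⨅ (Γ : Policy M Y) (_ : Γ.IsAdmissible K),
      Γ.bayesRisk f g L π c (s c)) (fun η hη => by
        filter_upwards [hlower η hη] with c hc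
        exact le_iInf₂ hc) (fun η hη => by
        filter_upwards [hupper η hη] with c hc
        exact (iInf₂_le (ccs K f g R c) (hadm c)).trans hc)
    -- For the infimum the ratio is stated the other way round, hence the inversion at the limit 1.
    have h' := ((continuous_inv (G := ℝ≥0∞)).tendsto 1).comp h
    rw [inv_one] at h'
    refine h'.congr' ?_
    filter_upwards [hpos] with c hc
    have hne0 : ENNReal.ofReal (-(c * Real.log c) / rate f g M K L) ≠ 0 := by simpa using hc
    exact ENNReal.inv_div (Or.inl ENNReal.ofReal_ne_top) (Or.inl hne0)
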